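/- Let $\mathbb T$ be the unit circle in $\mathbb C$ and $\mathbb D$ the open unit disk. For a (nondegenerate) subarc $I\subseteq\mathbb T$ put $|I|=\frac1{2\pi}\int_I|d\zeta|$, so that $|\mathbb T|=1$, and for $f\in L^1(\mathbb T)$ let $f_I=\frac1{2\pi|I|}\int_I f(\zeta)\,|d\zeta|$. For $1\le p<\infty$ and $\eta\ge 0$, the Campanato space $\mathcal L_{p,\eta}$ consists of all complex-valued $f\in L^p(\mathbb T)$ with $$\sup_{I\subseteq\mathbb T}\left(\frac1{|I|^{\eta}}\int_I|f(\zeta)-f_I|^p\,\frac{|d\zeta|}{2\pi}\right)^{1/p}<\infty,$$ the supremum being over all subarcs $I$ of $\mathbb T$. Let $$Pf(z)=\frac1{2\pi}\int_{\mathbb T}f(\zeta)\,\frac{1-|z|^2}{|\zeta-z|^2}\,|d\zeta|,\qquad z\in\mathbb D,$$ be the Poisson extension of $f$, and let $|\nabla Pf|^2=|\partial_xPf|^2+|\partial_yPf|^2$, where $z=x+iy$. Let $1<p<\infty$, $0<\eta<1+p$ and $f\in L^p(\mathbb T)$. Then $f\in\mathcal L_{p,\eta}$ if and only if $$\sup_{I\subseteq\mathbb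 T}\left(\frac1{|I|^{\eta}}\int_I\left(\int_{1-|I|}^1|\nabla Pf(r\zeta)|^2(1-r^2)\,dr\right)^{p/2}\frac{|d\zeta|}{2\pi}\right)^{1/p}<\infty,$$ the supremum being over all subarcs $I$ of $\mathbb T$. -/

import Mathlib

open MeasureTheory Set
open scoped ENNReal

noncomputable section

namespace Campanato

instance fact_two_pi_pos : Fact (0 < 2 * Real.pi) := ⟨Real.two_pi_pos⟩

/-- The unit circle, parametrized by the angle: `t` stands for `ζ = e^{it}`. -/
abbrev Torus : Type := AddCircle (2 * Real.pi)

/-- The point `ζ = e^{it}` of the complex plane. -/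
def point (t : Torus) : ℂ := (AddCircle.toCircle t : ℂ)

/-- Normalized arc length `|dζ| / 2π`, a probability measure. -/
def arcMeasure : Measure Torus := AddCircle.haarAddCircle

/-- Nondegenerate subarcs of the circle: images of bounded intervals (open, closed or half-open)
of length in `(0, 2π]`. -/
def IsArc (I : Set Torus) : Prop :=
  ∃ a b : ℝ, a < b ∧ b ≤ a + 2 * Real.pi ∧
    ∃ J : Set ℝ, Ioo a b ⊆ J ∧ J ⊆ Icc a b ∧ I = (fun x : ℝ => (x : Torus)) '' J

/-- The normalized length `|I|`. -/
def arcLength (I : Set Torus) : ℝ := arcMeasure.real I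

/-- The mean `f_I` of `f` over `I`. -/
def mean (f : Torus → ℂ) (I : Set Torus) : ℂ := ⨍ t in I, f t ∂arcMeasure

/-- The Campanato seminorm
`sup_I (|I|^{-η} ∫_I |f - f_I|^p |dζ|/2π)^{1/p}`, with values in `[0, ∞]`. -/
def campanatoSeminorm (p η : ℝ) (f : Torus → ℂ) : ℝ≥0∞ :=
  ⨆ (I : Set Torus) (_ : IsArc I),
    (ENNReal.ofReal (arcLength I ^ (-η)) *
      ∫⁻ t in I, ‖f t - mean f I‖ₑ ^ p ∂arcMeasure) ^ (1 / p)

/-- The Campanato space `L_{p,η}`. -/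
def campanatoSpace (p η : ℝ) : Set (Torus → ℂ) :=
  {f | MemLp f (ENNReal.ofReal p) arcMeasure ∧ campanatoSeminorm p η f < ∞}

/-- The Poisson extension `Pf(z) = ∫ f(ζ) (1 - |z|²) / |ζ - z|² |dζ|/2π` (used for `|z| < 1`). -/
def poissonExtension (f : Torus → ℂ) (z : ℂ) : ℂ :=
  ∫ t, (poissonKernel 0 z (point t) : ℂ) * f t ∂arcMeasure

/-- `|∇u(z)|² = |∂u/∂x|² + |∂u/∂y|²`, where `∂/∂x = ∂_z + ∂_z̄` and `∂/∂y = i (∂_z - ∂_z̄)`. -/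
def gradNormSq (u : ℂ → ℂ) (z : ℂ) : ℝ :=
  ‖fderiv ℝ u z 1‖ ^ 2 + ‖fderiv ℝ u z Complex.I‖ ^ 2

/-- The Littlewood–Paley seminorm
`sup_I (|I|^{-η} ∫_I (∫_{1-|I|}^1 |∇Pf(rζ)|² (1 - r²) dr)^{p/2} |dζ|/2π)^{1/p}`,
with values in `[0, ∞]`. -/
def littlewoodPaleySeminorm (p η : ℝ) (f : Torus → ℂ) : ℝ≥0∞ :=
  ⨆ (I : Set Torus) (_ : IsArc I),
    (ENNReal.ofReal (arcLength I ^ (-η)) *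
      ∫⁻ t in I,
        (∫⁻ r in Ioo (1 - arcLength I) 1,
          ENNReal.ofReal (gradNormSq (poissonExtension f) ((r : ℂ) * point t) * (1 - r ^ 2)))
            ^ (p / 2) ∂arcMeasure) ^ (1 / p)

end Campanato

end

open MeasureTheory Set
open scoped ENNReal

noncomputable section

namespace Campanato

/-! Both seminorms are finite exactly when certain integrals over the symmetric arcs `arc c ℓ` are
at most a constant times `ℓ ^ η`. The two implications between these bounds localize one global
fact, the boundedness of the Littlewood–Paley function on every `L^p`, `1 < p < ∞`: `∫ gsq f ^ (p/2)
≤ C ∫ |f|^p` (`exists_lintegral_gsq_rpow_le`).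

From Campanato to Littlewood–Paley (`exists_setLIntegral_gsqTrunc_le`): subtract the mean of `f`
over the doubled arc, which leaves the gradient unchanged, and split the rest into a part on the
doubled arc and a part off it. The first is handled by the global bound. For the second the gradient
kernel has size `1/|ζ - z|²`; on the dyadic annulus of scale `2^k ℓ` the means drift in a controlled
way, and the sum over `k` converges because `(η - 1)/p < 1`, that is `η < 1 + p`.

From Littlewood–Paley to Campanato (`exists_setLIntegral_oscillation_le`): the oscillation on an arc
is tested against a mean-zero `h` supported there, of controlled norm in the conjugate `L^q`. The
polarized Green formula (`enorm_integral_mul_le_gradient`) bounds the pairing by the integral of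
`|∇Pf| |∇Ph|` against `r log(1/r)`. Near the arc, Cauchy–Schwarz along radii, Hölder and the global
bound for `h` suffice. At distance `x` from the arc, cancellation gives `|∇Ph| ≲ ℓ x⁻³ ‖h‖₁`, and
the dyadic sum has ratio `2^((η-1)/p - 1) < 1`.

The global bound rests on a weighted inequality (`lintegral_weighted_energy`). For real harmonic `u`
and positive harmonic `v`, completing a square gives `Δ(u² v^(-s)) ≥ 2(1-s)/(1+s) |∇u|² v^(-s)`.
Green's formula, together with Cauchy–Schwarz and Jensen on the boundary, bounds the energy of `Pf`
weighted by `(Ph)^(-s)` by a multiple of `∫ |f|² h^(-s)`. If `p ≤ 2`, take `h = |f| + ε` and `s = 2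
- p`, and remove the weight with the maximal theorem. If `p > 2`, test `gsq f` against a function
`φ`. The Rubio de Francia algorithm gives `φ ≤ W^(b²)` with the maximal function of `W` at most a
multiple of `W`. Negative powers of such `W` satisfy a reverse Jensen inequality, so `h = W^(-b)`
and `s = b` is an admissible choice.

Green's formula is used in the coordinates `z = e^(x+it)`, where it is integration by parts on `x <
0` with period `2π` in `t`, and the weight `-x` becomes `r log(1/r)`. -/

instance : IsProbabilityMeasure arcMeasure := by unfold arcMeasure; infer_instance

/-! ### The circle, chords and the Poisson kernel. -/

@[simp] lemma norm_point (t : Torus) : ‖point t‖ = 1 := Circle.norm_coe _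

lemma point_ne_zero (t : Torus) : point t ≠ 0 := by
  rw [← norm_pos_iff]; simp

lemma continuous_point : Continuous point :=
  continuous_subtype_val.comp AddCircle.continuous_toCircle

lemma measurable_point : Measurable point := continuous_point.measurable

lemma point_coe (x : ℝ) : point (x : Torus) = Complex.exp (x * Complex.I) := by
  unfold point
  rw [AddCircle.toCircle_apply_mk]
  rw [div_self Real.two_pi_pos.ne', one_mul, Circle.coe_exp]

lemma point_mul_conj (t : Torus) : point t * (starRingEnd ℂ) (point t) = 1 := by
  rw [Complex.mul_conj, Complex.normSq_eq_norm_sq]; simp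

lemma conj_mul_point (t : Torus) : (starRingEnd ℂ) (point t) * point t = 1 := by
  rw [mul_comm, point_mul_conj]

lemma circleAverage_eq_integral {E : Type*} [NormedAddCommGroup E] [NormedSpace ℝ E]
    (g : ℂ → E) (r : ℝ) :
    Real.circleAverage g 0 r = ∫ t, g (r * point t) ∂arcMeasure := by
  unfold arcMeasure
  rw [AddCircle.integral_haarAddCircle, ← AddCircle.intervalIntegral_preimage (2 * Real.pi) 0,
    Real.circleAverage_def]
  simp [point_coe, circleMap]

/-- The Poisson kernel of the unit disk, as a function of the angle. -/
def ker (z : ℂ) (t : Torus) : ℝ := poissonKernel 0 z (point t)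

lemma ker_eq (z : ℂ) (t : Torus) : ker z t = (1 - ‖z‖ ^ 2) / ‖point t - z‖ ^ 2 := by
  simp [ker, poissonKernel_def]

lemma one_sub_norm_le (z : ℂ) (t : Torus) : 1 - ‖z‖ ≤ ‖point t - z‖ := by
  have := norm_sub_norm_le (point t) z
  simpa using this

lemma norm_point_sub_pos {z : ℂ} (hz : ‖z‖ < 1) (t : Torus) : 0 < ‖point t - z‖ :=
  lt_of_lt_of_le (by linarith) (one_sub_norm_le z t)

lemma ker_pos {z : ℂ} (hz : ‖z‖ < 1) (t : Torus) : 0 < ker z t := by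
  rw [ker_eq]
  have := norm_point_sub_pos hz t
  have h0 := norm_nonneg z
  have : 0 < 1 - ‖z‖ ^ 2 := by nlinarith
  positivity

lemma continuous_ker {z : ℂ} (hz : ‖z‖ < 1) : Continuous (ker z) := by
  have : ker z = fun t => (1 - ‖z‖ ^ 2) / ‖point t - z‖ ^ 2 := funext (ker_eq z)
  rw [this]
  refine Continuous.div continuous_const ?_ fun t => ?_
  · exact ((continuous_point.sub continuous_const).norm).pow 2
  · exact (pow_pos (norm_point_sub_pos hz t) 2).ne'

lemma measurable_ker : Measurable fun q : ℂ × Torus => ker q.1 q.2 := by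
  simp only [ker_eq]
  have := measurable_point
  fun_prop

lemma ker_le {z : ℂ} (hz : ‖z‖ < 1) (t : Torus) : ker z t ≤ 2 / (1 - ‖z‖) := by
  rw [ker_eq, div_le_div_iff₀ (pow_pos (norm_point_sub_pos hz t) 2) (by linarith)]
  have h := one_sub_norm_le z t
  have h0 := norm_nonneg z
  have : (1 - ‖z‖) ^ 2 ≤ ‖point t - z‖ ^ 2 := pow_le_pow_left₀ (by linarith) h 2
  nlinarith

/-- A Harnack inequality for the Poisson kernel. -/
lemma ker_le_harnack {z w : ℂ} (hz : ‖z‖ < 1) (hw : ‖w‖ < 1) (t : Torus) :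
    ker z t ≤ (1 - ‖z‖ ^ 2) / (1 - ‖w‖ ^ 2) * (1 + ‖z - w‖ / (1 - ‖z‖)) ^ 2 * ker w t := by
  rw [ker_eq, ker_eq]
  have h1 := norm_point_sub_pos hz t
  have h2 := norm_point_sub_pos hw t
  have h3 : 0 < 1 - ‖z‖ ^ 2 := by nlinarith [norm_nonneg z]
  have h4 : 0 < 1 - ‖w‖ ^ 2 := by nlinarith [norm_nonneg w]
  have h5 : 0 < 1 - ‖z‖ := by linarith
  have key : ‖point t - w‖ ≤ (1 + ‖z - w‖ / (1 - ‖z‖)) * ‖point t - z‖ := by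
    have e : point t - w = (point t - z) + (z - w) := by ring
    calc ‖point t - w‖ ≤ ‖point t - z‖ + ‖z - w‖ := by rw [e]; exact norm_add_le _ _
      _ = ‖point t - z‖ + ‖z - w‖ / (1 - ‖z‖) * (1 - ‖z‖) := by field_simp
      _ ≤ ‖point t - z‖ + ‖z - w‖ / (1 - ‖z‖) * ‖point t - z‖ := by
          gcongr; exact one_sub_norm_le z t
      _ = _ := by ring
  have key2 : ‖point t - w‖ ^ 2 ≤ ((1 + ‖z - w‖ / (1 - ‖z‖)) * ‖point t - z‖) ^ 2 :=
    pow_le_pow_left₀ (norm_nonneg _) key 2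
  set a := (1 + ‖z - w‖ / (1 - ‖z‖)) with ha
  have e1 : (1 - ‖z‖ ^ 2) / (1 - ‖w‖ ^ 2) * a ^ 2 * ((1 - ‖w‖ ^ 2) / ‖point t - w‖ ^ 2)
      = (1 - ‖z‖ ^ 2) * a ^ 2 / ‖point t - w‖ ^ 2 := by
    field_simp
  rw [e1, div_le_div_iff₀ (by positivity) (by positivity)]
  calc (1 - ‖z‖ ^ 2) * ‖point t - w‖ ^ 2 ≤ (1 - ‖z‖ ^ 2) * (a * ‖point t - z‖) ^ 2 := by gcongr
    _ = _ := by ring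

lemma norm_mul_point (r : ℝ) (t : Torus) : ‖(r : ℂ) * point t‖ = |r| := by simp

lemma norm_mul_point_lt {r : ℝ} (hr : r ∈ Ioo (0 : ℝ) 1) (t : Torus) :
    ‖(r : ℂ) * point t‖ < 1 := by
  rw [norm_mul_point, abs_of_pos hr.1]; exact hr.2

/-- Expanding the square separates the radial distance from the chord. Hence the kernel at `r *
point s` is symmetric in the two angles, and for `r ≥ 0` it decreases with their distance. -/
lemma norm_point_sub_mul_point (r : ℝ) (s t : Torus) :
    ‖point t - r * point s‖ ^ 2 = (1 - r) ^ 2 + r * ‖point t - point s‖ ^ 2 := by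
  have h1 := norm_point t
  have h2 := norm_point s
  rw [← Complex.normSq_eq_norm_sq, ← Complex.normSq_eq_norm_sq]
  have e1 : Complex.normSq (point t) = 1 := by rw [Complex.normSq_eq_norm_sq, h1]; norm_num
  have e2 : Complex.normSq (point s) = 1 := by rw [Complex.normSq_eq_norm_sq, h2]; norm_num
  rw [Complex.normSq_apply] at *
  rw [Complex.normSq_apply] at *
  simp only [Complex.sub_re, Complex.sub_im, Complex.mul_re, Complex.mul_im, Complex.ofReal_re,
    Complex.ofReal_im, zero_mul, sub_zero, add_zero]
  linear_combination (1 - r) * e1 + (r ^ 2 - r) * e2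

lemma ker_symm (r : ℝ) (s t : Torus) : ker (r * point s) t = ker (r * point t) s := by
  rw [ker_eq, ker_eq, norm_point_sub_mul_point, norm_point_sub_mul_point, norm_mul_point,
    norm_mul_point, norm_sub_rev]

lemma integral_ker {z : ℂ} (hz : ‖z‖ < 1) : ∫ t, ker z t ∂arcMeasure = 1 := by
  have h := DiffContOnCl.circleAverage_poissonKernel_smul (f := fun _ : ℂ => (1 : ℂ)) (c := 0)
    (R := 1) (w := z) diffContOnCl_const (by simpa using hz)
  rw [circleAverage_eq_integral] at h
  simp only [Complex.ofReal_one, one_mul, Pi.smul_apply', Complex.real_smul, mul_one] at h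
  rw [integral_complex_ofReal] at h
  exact_mod_cast h

lemma integrable_ker {z : ℂ} (hz : ‖z‖ < 1) : Integrable (ker z) arcMeasure := by
  refine Integrable.of_bound (continuous_ker hz).aestronglyMeasurable (2 / (1 - ‖z‖)) ?_
  filter_upwards with t
  rw [Real.norm_of_nonneg (ker_pos hz t).le]
  exact ker_le hz t

lemma lintegral_ker {z : ℂ} (hz : ‖z‖ < 1) : ∫⁻ t, ENNReal.ofReal (ker z t) ∂arcMeasure = 1 := by
  rw [← ofReal_integral_eq_lintegral_ofReal (integrable_ker hz)
    (.of_forall fun t => (ker_pos hz t).le), integral_ker hz, ENNReal.ofReal_one]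

lemma one_sub_mul_ne_zero {z w : ℂ} (hz : ‖z‖ < 1) (hw : ‖w‖ = 1) : 1 - z * w ≠ 0 := by
  intro h
  have h1 : z * w = 1 := by linear_combination -h
  have h2 : ‖z * w‖ = 1 := by rw [h1]; simp
  rw [norm_mul, hw, mul_one] at h2
  linarith

lemma norm_one_sub_mul_conj_point (z : ℂ) (t : Torus) :
    ‖1 - z * (starRingEnd ℂ) (point t)‖ = ‖point t - z‖ := by
  have : 1 - z * (starRingEnd ℂ) (point t) = (starRingEnd ℂ) (point t) * (point t - z) := by
    rw [mul_sub, conj_mul_point]; ring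
  rw [this, norm_mul]; simp

/-- The geometric series in `z ζ̄` and its conjugate, with the constant term counted twice. It
splits every Poisson extension into an analytic and an antianalytic part, which are easier to
differentiate. -/
lemma ker_eq_cauchy {z : ℂ} (hz : ‖z‖ < 1) (t : Torus) :
    (ker z t : ℂ) = 1 / (1 - z * (starRingEnd ℂ) (point t)) +
      1 / (1 - (starRingEnd ℂ) z * point t) - 1 := by
  have h1 : 1 - z * (starRingEnd ℂ) (point t) ≠ 0 := one_sub_mul_ne_zero hz (by simp)
  have h2 : 1 - (starRingEnd ℂ) z * point t ≠ 0 := one_sub_mul_ne_zero (by simpa) (by simp)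
  have e : ((‖point t - z‖ ^ 2 : ℝ) : ℂ) =
      (1 - z * (starRingEnd ℂ) (point t)) * (1 - (starRingEnd ℂ) z * point t) := by
    rw [← norm_one_sub_mul_conj_point, ← Complex.normSq_eq_norm_sq, ← Complex.mul_conj]
    simp
  have e2 : ((‖z‖ ^ 2 : ℝ) : ℂ) = z * (starRingEnd ℂ) z := by
    rw [← Complex.normSq_eq_norm_sq, ← Complex.mul_conj]
  rw [ker_eq, Complex.ofReal_div, e, Complex.ofReal_sub, e2, Complex.ofReal_one]
  field_simp
  linear_combination ((starRingEnd ℂ) z * z) * point_mul_conj t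

lemma exists_real_rep (u : Torus) : ∃ x : ℝ, (x : Torus) = u ∧ |x| ≤ Real.pi ∧ ‖u‖ = |x| := by
  have h : u ∈ (fun x : ℝ => (x : Torus)) '' Ioc (-Real.pi) (-Real.pi + 2 * Real.pi) := by
    rw [show (fun x : ℝ => (x : Torus)) = QuotientAddGroup.mk from rfl,
      AddCircle.coe_image_Ioc_eq]; trivial
  obtain ⟨x, hx, rfl⟩ := h
  have hx' : |x| ≤ Real.pi := abs_le.2 ⟨hx.1.le, by linarith [hx.2]⟩
  refine ⟨x, rfl, hx', (AddCircle.norm_coe_eq_abs_iff _ Real.two_pi_pos.ne').2 ?_⟩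
  rw [abs_of_pos Real.two_pi_pos]; linarith

lemma norm_le_pi (u : Torus) : ‖u‖ ≤ Real.pi := by
  obtain ⟨x, rfl, h1, h2⟩ := exists_real_rep u
  rwa [h2]

lemma point_add (s t : Torus) : point (s + t) = point s * point t := by
  unfold point; rw [AddCircle.toCircle_add]; rfl

lemma norm_point_sub_point (s t : Torus) :
    ‖point s - point t‖ = 2 * Real.sin (‖s - t‖ / 2) := by
  have e : point s - point t = (point (s - t) - 1) * point t := by
    rw [sub_mul, ← point_add, one_mul, sub_add_cancel]
  rw [e, norm_mul, norm_point, mul_one]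
  obtain ⟨x, hx, h1, h2⟩ := exists_real_rep (s - t)
  rw [h2, ← hx, point_coe, mul_comm, Complex.norm_exp_I_mul_ofReal_sub_one, norm_mul]
  rw [Real.norm_of_nonneg (by norm_num : (0 : ℝ) ≤ 2), Real.norm_eq_abs]
  congr 1
  rcases abs_cases x with ⟨h, hx0⟩ | ⟨h, hx0⟩
  · rw [h]
    exact abs_of_nonneg (Real.sin_nonneg_of_nonneg_of_le_pi (by linarith) (by linarith [Real.pi_pos]))
  · rw [h, neg_div, Real.sin_neg]
    apply abs_of_nonpos
    apply Real.sin_nonpos_of_nonpos_of_neg_pi_le (by linarith) (by linarith [Real.pi_pos])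

/-- Chord and arc are comparable. -/
lemma norm_sub_le_chord (s t : Torus) : 2 / Real.pi * ‖s - t‖ ≤ ‖point s - point t‖ := by
  rw [norm_point_sub_point]
  have h1 := norm_le_pi (s - t)
  have := Real.mul_le_sin (x := ‖s - t‖ / 2) (by positivity) (by linarith)
  calc 2 / Real.pi * ‖s - t‖ = 2 * (2 / Real.pi * (‖s - t‖ / 2)) := by ring
    _ ≤ _ := by linarith

lemma chord_le_norm_sub (s t : Torus) : ‖point s - point t‖ ≤ ‖s - t‖ := by
  rw [norm_point_sub_point]
  have := Real.sin_le (x := ‖s - t‖ / 2) (by positivity)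
  linarith

lemma arcMeasure_eq : arcMeasure = ENNReal.ofReal (2 * Real.pi)⁻¹ • (volume : Measure Torus) := by
  rw [AddCircle.volume_eq_smul_haarAddCircle, smul_smul, ← ENNReal.ofReal_mul (by positivity),
    inv_mul_cancel₀ Real.two_pi_pos.ne', ENNReal.ofReal_one, one_smul]
  rfl

lemma arcMeasure_closedBall (t : Torus) (ρ : ℝ) :
    arcMeasure (Metric.closedBall t ρ) = ENNReal.ofReal (min 1 (ρ / Real.pi)) := by
  rw [arcMeasure_eq, Measure.smul_apply, AddCircle.volume_closedBall, smul_eq_mul,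
    ← ENNReal.ofReal_mul (by positivity)]
  congr 1
  have : (0 : ℝ) ≤ (2 * Real.pi)⁻¹ := by positivity
  rw [mul_min_of_nonneg _ _ this, inv_mul_cancel₀ Real.two_pi_pos.ne']
  congr 1
  field_simp

/-! ### Cauchy integrals and the gradient of the Poisson extension. -/

section

/-- The Cauchy-type integral `∫ f / (1 - z e)`. -/
def cauchyInt (e f : Torus → ℂ) (z : ℂ) : ℂ := ∫ t, f t / (1 - z * e t) ∂arcMeasure

/-- The derivative of `cauchyInt e f`. -/
def cauchyDeriv (e f : Torus → ℂ) (z : ℂ) : ℂ :=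
  ∫ t, f t * (e t / (1 - z * e t) ^ 2) ∂arcMeasure

variable {e f g : Torus → ℂ} {z : ℂ}

lemma one_sub_norm_le_norm_one_sub_mul {w : ℂ} (z : ℂ) (hw : ‖w‖ = 1) :
    1 - ‖z‖ ≤ ‖1 - z * w‖ := by
  have := norm_sub_norm_le (1 : ℂ) (z * w)
  simpa [hw] using this

lemma norm_cauchyDeriv_kernel_le (he1 : ∀ t, ‖e t‖ = 1) (hz : ‖z‖ < 1) (t : Torus) :
    ‖e t / (1 - z * e t) ^ 2‖ ≤ 1 / (1 - ‖z‖) ^ 2 := by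
  have h := one_sub_norm_le_norm_one_sub_mul z (he1 t)
  rw [norm_div, he1, norm_pow]
  have : 0 < 1 - ‖z‖ := by linarith
  gcongr

lemma integrable_mul_cauchyDeriv_kernel (he : Measurable e) (he1 : ∀ t, ‖e t‖ = 1)
    (hf : Integrable f arcMeasure) (hz : ‖z‖ < 1) :
    Integrable (fun t => f t * (e t / (1 - z * e t) ^ 2)) arcMeasure := by
  refine hf.mul_bdd (c := 1 / (1 - ‖z‖) ^ 2) (Measurable.aestronglyMeasurable (by fun_prop)) ?_
  exact .of_forall (norm_cauchyDeriv_kernel_le he1 hz)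

lemma integrable_div_one_sub_mul (he : Measurable e) (he1 : ∀ t, ‖e t‖ = 1)
    (hf : Integrable f arcMeasure) (hz : ‖z‖ < 1) :
    Integrable (fun t => f t / (1 - z * e t)) arcMeasure := by
  simp_rw [div_eq_mul_inv]
  refine hf.mul_bdd (c := 1 / (1 - ‖z‖)) (Measurable.aestronglyMeasurable (by fun_prop)) ?_
  filter_upwards with t
  have h := one_sub_norm_le_norm_one_sub_mul z (he1 t)
  have : 0 < 1 - ‖z‖ := by linarith
  rw [norm_inv, ← one_div]
  gcongr

lemma hasDerivAt_cauchyInt (he : Measurable e) (he1 : ∀ t, ‖e t‖ = 1)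
    (hf : Integrable f arcMeasure) (hz : ‖z‖ < 1) :
    HasDerivAt (cauchyInt e f) (cauchyDeriv e f z) z := by
  set d := (1 - ‖z‖) / 2 with hd
  have hd0 : 0 < d := by rw [hd]; linarith
  have hball : ∀ w ∈ Metric.ball z d, ‖w‖ < 1 ∧ d ≤ 1 - ‖w‖ := by
    intro w hw
    rw [mem_ball_iff_norm] at hw
    have := norm_sub_norm_le w z
    constructor <;> linarith
  refine (hasDerivAt_integral_of_dominated_loc_of_deriv_le (s := Metric.ball z d)
    (bound := fun t => ‖f t‖ * (1 / d ^ 2)) (F := fun w t => f t / (1 - w * e t))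
    (F' := fun w t => f t * (e t / (1 - w * e t) ^ 2)) (Metric.ball_mem_nhds z hd0)
    ?_ ?_ ?_ ?_ ?_ ?_).2
  · filter_upwards with w
    simp_rw [div_eq_mul_inv]
    exact hf.aestronglyMeasurable.mul
      (Measurable.aestronglyMeasurable (((he.const_mul w).const_sub 1).inv))
  · exact integrable_div_one_sub_mul he he1 hf hz
  · exact (integrable_mul_cauchyDeriv_kernel he he1 hf hz).aestronglyMeasurable
  · filter_upwards with t w hw
    rw [norm_mul]
    have h := hball w hw
    refine mul_le_mul_of_nonneg_left ((norm_cauchyDeriv_kernel_le he1 h.1 t).trans ?_)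
      (norm_nonneg _)
    have := h.2
    gcongr
  · exact hf.norm.mul_const _
  · filter_upwards with t w hw
    have h := hball w hw
    have h1 := one_sub_mul_ne_zero h.1 (he1 t)
    have h2 : HasDerivAt (fun w => 1 - w * e t) (-(e t)) w := by
      simpa using ((hasDerivAt_id w).mul_const (e t)).const_sub 1
    have h3 := (hasDerivAt_const w (f t)).div h2 h1
    refine HasDerivAt.congr_deriv (f := fun w => f t / (1 - w * e t)) h3 ?_
    simp only [zero_mul, zero_sub, mul_neg, neg_neg, mul_div_assoc]

/-- The conjugate of the boundary point. -/
def cpoint (t : Torus) : ℂ := (starRingEnd ℂ) (point t)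

lemma measurable_cpoint : Measurable cpoint :=
  (Complex.continuous_conj.comp continuous_point).measurable

@[simp] lemma norm_cpoint (t : Torus) : ‖cpoint t‖ = 1 := by simp [cpoint]

/-- The analytic part of the Poisson extension. -/
def anaPart (f : Torus → ℂ) : ℂ → ℂ := cauchyInt cpoint f

/-- The antianalytic part of the Poisson extension, as an analytic function of `conj z`. -/
def coanaPart (f : Torus → ℂ) : ℂ → ℂ := cauchyInt point f

/-- Derivative of the analytic part. -/
def anaDeriv (f : Torus → ℂ) : ℂ → ℂ := cauchyDeriv cpoint f

/-- Derivative of the antianalytic part. -/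
def coanaDeriv (f : Torus → ℂ) : ℂ → ℂ := cauchyDeriv point f

lemma hasDerivAt_anaPart (hf : Integrable f arcMeasure) (hz : ‖z‖ < 1) :
    HasDerivAt (anaPart f) (anaDeriv f z) z :=
  hasDerivAt_cauchyInt measurable_cpoint norm_cpoint hf hz

lemma hasDerivAt_coanaPart (hf : Integrable f arcMeasure) (hz : ‖z‖ < 1) :
    HasDerivAt (coanaPart f) (coanaDeriv f z) z :=
  hasDerivAt_cauchyInt measurable_point norm_point hf hz

lemma poissonExtension_eq (hf : Integrable f arcMeasure) (hz : ‖z‖ < 1) :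
    poissonExtension f z =
      anaPart f z + coanaPart f ((starRingEnd ℂ) z) - ∫ t, f t ∂arcMeasure := by
  have i1 := integrable_div_one_sub_mul measurable_cpoint norm_cpoint hf hz
  have i2 := integrable_div_one_sub_mul measurable_point norm_point hf
    (z := (starRingEnd ℂ) z) (by simpa)
  unfold poissonExtension anaPart coanaPart cauchyInt
  rw [← integral_add i1 i2]
  erw [← integral_sub (i1.add i2) hf]
  refine integral_congr_ae (.of_forall fun t => ?_)
  change (ker z t : ℂ) * f t = _
  rw [ker_eq_cauchy hz]
  simp only [cpoint, Pi.add_apply]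
  ring

lemma fderiv_poissonExtension (hf : Integrable f arcMeasure) (hz : ‖z‖ < 1) (v : ℂ) :
    fderiv ℝ (poissonExtension f) z v =
      anaDeriv f z * v + coanaDeriv f ((starRingEnd ℂ) z) * (starRingEnd ℂ) v := by
  have h1 := (hasDerivAt_anaPart hf hz).hasFDerivAt.restrictScalars ℝ
  have h2 := (hasDerivAt_coanaPart hf (z := (starRingEnd ℂ) z)
    (by simpa)).hasFDerivAt.restrictScalars ℝ
  have h3 : HasFDerivAt (fun w => (starRingEnd ℂ) w)
    (Complex.conjCLE : ℂ →L[ℝ] ℂ) z := Complex.conjCLE.toContinuousLinearMap.hasFDerivAt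
  have h6 : HasFDerivAt (fun w => coanaPart f ((starRingEnd ℂ) w)) _ z :=
    HasFDerivAt.comp (𝕜 := ℝ) z h2 h3
  have h4 := (h1.add h6).sub_const (∫ t, f t ∂arcMeasure)
  have h5 := h4.congr_of_eventuallyEq (f₁ := poissonExtension f) <| by
    have : Metric.ball (0 : ℂ) 1 ∈ nhds z := Metric.isOpen_ball.mem_nhds (by simpa using hz)
    filter_upwards [this] with w hw
    exact poissonExtension_eq hf (by simpa using hw)
  rw [h5.fderiv]
  simp [mul_comm]

/-- With `a` and `b` the derivatives of the two parts, the partial derivatives are `a + b` and `i(a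
- b)`; the parallelogram law removes the cross term. -/
lemma gradNormSq_poissonExtension (hf : Integrable f arcMeasure) (hz : ‖z‖ < 1) :
    gradNormSq (poissonExtension f) z =
      2 * (‖anaDeriv f z‖ ^ 2 + ‖coanaDeriv f ((starRingEnd ℂ) z)‖ ^ 2) := by
  unfold gradNormSq
  rw [fderiv_poissonExtension hf hz, fderiv_poissonExtension hf hz]
  generalize anaDeriv f z = a
  generalize coanaDeriv f ((starRingEnd ℂ) z) = b
  simp only [map_one, mul_one, Complex.conj_I]
  simp only [← Complex.normSq_eq_norm_sq, Complex.normSq_apply]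
  simp
  ring

end

/-! ### Poisson integrals of nonnegative functions and the radial maximal function. -/

section

/-- The Poisson integral of an `[0, ∞]`-valued function. -/
def poissonL (ψ : Torus → ℝ≥0∞) (z : ℂ) : ℝ≥0∞ :=
  ∫⁻ t, ENNReal.ofReal (ker z t) * ψ t ∂arcMeasure

variable {φ ψ : Torus → ℝ≥0∞} {z : ℂ}

lemma measurable_ofReal_ker (z : ℂ) : Measurable fun t => ENNReal.ofReal (ker z t) := by
  have : Measurable fun t => ker z t := by
    simp only [ker_eq]
    have := measurable_point
    fun_prop
  exact this.ennreal_ofReal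

lemma measurable_poissonL (hψ : Measurable ψ) : Measurable (poissonL ψ) :=
  Measurable.lintegral_prod_right' (f := fun q : ℂ × Torus => ENNReal.ofReal (ker q.1 q.2) * ψ q.2)
    (measurable_ker.ennreal_ofReal.mul (hψ.comp measurable_snd))

lemma poissonL_mono (h : φ ≤ ψ) (z : ℂ) : poissonL φ z ≤ poissonL ψ z :=
  lintegral_mono fun t => mul_le_mul_right (h t) _

lemma poissonL_const (c : ℝ≥0∞) (hz : ‖z‖ < 1) : poissonL (fun _ => c) z = c := by
  unfold poissonL
  rw [lintegral_mul_const _ (measurable_ofReal_ker z), lintegral_ker hz, one_mul]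

lemma poissonL_add (hφ : Measurable φ) (z : ℂ) :
    poissonL (fun t => φ t + ψ t) z = poissonL φ z + poissonL ψ z := by
  unfold poissonL
  simp_rw [mul_add]
  exact lintegral_add_left ((measurable_ofReal_ker z).mul hφ) _

lemma poissonL_const_mul (c : ℝ≥0∞) (hψ : Measurable ψ) (z : ℂ) :
    poissonL (fun t => c * ψ t) z = c * poissonL ψ z := by
  unfold poissonL
  have := lintegral_const_mul (μ := arcMeasure) c ((measurable_ofReal_ker z).mul hψ)
  simp only [Pi.mul_apply] at this
  rw [← this]
  exact lintegral_congr fun t => by ring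

lemma poissonL_tsum {F : ℕ → Torus → ℝ≥0∞} (hF : ∀ n, Measurable (F n)) (z : ℂ) :
    poissonL (fun t => ∑' n, F n t) z = ∑' n, poissonL (F n) z := by
  unfold poissonL
  have := lintegral_tsum (μ := arcMeasure)
    fun n => ((measurable_ofReal_ker z).mul (hF n)).aemeasurable
  simp only [Pi.mul_apply] at this
  rw [← this]
  exact lintegral_congr fun t => ENNReal.tsum_mul_left.symm

/-- Tonelli and `ker_symm`: integrating the kernel in its other variable again gives mass one. -/
lemma lintegral_poissonL (hψ : Measurable ψ) {r : ℝ} (hr0 : 0 ≤ r) (hr1 : r < 1) :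
    ∫⁻ t, poissonL ψ (r * point t) ∂arcMeasure = ∫⁻ t, ψ t ∂arcMeasure := by
  unfold poissonL
  rw [lintegral_lintegral_swap]
  · refine lintegral_congr fun s => ?_
    simp_rw [ker_symm r _ s]
    rw [lintegral_mul_const _ (measurable_ofReal_ker _), lintegral_ker, one_mul]
    rw [norm_mul_point, abs_of_nonneg hr0]; exact hr1
  · refine Measurable.aemeasurable ?_
    refine Measurable.mul ?_ (hψ.comp measurable_snd)
    have : Measurable fun q : Torus × Torus => ((r : ℂ) * point q.1, q.2) :=
      ((measurable_point.comp measurable_fst).const_mul _).prodMk measurable_snd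
    exact (measurable_ker.comp this).ennreal_ofReal

lemma closedBall_ae_eq_ball (t : Torus) (ρ : ℝ) :
    Metric.closedBall t ρ =ᵐ[arcMeasure] Metric.ball t ρ := by
  rw [arcMeasure_eq]
  exact Measure.ae_smul_measure AddCircle.closedBall_ae_eq_ball _

/-- If all averages of `ψ` over balls centered at `t` are at most `a`, so are the radial values
of its Poisson integral. -/
lemma poissonL_le_of_average_le (hψ : Measurable ψ) (t : Torus) (a : ℝ≥0∞)
    (h : ∀ ρ : ℝ, 0 < ρ → ∫⁻ s in Metric.closedBall t ρ, ψ s ∂arcMeasure ≤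
      a * arcMeasure (Metric.closedBall t ρ)) {r : ℝ} (hr0 : 0 ≤ r) (hr1 : r < 1) :
    poissonL ψ (r * point t) ≤ a := by
  set z : ℂ := r * point t with hz
  have hz1 : ‖z‖ < 1 := by rw [hz, norm_mul_point, abs_of_nonneg hr0]; exact hr1
  have hm : Measurable (ker z) := (continuous_ker hz1).measurable
  have h0 : ∀ s, 0 ≤ ker z s := fun s => (ker_pos hz1 s).le
  have e1 : poissonL ψ z = ∫⁻ s, ENNReal.ofReal (ker z s) ∂(arcMeasure.withDensity ψ) := by
    rw [lintegral_withDensity_eq_lintegral_mul _ hψ (measurable_ofReal_ker z)]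
    exact lintegral_congr fun s => mul_comm _ _
  -- Layer cake: it suffices to compare, level by level, the `ψ`-mass of a superlevel set of the
  -- kernel with its arc measure, since these measures integrate to the total mass one of the
  -- kernel.
  rw [e1, lintegral_eq_lintegral_meas_lt _ (.of_forall h0) hm.aemeasurable]
  have e2 := lintegral_ker hz1
  rw [lintegral_eq_lintegral_meas_lt _ (.of_forall h0) hm.aemeasurable] at e2
  calc _ ≤ ∫⁻ b in Ioi 0, a * arcMeasure {s | b < ker z s} := ?_
    _ ≤ a * 1 := by
      rw [← e2, lintegral_const_mul]
      exact Antitone.measurable fun x y hxy =>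
        measure_mono fun s (hs : y < ker z s) => lt_of_le_of_lt hxy hs
    _ = a := mul_one a
  refine lintegral_mono fun b => ?_
  rw [withDensity_apply _ (measurableSet_lt measurable_const hm)]
  set S := {s | b < ker z s} with hS
  -- The kernel decreases with the angle to `t`, so a nonempty `S` lies between the open and the
  -- closed ball of the same radius about `t`.
  have hrad : ∀ s s', s ∈ S → ‖s' - t‖ ≤ ‖s - t‖ → s' ∈ S := by
    intro s s' hs hle
    refine lt_of_lt_of_le (show b < ker z s from hs) ?_
    rw [ker_eq, ker_eq]
    have hc : ‖point s' - point t‖ ≤ ‖point s - point t‖ := by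
      rw [norm_point_sub_point, norm_point_sub_point]
      have := Real.sin_le_sin_of_le_of_le_pi_div_two
        (x := ‖s' - t‖ / 2) (y := ‖s - t‖ / 2) (by linarith [norm_nonneg (s' - t), Real.pi_pos])
        (by linarith [norm_le_pi (s - t)]) (by linarith)
      linarith
    have h3 : 0 < 1 - ‖z‖ ^ 2 := by nlinarith [norm_nonneg z]
    have h4 := norm_point_sub_pos hz1 s'
    have h5 : ‖point s' - z‖ ^ 2 ≤ ‖point s - z‖ ^ 2 := by
      rw [hz, norm_point_sub_mul_point, norm_point_sub_mul_point]
      gcongr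
    gcongr
  rcases S.eq_empty_or_nonempty with hE | ⟨s0, hs0⟩
  · simp [hE]
  set ρ := sSup ((fun s => ‖s - t‖) '' S) with hρ
  have hbdd : BddAbove ((fun s => ‖s - t‖) '' S) :=
    ⟨Real.pi, by rintro _ ⟨s, -, rfl⟩; exact norm_le_pi _⟩
  have hsub : S ⊆ Metric.closedBall t ρ := fun s hs => by
    rw [mem_closedBall_iff_norm]; exact le_csSup hbdd ⟨s, hs, rfl⟩
  have hsub2 : Metric.ball t ρ ⊆ S := fun s hs => by
    rw [mem_ball_iff_norm] at hs
    obtain ⟨_, ⟨s1, hs1, rfl⟩, hlt⟩ := exists_lt_of_lt_csSup (Set.Nonempty.image _ ⟨s0, hs0⟩) hs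
    exact hrad s1 s hs1 hlt.le
  have hae : S =ᵐ[arcMeasure] Metric.closedBall t ρ := by
    refine Filter.EventuallyLE.antisymm hsub.eventuallyLE ?_
    exact (closedBall_ae_eq_ball t ρ).le.trans hsub2.eventuallyLE
  rw [setLIntegral_congr hae, measure_congr hae]
  have hρ0 : 0 ≤ ρ := (norm_nonneg _).trans (le_csSup hbdd ⟨s0, hs0, rfl⟩)
  rcases hρ0.eq_or_lt with h | hpos
  · rw [← h]
    have : arcMeasure (Metric.closedBall t 0) = 0 := by rw [arcMeasure_closedBall]; simp
    rw [setLIntegral_measure_zero _ _ this]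
    exact zero_le
  · exact h ρ hpos

/-- The radii `1 - 2⁻ⁿ`. -/
def rad (n : ℕ) : ℝ := 1 - (1 / 2) ^ n

lemma rad_nonneg (n : ℕ) : 0 ≤ rad n := by
  unfold rad
  have : ((1 : ℝ) / 2) ^ n ≤ 1 := pow_le_one₀ (by norm_num) (by norm_num)
  linarith

lemma rad_lt_one (n : ℕ) : rad n < 1 := by
  unfold rad
  have : 0 < ((1 : ℝ) / 2) ^ n := by positivity
  linarith

lemma norm_rad_lt (n : ℕ) (t : Torus) : ‖(rad n : ℂ) * point t‖ < 1 := by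
  rw [norm_mul_point, abs_of_nonneg (rad_nonneg n)]; exact rad_lt_one n

/-- The radial Poisson maximal function, along the radii `1 - 2⁻ⁿ`. -/
def maxP (ψ : Torus → ℝ≥0∞) (t : Torus) : ℝ≥0∞ := ⨆ n, poissonL ψ (rad n * point t)

lemma measurable_maxP (hψ : Measurable ψ) : Measurable (maxP ψ) :=
  Measurable.iSup fun _ => (measurable_poissonL hψ).comp (measurable_point.const_mul _)

/-- Weak type `(1,1)` of the maximal function. -/
lemma mul_measure_maxP_le (hψ : Measurable ψ) (a : ℝ≥0∞) :
    a * arcMeasure {t | a < maxP ψ t} ≤ 5 * ∫⁻ t, ψ t ∂arcMeasure := by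
  set S := {t | a < maxP ψ t} with hS
  have h1 : ∀ t ∈ S, ∃ ρ : ℝ, 0 < ρ ∧ ρ ≤ Real.pi ∧ a * arcMeasure (Metric.closedBall t ρ) ≤
      ∫⁻ s in Metric.closedBall t ρ, ψ s ∂arcMeasure := by
    intro t ht
    by_contra! hcon
    have h2 : ∀ ρ : ℝ, 0 < ρ → ∫⁻ s in Metric.closedBall t ρ, ψ s ∂arcMeasure ≤
        a * arcMeasure (Metric.closedBall t ρ) := by
      intro ρ hρ
      rcases le_or_gt ρ Real.pi with h | h
      · exact (hcon ρ hρ h).le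
      · have e : ∀ ρ : ℝ, Real.pi ≤ ρ → Metric.closedBall t ρ = univ := fun ρ hρ =>
          AddCircle.closedBall_eq_univ_of_half_period_le _ Real.two_pi_pos.ne' t (by
            rw [abs_of_pos Real.two_pi_pos]; linarith)
        have := hcon Real.pi Real.pi_pos le_rfl
        rw [e _ le_rfl] at this
        rw [e _ h.le]
        exact this.le
    have : maxP ψ t ≤ a :=
      iSup_le fun n => poissonL_le_of_average_le hψ t a h2 (rad_nonneg n) (rad_lt_one n)
    exact absurd ht (not_lt.2 this)
  choose! ρ hρ0 hρπ hρ using h1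
  -- Vitali selection: the chosen balls are disjoint, and their fivefold enlargements, of at most
  -- five times the measure, still cover `S`.
  obtain ⟨u, huS, hdisj, hcov⟩ := Vitali.exists_disjoint_subfamily_covering_enlargement_closedBall
    S (fun t => t) ρ Real.pi hρπ 5 (by norm_num)
  have hcount : u.Countable := by
    refine hdisj.countable_of_nonempty_interior fun i hi => ?_
    exact ⟨i, Metric.ball_subset_interior_closedBall (Metric.mem_ball_self (hρ0 i (huS hi)))⟩
  have hsub : S ⊆ ⋃ i ∈ u, Metric.closedBall i (5 * ρ i) := by
    intro t ht
    obtain ⟨b, hb, hsub⟩ := hcov t ht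
    exact mem_biUnion hb (hsub (Metric.mem_closedBall_self (hρ0 t ht).le))
  have h5 : ∀ i ∈ u, arcMeasure (Metric.closedBall i (5 * ρ i)) ≤
      5 * arcMeasure (Metric.closedBall i (ρ i)) := by
    intro i hi
    rw [arcMeasure_closedBall, arcMeasure_closedBall]
    rw [show (5 : ℝ≥0∞) = ENNReal.ofReal 5 by norm_num, ← ENNReal.ofReal_mul (by norm_num)]
    refine ENNReal.ofReal_le_ofReal ?_
    rw [mul_min_of_nonneg _ _ (by norm_num)]
    refine min_le_min (by norm_num) (le_of_eq (by ring))
  calc a * arcMeasure S ≤ a * ∑' i : u, arcMeasure (Metric.closedBall i.1 (5 * ρ i)) := by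
        gcongr
        exact (measure_mono hsub).trans (measure_biUnion_le _ hcount _)
    _ ≤ a * ∑' i : u, 5 * arcMeasure (Metric.closedBall i.1 (ρ i)) := by
        gcongr with i
        exact h5 i i.2
    _ = 5 * ∑' i : u, a * arcMeasure (Metric.closedBall i.1 (ρ i)) := by
        rw [ENNReal.tsum_mul_left, ENNReal.tsum_mul_left]; ring
    _ ≤ 5 * ∑' i : u, ∫⁻ s in Metric.closedBall i.1 (ρ i), ψ s ∂arcMeasure := by
        gcongr with i
        exact hρ i (huS i.2)
    _ = 5 * ∫⁻ s in ⋃ i ∈ u, Metric.closedBall i (ρ i), ψ s ∂arcMeasure := by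
        rw [lintegral_biUnion hcount (fun i _ => Metric.isClosed_closedBall.measurableSet) hdisj]
    _ ≤ 5 * ∫⁻ t, ψ t ∂arcMeasure := mul_le_mul_right (setLIntegral_le_lintegral _ _) _

lemma maxP_le_const {c : ℝ≥0∞} (h : ∀ t, ψ t ≤ c) (t : Torus) : maxP ψ t ≤ c :=
  iSup_le fun n =>
    (poissonL_mono (ψ := fun _ => c) h _).trans_eq (poissonL_const c (norm_rad_lt n t))

lemma maxP_const_mul (c : ℝ≥0∞) (hψ : Measurable ψ) (t : Torus) :
    maxP (fun s => c * ψ s) t = c * maxP ψ t := by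
  unfold maxP
  rw [ENNReal.mul_iSup]
  exact iSup_congr fun _ => poissonL_const_mul c hψ _

lemma maxP_tsum_le {F : ℕ → Torus → ℝ≥0∞} (hF : ∀ n, Measurable (F n)) (t : Torus) :
    maxP (fun s => ∑' n, F n s) t ≤ ∑' n, maxP (F n) t := by
  refine iSup_le fun k => ?_
  rw [poissonL_tsum hF]
  exact ENNReal.tsum_le_tsum fun n => le_iSup (fun k => poissonL (F n) (rad k * point t)) k

/-- The whole radial maximal function is controlled by `maxP`. -/
lemma poissonL_le_maxP (ψ : Torus → ℝ≥0∞) {r : ℝ} (hr0 : 0 ≤ r) (hr1 : r < 1) (t : Torus) :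
    poissonL ψ (r * point t) ≤ 18 * maxP ψ t := by
  -- The dyadic radius with `2^(-n-1) < 1 - r ≤ 2^(-n)`. Harnack then costs `2 * (1 + 2)² = 18`.
  obtain ⟨n, hn1, hn2⟩ := exists_nat_pow_near_of_lt_one (x := 1 - r) (y := 1 / 2)
    (by linarith) (by linarith) (by norm_num) (by norm_num)
  have hz : ‖(r : ℂ) * point t‖ = r := by rw [norm_mul_point, abs_of_nonneg hr0]
  have hw : ‖(rad n : ℂ) * point t‖ = rad n := by rw [norm_mul_point, abs_of_nonneg (rad_nonneg n)]
  have hp : (0 : ℝ) < (1 / 2) ^ n := by positivity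
  have hk : ∀ s, ker (r * point t) s ≤ 18 * ker (rad n * point t) s := by
    intro s
    refine (ker_le_harnack (by rwa [hz]) (norm_rad_lt n t) s).trans ?_
    have hpos := (ker_pos (norm_rad_lt n t) s).le
    refine mul_le_mul_of_nonneg_right ?_ hpos
    rw [hz, hw, ← sub_mul, norm_mul, norm_point, mul_one, ← Complex.ofReal_sub, Complex.norm_real,
      Real.norm_eq_abs]
    have e1 : |r - rad n| ≤ 2 * (1 - r) := by
      rw [pow_succ] at hn1
      unfold rad
      rw [abs_le]; constructor <;> linarith
    have e2 : |r - rad n| / (1 - r) ≤ 2 := by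
      rw [div_le_iff₀ (by linarith)]; exact e1
    have e4 : rad n = 1 - (1 / 2) ^ n := rfl
    have e5 : (1 / 2) ^ n ≤ 1 - rad n ^ 2 := by
      have := rad_nonneg n
      have := rad_lt_one n
      nlinarith
    have e3 : (1 - r ^ 2) / (1 - rad n ^ 2) ≤ 2 := by
      rw [div_le_iff₀ (by linarith)]
      nlinarith
    have e6 : 0 ≤ |r - rad n| / (1 - r) := div_nonneg (abs_nonneg _) (by linarith)
    calc _ ≤ (2 : ℝ) * (1 + 2) ^ 2 := by gcongr
      _ = 18 := by norm_num
  calc poissonL ψ (r * point t) ≤ ∫⁻ s, 18 * (ENNReal.ofReal (ker (rad n * point t) s) * ψ s)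
        ∂arcMeasure := by
        refine lintegral_mono fun s => ?_
        rw [← mul_assoc]
        gcongr
        rw [show (18 : ℝ≥0∞) = ENNReal.ofReal 18 by norm_num, ← ENNReal.ofReal_mul (by norm_num)]
        exact ENNReal.ofReal_le_ofReal (hk s)
    _ = 18 * poissonL ψ (rad n * point t) := lintegral_const_mul' _ _ (by norm_num)
    _ ≤ 18 * maxP ψ t := by
        gcongr
        exact le_iSup (fun k => poissonL ψ (rad k * point t)) n

end

/-! ### The maximal theorem and majorants controlled by their own maximal function. -/

section

variable {φ ψ : Torus → ℝ≥0∞}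

lemma lintegral_ne_top_of_rpow {Q : ℝ} (hQ : 1 < Q) (h : ∫⁻ t, ψ t ^ Q ∂arcMeasure ≠ ∞) :
    ∫⁻ t, ψ t ∂arcMeasure ≠ ∞ := by
  have h1 : ∫⁻ t, ψ t ∂arcMeasure ≤ ∫⁻ t, (1 + ψ t ^ Q) ∂arcMeasure := by
    refine lintegral_mono fun t => ?_
    rcases le_total (ψ t) 1 with h | h
    · exact h.trans le_self_add
    · exact (ENNReal.rpow_one (ψ t)).symm.le.trans
        ((ENNReal.rpow_le_rpow_of_exponent_le h hQ.le).trans le_add_self)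
  rw [lintegral_add_left measurable_const] at h1
  refine ne_top_of_le_ne_top ?_ h1
  simp [h]

lemma ae_maxP_lt_top (hψ : Measurable ψ) (h : ∫⁻ t, ψ t ∂arcMeasure ≠ ∞) :
    ∀ᵐ t ∂arcMeasure, maxP ψ t < ∞ := by
  have h1 : ∀ n : ℕ, (n : ℝ≥0∞) * arcMeasure {t | maxP ψ t = ∞} ≤
      5 * ∫⁻ t, ψ t ∂arcMeasure := by
    intro n
    refine le_trans ?_ (mul_measure_maxP_le hψ n)
    refine mul_le_mul_right (measure_mono fun t (ht : maxP ψ t = ∞) => ?_) _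
    simp [ht]
  have h2 : arcMeasure {t | maxP ψ t = ∞} = 0 := by
    by_contra hne
    obtain ⟨n, hn⟩ := ENNReal.exists_nat_mul_gt hne (b := 5 * ∫⁻ t, ψ t ∂arcMeasure)
      (ENNReal.mul_ne_top (by norm_num) h)
    exact absurd (h1 n) (not_le.2 hn)
  rw [ae_iff]
  simpa [not_lt, top_le_iff] using h2

/-- The part of `ψ` below height `a/2` contributes at most `a/2` to the maximal function, so only
the part above matters for the level `a`, and the weak type bound applies to it. -/
lemma measure_lt_maxP_le (hψ : Measurable ψ) {a : ℝ} (ha : 0 < a) :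
    arcMeasure {t | ENNReal.ofReal a < maxP ψ t} ≤
      ENNReal.ofReal (10 / a) *
        ∫⁻ t, {t | ENNReal.ofReal (a / 2) < ψ t}.indicator ψ t ∂arcMeasure := by
  set S := {t | ENNReal.ofReal (a / 2) < ψ t} with hS
  have hSm : MeasurableSet S := measurableSet_lt measurable_const hψ
  have hle : ∀ t, maxP ψ t ≤ maxP (S.indicator ψ) t + ENNReal.ofReal (a / 2) := by
    intro t
    refine iSup_le fun n => ?_
    calc poissonL ψ (rad n * point t)
        ≤ poissonL (fun s => S.indicator ψ s + ENNReal.ofReal (a / 2)) (rad n * point t) := by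
          refine poissonL_mono (fun s => ?_) _
          by_cases hs : s ∈ S
          · simp [hs]
          · simp only [hs, not_false_eq_true, indicator_of_notMem, zero_add]
            exact not_lt.1 hs
      _ = poissonL (S.indicator ψ) (rad n * point t) + ENNReal.ofReal (a / 2) := by
          rw [poissonL_add (hψ.indicator hSm), poissonL_const _ (norm_rad_lt n t)]
      _ ≤ _ := by
          gcongr
          exact le_iSup (fun k => poissonL (S.indicator ψ) (rad k * point t)) n
  have hsub : {t | ENNReal.ofReal a < maxP ψ t} ⊆
      {t | ENNReal.ofReal (a / 2) < maxP (S.indicator ψ) t} := by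
    intro t (ht : ENNReal.ofReal a < maxP ψ t)
    by_contra hcon
    have h1 : maxP (S.indicator ψ) t ≤ ENNReal.ofReal (a / 2) := not_lt.1 hcon
    have h2 := (ht.trans_le (hle t)).trans_le (add_le_add_left h1 _)
    rw [← ENNReal.ofReal_add (by positivity) (by positivity), add_halves] at h2
    exact lt_irrefl _ h2
  have hw := mul_measure_maxP_le (hψ.indicator hSm) (ENNReal.ofReal (a / 2))
  calc arcMeasure {t | ENNReal.ofReal a < maxP ψ t}
      ≤ arcMeasure {t | ENNReal.ofReal (a / 2) < maxP (S.indicator ψ) t} := measure_mono hsub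
    _ = ENNReal.ofReal (2 / a) * (ENNReal.ofReal (a / 2) *
        arcMeasure {t | ENNReal.ofReal (a / 2) < maxP (S.indicator ψ) t}) := by
        rw [← mul_assoc, ← ENNReal.ofReal_mul (by positivity)]
        rw [show 2 / a * (a / 2) = 1 by field_simp]; simp
    _ ≤ ENNReal.ofReal (2 / a) * (5 * ∫⁻ t, S.indicator ψ t ∂arcMeasure) := by gcongr
    _ = _ := by
        rw [← mul_assoc, show (5 : ℝ≥0∞) = ENNReal.ofReal 5 by norm_num,
          ← ENNReal.ofReal_mul (by positivity)]
        congr 2; ring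

lemma setLIntegral_rpow_sub_two {Q : ℝ} (hQ : 1 < Q) {b : ℝ} (hb : 0 ≤ b) :
    ∫⁻ a in Ioo 0 b, ENNReal.ofReal (a ^ (Q - 2)) = ENNReal.ofReal (b ^ (Q - 1) / (Q - 1)) := by
  have h1 : IntervalIntegrable (fun a : ℝ => a ^ (Q - 2)) volume 0 b :=
    intervalIntegral.intervalIntegrable_rpow' (by linarith)
  have h2 := integral_rpow (a := 0) (b := b) (r := Q - 2) (Or.inl (by linarith))
  rw [show Q - 2 + 1 = Q - 1 by ring, Real.zero_rpow (by linarith), sub_zero] at h2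
  rw [← h2, intervalIntegral.integral_of_le hb, restrict_Ioo_eq_restrict_Ioc]
  rw [ofReal_integral_eq_lintegral_ofReal h1.1]
  exact (ae_restrict_iff' measurableSet_Ioc).2 (.of_forall fun a ha => Real.rpow_nonneg ha.1.le _)

/-- The maximal theorem. -/
theorem exists_lintegral_maxP_rpow_le {Q : ℝ} (hQ : 1 < Q) :
    ∃ C : ℝ, 1 ≤ C ∧ ∀ ψ : Torus → ℝ≥0∞, Measurable ψ →
      ∫⁻ t, maxP ψ t ^ Q ∂arcMeasure ≤ ENNReal.ofReal C * ∫⁻ t, ψ t ^ Q ∂arcMeasure := by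
  set C0 : ℝ := Q * 10 * (2 ^ (Q - 1) / (Q - 1)) with hC0
  have hC0' : 0 ≤ C0 := by have : 0 < Q - 1 := by linarith
                           positivity
  refine ⟨max 1 C0, le_max_left _ _, fun ψ hψ => ?_⟩
  by_cases htop : ∫⁻ t, ψ t ^ Q ∂arcMeasure = ∞
  · rw [htop, ENNReal.mul_top]
    · exact le_top
    · exact (ENNReal.ofReal_pos.2 (lt_of_lt_of_le one_pos (le_max_left _ _))).ne'
  have hL1 := lintegral_ne_top_of_rpow hQ htop
  have hfin := ae_maxP_lt_top hψ hL1
  have hψfin := ae_lt_top hψ hL1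
  have hMm := measurable_maxP hψ
  have e1 : ∫⁻ t, maxP ψ t ^ Q ∂arcMeasure =
      ∫⁻ t, ENNReal.ofReal ((maxP ψ t).toReal ^ Q) ∂arcMeasure := by
    refine lintegral_congr_ae ?_
    filter_upwards [hfin] with t ht
    rw [← ENNReal.ofReal_rpow_of_nonneg ENNReal.toReal_nonneg (by linarith),
      ENNReal.ofReal_toReal ht.ne]
  rw [e1, lintegral_rpow_eq_lintegral_meas_lt_mul _ (.of_forall fun t => ENNReal.toReal_nonneg)
    hMm.ennreal_toReal.aemeasurable (by linarith)]
  -- The density left by the truncated weak type bound: `10/a` times `a^(Q-1)`. After exchanging the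
  -- integrals, `a` runs over `(0, 2ψ(t))`, where `a^(Q-2)` is integrable because `Q > 1`.
  set F : ℝ → Torus → ℝ≥0∞ := fun a t =>
    ENNReal.ofReal (10 * a ^ (Q - 2)) * {t | ENNReal.ofReal (a / 2) < ψ t}.indicator ψ t with hF
  have hFm : Measurable (Function.uncurry F) := by
    have : Function.uncurry F = fun q : ℝ × Torus => ENNReal.ofReal (10 * q.1 ^ (Q - 2)) *
        {q : ℝ × Torus | ENNReal.ofReal (q.1 / 2) < ψ q.2}.indicator (fun q => ψ q.2) q := by
      ext ⟨a, t⟩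
      rfl
    rw [this]
    refine Measurable.mul (by fun_prop) (Measurable.indicator (hψ.comp measurable_snd) ?_)
    exact measurableSet_lt (by fun_prop) (hψ.comp measurable_snd)
  have h2 : ∀ a ∈ Ioi (0 : ℝ), arcMeasure {t | a < (maxP ψ t).toReal} * ENNReal.ofReal (a ^ (Q - 1))
      ≤ ∫⁻ t, F a t ∂arcMeasure := by
    intro a (ha : 0 < a)
    have hsub : {t | a < (maxP ψ t).toReal} ⊆ {t | ENNReal.ofReal a < maxP ψ t} := by
      intro t (ht : a < (maxP ψ t).toReal)
      exact (ENNReal.ofReal_lt_iff_lt_toReal ha.le (by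
        intro h; rw [h] at ht; simp at ht; linarith)).2 ht
    calc _ ≤ (ENNReal.ofReal (10 / a) *
        ∫⁻ t, {t | ENNReal.ofReal (a / 2) < ψ t}.indicator ψ t ∂arcMeasure) *
          ENNReal.ofReal (a ^ (Q - 1)) := by
          gcongr
          exact (measure_mono hsub).trans (measure_lt_maxP_le hψ ha)
      _ = ENNReal.ofReal (10 * a ^ (Q - 2)) *
        ∫⁻ t, {t | ENNReal.ofReal (a / 2) < ψ t}.indicator ψ t ∂arcMeasure := by
          rw [mul_right_comm, ← ENNReal.ofReal_mul (by positivity)]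
          congr 2
          rw [show Q - 1 = Q - 2 + 1 by ring, Real.rpow_add ha, Real.rpow_one]
          field_simp
      _ = _ := by
          rw [hF, lintegral_const_mul' _ _ ENNReal.ofReal_ne_top]
  calc _ ≤ ENNReal.ofReal Q * ∫⁻ a in Ioi 0, ∫⁻ t, F a t ∂arcMeasure := by
        exact mul_le_mul_right (setLIntegral_mono' measurableSet_Ioi h2) _
    _ = ENNReal.ofReal Q * ∫⁻ t, (∫⁻ a in Ioi 0, F a t) ∂arcMeasure := by
        rw [lintegral_lintegral_swap hFm.aemeasurable]
    _ ≤ ENNReal.ofReal Q * ∫⁻ t, ENNReal.ofReal (10 * (2 ^ (Q - 1) / (Q - 1))) * ψ t ^ Q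
          ∂arcMeasure := by
        refine mul_le_mul_right (lintegral_mono_ae ?_) _
        filter_upwards [hψfin] with t ht
        obtain ⟨x, hx0, hx⟩ : ∃ x : ℝ, 0 ≤ x ∧ ψ t = ENNReal.ofReal x :=
          ⟨(ψ t).toReal, ENNReal.toReal_nonneg, (ENNReal.ofReal_toReal ht.ne).symm⟩
        have e3 : ∀ a ∈ Ioi (0 : ℝ), F a t = ENNReal.ofReal x * ENNReal.ofReal 10 *
            (Ioo 0 (2 * x)).indicator (fun a => ENNReal.ofReal (a ^ (Q - 2))) a := by
          intro a (ha : 0 < a)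
          simp only [hF]
          rw [ENNReal.ofReal_mul (by norm_num)]
          by_cases hax : a < 2 * x
          · have m1 : t ∈ {t | ENNReal.ofReal (a / 2) < ψ t} := by
              rw [mem_ofPred_eq, hx]
              exact (ENNReal.ofReal_lt_ofReal_iff (by linarith)).2 (by linarith)
            have m2 : a ∈ Ioo 0 (2 * x) := ⟨ha, hax⟩
            rw [indicator_of_mem m1, indicator_of_mem m2, hx]
            ring
          · have m1 : t ∉ {t | ENNReal.ofReal (a / 2) < ψ t} := by
              rw [mem_ofPred_eq, hx, not_lt]
              exact ENNReal.ofReal_le_ofReal (by linarith)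
            have m2 : a ∉ Ioo 0 (2 * x) := fun h => hax h.2
            rw [indicator_of_notMem m1, indicator_of_notMem m2, mul_zero, mul_zero]
        rw [setLIntegral_congr_fun measurableSet_Ioi e3,
          lintegral_const_mul' _ _ (ENNReal.mul_ne_top ENNReal.ofReal_ne_top ENNReal.ofReal_ne_top),
          setLIntegral_indicator measurableSet_Ioo,
          inter_eq_left.2 (Ioo_subset_Ioi_self : Ioo 0 (2 * x) ⊆ Ioi 0),
          setLIntegral_rpow_sub_two hQ (by linarith), hx,
          ENNReal.ofReal_rpow_of_nonneg hx0 (by linarith), ← ENNReal.ofReal_mul hx0,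
          ← ENNReal.ofReal_mul (by positivity), ← ENNReal.ofReal_mul (by
            have : 0 < Q - 1 := by linarith
            positivity)]
        refine ENNReal.ofReal_le_ofReal (le_of_eq ?_)
        rw [Real.mul_rpow (by norm_num) hx0]
        have : x ^ Q = x * x ^ (Q - 1) := by
          rcases hx0.eq_or_lt with h | h
          · rw [← h, zero_mul, Real.zero_rpow (by linarith)]
          · rw [← Real.rpow_one_add' hx0 (by linarith)]; congr 1; ring
        rw [this]; ring
    _ = ENNReal.ofReal C0 * ∫⁻ t, ψ t ^ Q ∂arcMeasure := by
        rw [lintegral_const_mul' _ _ ENNReal.ofReal_ne_top, ← mul_assoc,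
          ← ENNReal.ofReal_mul (by linarith), hC0]
        congr 2; ring
    _ ≤ _ := by
        gcongr
        exact le_max_right _ _

/-- A substitute for Minkowski's inequality: the sum is at most twice the supremum of `2^k x_k`, and
the `Q`-th power of a supremum is at most the sum of the powers. -/
lemma tsum_rpow_le_of_pow {Q : ℝ} (hQ : 1 ≤ Q) (x : ℕ → ℝ≥0∞) :
    (∑' k, x k) ^ Q ≤ 2 ^ Q * ∑' k, (2 ^ k * x k) ^ Q := by
  have hQ0 : 0 ≤ Q := by linarith
  have h1 : ∀ k, x k = (2⁻¹) ^ k * (2 ^ k * x k) := fun k => by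
    rw [← mul_assoc, ← mul_pow, ENNReal.inv_mul_cancel (by norm_num) (by norm_num), one_pow,
      one_mul]
  have h2 : ∑' k, x k ≤ 2 * ⨆ k, 2 ^ k * x k := by
    calc ∑' k, x k ≤ ∑' k, (2⁻¹) ^ k * ⨆ k, 2 ^ k * x k := by
          refine ENNReal.tsum_le_tsum fun k => ?_
          conv_lhs => rw [h1 k]
          gcongr
          exact le_iSup (fun k => 2 ^ k * x k) k
      _ = 2 * ⨆ k, 2 ^ k * x k := by
          rw [ENNReal.tsum_mul_right, ENNReal.tsum_geometric, ENNReal.one_sub_inv_two, inv_inv]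
  calc (∑' k, x k) ^ Q ≤ (2 * ⨆ k, 2 ^ k * x k) ^ Q := ENNReal.rpow_le_rpow h2 hQ0
    _ = 2 ^ Q * (⨆ k, 2 ^ k * x k) ^ Q := ENNReal.mul_rpow_of_nonneg _ _ hQ0
    _ ≤ _ := by
      gcongr
      have h3 : ⨆ k, 2 ^ k * x k ≤ (∑' k, (2 ^ k * x k) ^ Q) ^ Q⁻¹ := by
        refine iSup_le fun k => ?_
        rw [ENNReal.le_rpow_inv_iff (by linarith)]
        exact ENNReal.le_tsum k
      exact (ENNReal.le_rpow_inv_iff (by linarith)).1 h3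

/-- A majorant with `A₁`-type control of its Poisson integral (the Rubio de Francia algorithm). -/
theorem exists_maxP_majorant {Q : ℝ} (hQ : 1 < Q) :
    ∃ C : ℝ, 1 ≤ C ∧ ∀ ψ : Torus → ℝ≥0∞, Measurable ψ → ∃ W : Torus → ℝ≥0∞, Measurable W ∧
      ψ ≤ W ∧ (∀ t, maxP W t ≤ ENNReal.ofReal C * W t) ∧
      ∫⁻ t, W t ^ Q ∂arcMeasure ≤ ENNReal.ofReal C * ∫⁻ t, ψ t ^ Q ∂arcMeasure ∧
      ∀ c, (∀ t, ψ t ≤ c) → ∀ t, W t ≤ 2 * c := by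
  obtain ⟨A, hA1, hA⟩ := exists_lintegral_maxP_rpow_le hQ
  have hQ0 : 0 < Q := by linarith
  set α : ℝ≥0∞ := ENNReal.ofReal A with hα
  have hα1 : 1 ≤ α := by rw [hα]; exact_mod_cast ENNReal.ofReal_le_ofReal hA1 |>.trans' (by simp)
  have hαt : α ≠ ∞ := ENNReal.ofReal_ne_top
  have hα0 : α ≠ 0 := (lt_of_lt_of_le one_pos hα1).ne'
  -- One factor 2 in the 4 offsets the `2^k` of `tsum_rpow_le_of_pow`, the other leaves a convergent
  -- geometric series. Dividing by `α`, which is at least 1, offsets the growth of the iterates.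
  set b : ℝ≥0∞ := (4 * α)⁻¹ with hb
  have h4t : 4 * α ≠ ∞ := ENNReal.mul_ne_top (by norm_num) hαt
  have h40 : 4 * α ≠ 0 := mul_ne_zero (by norm_num) hα0
  have hb1 : b ≤ 2⁻¹ := by
    rw [hb, ENNReal.inv_le_inv]
    calc (2 : ℝ≥0∞) ≤ 4 * 1 := by norm_num
      _ ≤ 4 * α := by gcongr
  set D : ℝ := max (4 * A) (2 ^ Q * 2) with hD
  refine ⟨D, le_trans (by linarith) (le_max_left _ _), fun ψ hψ => ?_⟩
  -- The majorant is `∑ b^k G_k`. Applying `maxP` shifts the sum by one index and so costs only `1/b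
  -- = 4α`.
  set G : ℕ → Torus → ℝ≥0∞ := fun k => maxP^[k] ψ with hG
  have hGs : ∀ k, G (k + 1) = maxP (G k) := fun k => Function.iterate_succ_apply' _ _ _
  have hGm : ∀ k, Measurable (G k) := by
    intro k
    induction k with
    | zero => exact hψ
    | succ k ih => rw [hGs]; exact measurable_maxP ih
  have hGi : ∀ k, ∫⁻ t, G k t ^ Q ∂arcMeasure ≤ α ^ k * ∫⁻ t, ψ t ^ Q ∂arcMeasure := by
    intro k
    induction k with
    | zero => simp [hG]
    | succ k ih =>
      rw [hGs, pow_succ', mul_assoc]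
      exact (hA _ (hGm k)).trans (mul_le_mul_right ih _)
  refine ⟨fun t => ∑' k, b ^ k * G k t, ?_, ?_, ?_, ?_, ?_⟩
  · exact Measurable.tsum fun k => (hGm k).const_mul _
  · intro t
    have := ENNReal.le_tsum (f := fun k => b ^ k * G k t) 0
    simpa [hG] using this
  · intro t
    refine (maxP_tsum_le (fun k => (hGm k).const_mul _) t).trans ?_
    have e : ∀ k, maxP (fun s => b ^ k * G k s) t = 4 * α * (b ^ (k + 1) * G (k + 1) t) := by
      intro k
      rw [maxP_const_mul _ (hGm k), hGs, pow_succ', ← mul_assoc, ← mul_assoc, hb,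
        ENNReal.mul_inv_cancel h40 h4t, one_mul]
    simp_rw [e]
    rw [ENNReal.tsum_mul_left]
    refine mul_le_mul' ?_ (ENNReal.tsum_comp_le_tsum_of_injective (add_left_injective 1)
      (fun k => b ^ k * G k t))
    rw [hα, show (4 : ℝ≥0∞) = ENNReal.ofReal 4 by norm_num, ← ENNReal.ofReal_mul (by norm_num)]
    exact ENNReal.ofReal_le_ofReal (le_max_left _ _)
  · calc ∫⁻ t, (∑' k, b ^ k * G k t) ^ Q ∂arcMeasure
        ≤ ∫⁻ t, 2 ^ Q * ∑' k, (2 ^ k * (b ^ k * G k t)) ^ Q ∂arcMeasure :=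
          lintegral_mono fun t => tsum_rpow_le_of_pow hQ.le _
      _ = 2 ^ Q * ∑' k, ∫⁻ t, (2 ^ k * (b ^ k * G k t)) ^ Q ∂arcMeasure := by
          rw [lintegral_const_mul' _ _ (by finiteness), lintegral_tsum]
          intro k
          exact (((hGm k).const_mul _).const_mul _).pow_const Q |>.aemeasurable
      _ ≤ 2 ^ Q * ∑' k, (2⁻¹) ^ k * ∫⁻ t, ψ t ^ Q ∂arcMeasure := by
          gcongr with k
          have e : ∀ t, (2 ^ k * (b ^ k * G k t)) ^ Q = ((2 * b) ^ k) ^ Q * G k t ^ Q := by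
            intro t
            rw [← mul_assoc, ← mul_pow, ENNReal.mul_rpow_of_nonneg _ _ hQ0.le]
          simp_rw [e]
          have h2b : 2 * b = 2⁻¹ * α⁻¹ := by
            rw [hb, ENNReal.mul_inv (Or.inl (by norm_num)) (Or.inl (by norm_num)), ← mul_assoc]
            congr 1
            rw [show (4 : ℝ≥0∞) = 2 * 2 by norm_num,
              ENNReal.mul_inv (Or.inl (by norm_num)) (Or.inl (by norm_num)), ← mul_assoc,
              ENNReal.mul_inv_cancel (by norm_num) (by norm_num), one_mul]
          have hle1 : (2 * b) ^ k ≤ 1 := by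
            refine pow_le_one₀ zero_le ?_
            calc 2 * b ≤ 2 * 2⁻¹ := by gcongr
              _ = 1 := ENNReal.mul_inv_cancel (by norm_num) (by norm_num)
          have hle2 : ((2 * b) ^ k) ^ Q ≤ (2 * b) ^ k := by
            conv_rhs => rw [← ENNReal.rpow_one ((2 * b) ^ k)]
            exact ENNReal.rpow_le_rpow_of_exponent_ge hle1 hQ.le
          rw [lintegral_const_mul _ ((hGm k).pow_const Q)]
          calc _ ≤ (2 * b) ^ k * (α ^ k * ∫⁻ t, ψ t ^ Q ∂arcMeasure) := mul_le_mul' hle2 (hGi k)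
            _ = _ := by
              rw [← mul_assoc, ← mul_pow, h2b, mul_assoc, ENNReal.inv_mul_cancel hα0 hαt, mul_one]
      _ = ENNReal.ofReal (2 ^ Q * 2) * ∫⁻ t, ψ t ^ Q ∂arcMeasure := by
          rw [ENNReal.tsum_mul_right, ENNReal.tsum_geometric, ENNReal.one_sub_inv_two, inv_inv,
            ENNReal.ofReal_mul (by positivity), ← ENNReal.ofReal_rpow_of_pos (by norm_num)]
          norm_num [mul_assoc]
      _ ≤ _ := by
          gcongr
          exact le_max_right _ _
  · intro c hc t
    have hGc : ∀ k t, G k t ≤ c := by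
      intro k
      induction k with
      | zero => exact hc
      | succ k ih => rw [hGs]; exact maxP_le_const ih
    calc ∑' k, b ^ k * G k t ≤ ∑' k, (2⁻¹) ^ k * c := by
          gcongr with k
          exact hGc k t
      _ = 2 * c := by
          rw [ENNReal.tsum_mul_right, ENNReal.tsum_geometric, ENNReal.one_sub_inv_two, inv_inv]

end

/-! ### Green's formula in logarithmic coordinates. -/

/-- The half plane in which the logarithm of the disk variable lives. -/
abbrev strip : Set (ℝ × ℝ) := Iio 0 ×ˢ univ

lemma _root_.ContinuousOn.strip_section {E : Type*} [TopologicalSpace E] {F : ℝ → ℝ → E}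
    (hF : ContinuousOn (Function.uncurry F) strip) {x : ℝ} (hx : x < 0) : Continuous (F x) := by
  rw [← continuousOn_univ]
  exact hF.comp (f := fun t => (x, t)) (by fun_prop) (fun t _ => ⟨hx, trivial⟩)

lemma _root_.ContinuousOn.strip_line {E : Type*} [TopologicalSpace E] {F : ℝ → ℝ → E}
    (hF : ContinuousOn (Function.uncurry F) strip) (t : ℝ) {X ε : ℝ} (hε : 0 < ε) (h : ε < X) :
    ContinuousOn (fun x => F x t) (uIcc (-X) (-ε)) := by
  refine hF.comp (f := fun x => (x, t)) (by fun_prop) (fun x hx => ⟨?_, trivial⟩)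
  rw [uIcc_of_le (by linarith)] at hx
  exact mem_Iio.2 (by linarith [hx.2])

lemma integrableOn_strip_rect {E : Type*} [NormedAddCommGroup E] {G : ℝ → ℝ → E}
    (hG : ContinuousOn (Function.uncurry G) strip) {X ε : ℝ} (hε : 0 < ε) :
    IntegrableOn (Function.uncurry G) (Icc (-X) (-ε) ×ˢ Icc 0 (2 * Real.pi)) := by
  refine (hG.mono ?_).integrableOn_compact (isCompact_Icc.prod isCompact_Icc)
  exact fun q hq => ⟨mem_Iio.2 (by linarith [hq.1.2]), trivial⟩

lemma intervalIntegrable_integral_strip {E : Type*} [NormedAddCommGroup E] [NormedSpace ℝ E]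
    {G : ℝ → ℝ → E} (hG : ContinuousOn (Function.uncurry G) strip) {X ε : ℝ} (hε : 0 < ε)
    (hX : ε < X) :
    IntervalIntegrable (fun x => ∫ t in (0)..(2 * Real.pi), G x t) volume (-X) (-ε) := by
  have h := (integrableOn_strip_rect hG (X := X) hε).mono_set
    (prod_mono_right (s := Icc (-X) (-ε)) (Ioc_subset_Icc_self (a := 0) (b := 2 * Real.pi)))
  rw [IntegrableOn, Measure.volume_eq_prod, ← Measure.prod_restrict] at h
  have h2 := h.integral_prod_left
  simp only [Function.uncurry] at h2
  rw [intervalIntegrable_iff_integrableOn_Icc_of_le (by linarith)]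
  simp_rw [intervalIntegral.integral_of_le Real.two_pi_pos.le]
  exact h2

/-- Green's formula in the half strip. -/
lemma green_strip {E : Type*} [NormedAddCommGroup E] [NormedSpace ℝ E] [CompleteSpace E]
    {F F1 F11 F2 F22 : ℝ → ℝ → E}
    (h1 : ∀ x < 0, ∀ t, HasDerivAt (fun y => F y t) (F1 x t) x)
    (h11 : ∀ x < 0, ∀ t, HasDerivAt (fun y => F1 y t) (F11 x t) x)
    (h22 : ∀ x < 0, ∀ t, HasDerivAt (F2 x) (F22 x t) t)
    (c0 : ContinuousOn (Function.uncurry F) strip) (c1 : ContinuousOn (Function.uncurry F1) strip)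
    (c11 : ContinuousOn (Function.uncurry F11) strip)
    (c22 : ContinuousOn (Function.uncurry F22) strip)
    (per : ∀ x < 0, F2 x (2 * Real.pi) = F2 x 0) {X ε : ℝ} (hε : 0 < ε) (hX : ε < X) :
    ∫ x in (-X)..(-ε), (-ε - x) • ∫ t in (0)..(2 * Real.pi), (F11 x t + F22 x t) =
      (∫ t in (0)..(2 * Real.pi), F (-ε) t) - (∫ t in (0)..(2 * Real.pi), F (-X) t) -
        (X - ε) • ∫ t in (0)..(2 * Real.pi), F1 (-X) t := by
  have hXε : -X ≤ -ε := by linarith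
  -- The second `t`-derivative integrates to zero over a period.
  have e1 : ∀ x ∈ uIcc (-X) (-ε), (-ε - x) • ∫ t in (0)..(2 * Real.pi), (F11 x t + F22 x t) =
      ∫ t in (0)..(2 * Real.pi), (-ε - x) • F11 x t := by
    intro x hx
    rw [uIcc_of_le hXε] at hx
    have hx0 : x < 0 := by linarith [hx.2]
    rw [intervalIntegral.integral_add ((c11.strip_section hx0).intervalIntegrable _ _)
      ((c22.strip_section hx0).intervalIntegrable _ _),
      intervalIntegral.integral_eq_sub_of_hasDerivAt (fun t _ => h22 x hx0 t)
        ((c22.strip_section hx0).intervalIntegrable _ _), per x hx0, sub_self, add_zero,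
      intervalIntegral.integral_smul]
  rw [intervalIntegral.integral_congr e1]
  have hrect : ContinuousOn (Function.uncurry fun x t => (-ε - x) • F11 x t)
      (Icc (-X) (-ε) ×ˢ Icc 0 (2 * Real.pi)) := by
    refine ContinuousOn.smul (f := fun q : ℝ × ℝ => -ε - q.1) (by fun_prop) (c11.mono ?_)
    exact fun q hq => ⟨mem_Iio.2 (by linarith [hq.1.2]), trivial⟩
  rw [intervalIntegral_intervalIntegral_swap]
  · have e2 : ∀ t, ∫ x in (-X)..(-ε), (-ε - x) • F11 x t =
        F (-ε) t - F (-X) t - (X - ε) • F1 (-X) t := by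
      intro t
      -- This primitive of `(-ε - x) F11` has a derivative term that vanishes at `-ε`, so only the
      -- values of `F` survive at that end.
      have hd : ∀ x ∈ uIcc (-X) (-ε), HasDerivAt (fun y => (-ε - y) • F1 y t + F y t)
          ((-ε - x) • F11 x t) x := by
        intro x hx
        rw [uIcc_of_le hXε] at hx
        have hx0 : x < 0 := by linarith [hx.2]
        have hl : HasDerivAt (fun y : ℝ => -ε - y) (-1) x := by
          simpa using (hasDerivAt_id x).const_sub (-ε)
        refine ((hl.smul (h11 x hx0 t)).add (h1 x hx0 t)).congr_deriv ?_
        simp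
      rw [intervalIntegral.integral_eq_sub_of_hasDerivAt hd]
      · simp only [sub_self, zero_smul, zero_add]
        rw [show -ε - -X = X - ε by ring]
        abel
      · refine ContinuousOn.intervalIntegrable ?_
        exact ContinuousOn.smul (by fun_prop) (c11.strip_line t hε hX)
    simp_rw [e2]
    have hε0 : -ε < 0 := by linarith
    have hX0 : -X < 0 := by linarith
    have i1 := (c0.strip_section hε0).intervalIntegrable (μ := volume) 0 (2 * Real.pi)
    have i2 := (c0.strip_section hX0).intervalIntegrable (μ := volume) 0 (2 * Real.pi)
    have i3 := (c1.strip_section hX0).intervalIntegrable (μ := volume) 0 (2 * Real.pi)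
    have i4 : IntervalIntegrable (fun t => (X - ε) • F1 (-X) t) volume 0 (2 * Real.pi) := i3.smul _
    rw [intervalIntegral.integral_sub (i1.sub i2) i4, intervalIntegral.integral_sub i1 i2,
      intervalIntegral.integral_smul]
  · rw [uIoc_of_le hXε, uIoc_of_le Real.two_pi_pos.le]
    refine IntegrableOn.mono_set ?_ (prod_mono Ioc_subset_Icc_self Ioc_subset_Icc_self)
    exact hrect.integrableOn_compact (isCompact_Icc.prod isCompact_Icc)

/-- A `2π`-periodic harmonic function `u` in the half plane `x < 0`, with its partial derivatives
`ux`, `ut`, `w = ∂²u/∂x² = -∂²u/∂t²`, which is bounded with decaying `ux` as `x → -∞`. -/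
structure IsStripHarmonic {𝕜 : Type*} [NormedAddCommGroup 𝕜] [NormedSpace ℝ 𝕜]
    (u ux ut w : ℝ → ℝ → 𝕜) : Prop where
  dx : ∀ x < 0, ∀ t, HasDerivAt (fun y => u y t) (ux x t) x
  dt : ∀ x < 0, ∀ t, HasDerivAt (u x) (ut x t) t
  dxx : ∀ x < 0, ∀ t, HasDerivAt (fun y => ux y t) (w x t) x
  dtt : ∀ x < 0, ∀ t, HasDerivAt (ut x) (-(w x t)) t
  cu : ContinuousOn (Function.uncurry u) strip
  cux : ContinuousOn (Function.uncurry ux) strip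
  cut : ContinuousOn (Function.uncurry ut) strip
  cw : ContinuousOn (Function.uncurry w) strip
  per : ∀ x < 0, u x (2 * Real.pi) = u x 0
  pert : ∀ x < 0, ut x (2 * Real.pi) = ut x 0
  decay : ∃ C, ∀ x ≤ -1, ∀ t, ‖u x t‖ ≤ C ∧ ‖ux x t‖ ≤ C * Real.exp x

lemma IsStripHarmonic.map {u ux ut w : ℝ → ℝ → ℂ} (h : IsStripHarmonic u ux ut w)
    (L : ℂ →L[ℝ] ℝ) : IsStripHarmonic (fun x t => L (u x t)) (fun x t => L (ux x t))
      (fun x t => L (ut x t)) (fun x t => L (w x t)) where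
  dx x hx t := L.hasFDerivAt.comp_hasDerivAt x (h.dx x hx t)
  dt x hx t := L.hasFDerivAt.comp_hasDerivAt t (h.dt x hx t)
  dxx x hx t := L.hasFDerivAt.comp_hasDerivAt x (h.dxx x hx t)
  dtt x hx t := by
    rw [← map_neg]; exact L.hasFDerivAt.comp_hasDerivAt t (h.dtt x hx t)
  cu := L.continuous.comp_continuousOn h.cu
  cux := L.continuous.comp_continuousOn h.cux
  cut := L.continuous.comp_continuousOn h.cut
  cw := L.continuous.comp_continuousOn h.cw
  per x hx := by simp only [h.per x hx]
  pert x hx := by simp only [h.pert x hx]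
  decay := by
    obtain ⟨C, hC⟩ := h.decay
    refine ⟨‖L‖ * C, fun x hx t => ⟨?_, ?_⟩⟩
    · exact (L.le_opNorm _).trans (mul_le_mul_of_nonneg_left (hC x hx t).1 (norm_nonneg _))
    · rw [mul_assoc]
      exact (L.le_opNorm _).trans (mul_le_mul_of_nonneg_left (hC x hx t).2 (norm_nonneg _))

/-! ### The weighted energy inequality in the half strip. -/

section weighted

variable (s : ℝ)

/-- First derivative of `u² v^{-s}`. -/
def wd1 (u v u' v' : ℝ) : ℝ := 2 * u * u' * v ^ (-s) - s * u ^ 2 * v' * v ^ (-s - 1)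

/-- Second derivative of `u² v^{-s}`. -/
def wd2 (u v u' v' u'' v'' : ℝ) : ℝ :=
  (2 * u' ^ 2 + 2 * u * u'') * v ^ (-s) - (4 * s * u * u' * v' + s * u ^ 2 * v'') * v ^ (-s - 1) +
    s * (s + 1) * u ^ 2 * v' ^ 2 * v ^ (-s - 2)

lemma hasDerivAt_weighted {u v : ℝ → ℝ} {u' v' x : ℝ} (hu : HasDerivAt u u' x)
    (hv : HasDerivAt v v' x) (h0 : 0 < v x) :
    HasDerivAt (fun y => u y ^ 2 * v y ^ (-s)) (wd1 s (u x) (v x) u' v') x := by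
  refine ((hu.pow 2).mul (hv.rpow_const (p := -s) (Or.inl h0.ne'))).congr_deriv ?_
  simp only [wd1, Pi.pow_apply]
  push_cast
  ring

lemma hasDerivAt_wd1 {u v u1 v1 : ℝ → ℝ} {u'' v'' x : ℝ} (hu : HasDerivAt u (u1 x) x)
    (hv : HasDerivAt v (v1 x) x) (hu1 : HasDerivAt u1 u'' x) (hv1 : HasDerivAt v1 v'' x)
    (h0 : 0 < v x) :
    HasDerivAt (fun y => wd1 s (u y) (v y) (u1 y) (v1 y))
      (wd2 s (u x) (v x) (u1 x) (v1 x) u'' v'') x := by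
  have h := (((hu.const_mul 2).mul hu1).mul (hv.rpow_const (p := -s) (Or.inl h0.ne'))).sub
    ((((hu.pow 2).const_mul s).mul hv1).mul (hv.rpow_const (p := -s - 1) (Or.inl h0.ne')))
  refine HasDerivAt.congr_deriv (f := fun y => wd1 s (u y) (v y) (u1 y) (v1 y)) h ?_
  simp only [wd2, Pi.pow_apply, Pi.mul_apply]
  rw [show -s - 1 - 1 = -s - 2 by ring]
  push_cast
  ring

/-- The second derivatives enter with opposite signs in the two directions and cancel, which is
harmonicity. In each direction there remains a quadratic form in the derivative of `u` and in `y = u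
v'/v`; completing the square in `y` leaves the stated multiple of the squared derivative. -/
lemma wd2_add_wd2_ge {s : ℝ} (hs0 : 0 ≤ s) (u a b w q c d : ℝ) {v : ℝ} (h0 : 0 < v) :
    2 * (1 - s) / (1 + s) * ((a ^ 2 + b ^ 2) * v ^ (-s)) ≤
      wd2 s u v a c w q + wd2 s u v b d (-w) (-q) := by
  have e1 : v ^ (-s - 1) = v ^ (-s) * v⁻¹ := by rw [Real.rpow_sub_one h0.ne', div_eq_mul_inv]
  have e2 : v ^ (-s - 2) = v ^ (-s) * v⁻¹ ^ 2 := by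
    rw [show -s - 2 = -s - 1 - 1 by ring, Real.rpow_sub_one h0.ne', e1]; field_simp
  have hp : 0 < v ^ (-s) := Real.rpow_pos_of_pos h0 _
  unfold wd2
  rw [e1, e2]
  have hs1 : 0 < 1 + s := by linarith
  have key : ∀ a y : ℝ, 2 * (1 - s) / (1 + s) * a ^ 2 ≤
      2 * a ^ 2 - 4 * s * a * y + s * (s + 1) * y ^ 2 := by
    intro a y
    have : 2 * a ^ 2 - 4 * s * a * y + s * (s + 1) * y ^ 2 - 2 * (1 - s) / (1 + s) * a ^ 2 =
        s / (1 + s) * (2 * a - (1 + s) * y) ^ 2 := by field_simp; ring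
    have h2 : 0 ≤ s / (1 + s) * (2 * a - (1 + s) * y) ^ 2 := by positivity
    linarith
  have k1 := mul_le_mul_of_nonneg_right (key a (u * c * v⁻¹)) hp.le
  have k2 := mul_le_mul_of_nonneg_right (key b (u * d * v⁻¹)) hp.le
  calc _ = 2 * (1 - s) / (1 + s) * a ^ 2 * v ^ (-s) + 2 * (1 - s) / (1 + s) * b ^ 2 * v ^ (-s) := by
        ring
    _ ≤ _ := add_le_add k1 k2
    _ = _ := by ring

variable {s}

lemma continuousOn_weight {v : ℝ → ℝ → ℝ} (hv : ContinuousOn (Function.uncurry v) strip)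
    (h0 : ∀ x < 0, ∀ t, 0 < v x t) (a : ℝ) :
    ContinuousOn (Function.uncurry fun x t => v x t ^ a) strip :=
  hv.rpow_const fun q hq => Or.inl (h0 q.1 hq.1 q.2).ne'

/-- The weighted energy inequality in the half strip. -/
lemma weighted_energy_strip (hs0 : 0 ≤ s) {u ux ut w v vx vt q : ℝ → ℝ → ℝ}
    (hu : IsStripHarmonic u ux ut w) (hv : IsStripHarmonic v vx vt q)
    (h0 : ∀ x < 0, ∀ t, 0 < v x t) {X ε : ℝ} (hε : 0 < ε) (hX : ε < X) :
    2 * (1 - s) / (1 + s) * ∫ x in (-X)..(-ε), (-ε - x) * ∫ t in (0)..(2 * Real.pi),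
        (ux x t ^ 2 + ut x t ^ 2) * v x t ^ (-s) ≤
      (∫ t in (0)..(2 * Real.pi), u (-ε) t ^ 2 * v (-ε) t ^ (-s)) +
        (X - ε) * |∫ t in (0)..(2 * Real.pi), wd1 s (u (-X) t) (v (-X) t) (ux (-X) t) (vx (-X) t)|
      := by
  have cr := continuousOn_weight hv.cu h0
  have cu' : ContinuousOn (fun q : ℝ × ℝ => u q.1 q.2) strip := hu.cu
  have cux' : ContinuousOn (fun q : ℝ × ℝ => ux q.1 q.2) strip := hu.cux
  have cut' : ContinuousOn (fun q : ℝ × ℝ => ut q.1 q.2) strip := hu.cut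
  have cw' : ContinuousOn (fun q : ℝ × ℝ => w q.1 q.2) strip := hu.cw
  have cvx' : ContinuousOn (fun q : ℝ × ℝ => vx q.1 q.2) strip := hv.cux
  have cvt' : ContinuousOn (fun q : ℝ × ℝ => vt q.1 q.2) strip := hv.cut
  have cq' : ContinuousOn (fun p : ℝ × ℝ => q p.1 p.2) strip := hv.cw
  have cr0 : ContinuousOn (fun q : ℝ × ℝ => v q.1 q.2 ^ (-s)) strip := cr _
  have cr1 : ContinuousOn (fun q : ℝ × ℝ => v q.1 q.2 ^ (-s - 1)) strip := cr _
  have cr2 : ContinuousOn (fun q : ℝ × ℝ => v q.1 q.2 ^ (-s - 2)) strip := cr _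
  set F := fun x t => u x t ^ 2 * v x t ^ (-s) with hF
  set F1 := fun x t => wd1 s (u x t) (v x t) (ux x t) (vx x t) with hF1
  set F2 := fun x t => wd1 s (u x t) (v x t) (ut x t) (vt x t) with hF2
  set F11 := fun x t => wd2 s (u x t) (v x t) (ux x t) (vx x t) (w x t) (q x t) with hF11
  set F22 := fun x t => wd2 s (u x t) (v x t) (ut x t) (vt x t) (-(w x t)) (-(q x t)) with hF22
  have c0 : ContinuousOn (Function.uncurry F) strip :=
    show ContinuousOn (fun p : ℝ × ℝ => u p.1 p.2 ^ 2 * v p.1 p.2 ^ (-s)) strip by fun_prop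
  have c1 : ContinuousOn (Function.uncurry F1) strip := by
    change ContinuousOn (fun p : ℝ × ℝ => F1 p.1 p.2) strip
    simp only [hF1, wd1]; fun_prop
  have c11 : ContinuousOn (Function.uncurry F11) strip := by
    change ContinuousOn (fun p : ℝ × ℝ => F11 p.1 p.2) strip
    simp only [hF11, wd2]; fun_prop
  have c22 : ContinuousOn (Function.uncurry F22) strip := by
    change ContinuousOn (fun p : ℝ × ℝ => F22 p.1 p.2) strip
    simp only [hF22, wd2]; fun_prop
  have cG : ContinuousOn (Function.uncurry fun x t => (ux x t ^ 2 + ut x t ^ 2) * v x t ^ (-s))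
      strip := by
    change ContinuousOn (fun p : ℝ × ℝ => (ux p.1 p.2 ^ 2 + ut p.1 p.2 ^ 2) * v p.1 p.2 ^ (-s)) strip
    fun_prop
  have hg := green_strip (F := F) (F1 := F1) (F11 := F11) (F2 := F2) (F22 := F22)
    (fun x hx t => hasDerivAt_weighted s (hu.dx x hx t) (hv.dx x hx t) (h0 x hx t))
    (fun x hx t => hasDerivAt_wd1 s (u := fun y => u y t) (v := fun y => v y t)
      (u1 := fun y => ux y t) (v1 := fun y => vx y t) (hu.dx x hx t) (hv.dx x hx t)
      (hu.dxx x hx t) (hv.dxx x hx t) (h0 x hx t))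
    (fun x hx t => hasDerivAt_wd1 s (u1 := ut x) (v1 := vt x) (hu.dt x hx t) (hv.dt x hx t)
      (hu.dtt x hx t) (hv.dtt x hx t) (h0 x hx t)) c0 c1 c11 c22
    (fun x hx => by simp only [hF2, hu.per x hx, hv.per x hx, hu.pert x hx, hv.pert x hx]) hε hX
  have hXε : -X ≤ -ε := by linarith
  have hmono : 2 * (1 - s) / (1 + s) * ∫ x in (-X)..(-ε), (-ε - x) * ∫ t in (0)..(2 * Real.pi),
        (ux x t ^ 2 + ut x t ^ 2) * v x t ^ (-s) ≤
      ∫ x in (-X)..(-ε), (-ε - x) • ∫ t in (0)..(2 * Real.pi), (F11 x t + F22 x t) := by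
    have hcont : ∀ G : ℝ → ℝ → ℝ, ContinuousOn (Function.uncurry G) strip →
        IntervalIntegrable (fun x => (-ε - x) * ∫ t in (0)..(2 * Real.pi), G x t) volume
          (-X) (-ε) := by
      intro G hG
      exact (intervalIntegrable_integral_strip hG hε hX).continuousOn_mul (by fun_prop)
    rw [← intervalIntegral.integral_const_mul]
    refine intervalIntegral.integral_mono_on hXε ((hcont _ cG).const_mul _)
      (hcont _ (c11.add c22)) ?_
    intro x hx
    have hx0 : x < 0 := by linarith [hx.2]
    rw [smul_eq_mul, ← mul_assoc, mul_comm (2 * (1 - s) / (1 + s)), mul_assoc,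
      ← intervalIntegral.integral_const_mul]
    refine mul_le_mul_of_nonneg_left ?_ (by linarith [hx.2])
    refine intervalIntegral.integral_mono_on Real.two_pi_pos.le
      (((cG.strip_section hx0).const_mul _).intervalIntegrable _ _)
      (((c11.add c22).strip_section (F := fun x t => F11 x t + F22 x t) hx0).intervalIntegrable _ _)
      fun t _ => ?_
    exact wd2_add_wd2_ge hs0 _ _ _ _ _ _ _ (h0 x hx0 t)
  rw [hg] at hmono
  refine hmono.trans ?_
  -- The values at `-X` enter Green's formula with a minus sign, so this nonnegative integral may be
  -- dropped; only the derivative term at `-X` has to be estimated.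
  have n1 : 0 ≤ ∫ t in (0)..(2 * Real.pi), F (-X) t :=
    intervalIntegral.integral_nonneg Real.two_pi_pos.le fun t _ =>
      mul_nonneg (sq_nonneg _) (Real.rpow_nonneg (h0 _ (by linarith) t).le _)
  have n2 := neg_abs_le (∫ t in (0)..(2 * Real.pi), F1 (-X) t)
  have n3 := mul_le_mul_of_nonneg_left n2 (by linarith : 0 ≤ X - ε)
  rw [smul_eq_mul]
  linarith

end weighted

/-! ### The Poisson extension as a harmonic function in the half strip. -/

lemma isOpen_re_neg : IsOpen {w : ℂ | w.re < 0} := isOpen_lt Complex.continuous_re continuous_const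

/-- The harmonic function `a(x + it) + b(x - it) + c` built from analytic periodic `a`, `b`. -/
lemma isStripHarmonic_of_analytic {a b : ℂ → ℂ} (c : ℂ)
    (ha : DifferentiableOn ℂ a {w | w.re < 0}) (hb : DifferentiableOn ℂ b {w | w.re < 0})
    (pa : ∀ w, a (w + 2 * Real.pi * Complex.I) = a w)
    (pb : ∀ w, b (w + 2 * Real.pi * Complex.I) = b w)
    (da : ∃ C, ∀ w : ℂ, w.re ≤ -1 → ‖a w‖ ≤ C ∧ ‖deriv a w‖ ≤ C * Real.exp w.re)
    (db : ∃ C, ∀ w : ℂ, w.re ≤ -1 → ‖b w‖ ≤ C ∧ ‖deriv b w‖ ≤ C * Real.exp w.re) :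
    IsStripHarmonic (fun x t => a (x + t * Complex.I) + b (x - t * Complex.I) - c)
      (fun x t => deriv a (x + t * Complex.I) + deriv b (x - t * Complex.I))
      (fun x t => Complex.I * (deriv a (x + t * Complex.I) - deriv b (x - t * Complex.I)))
      (fun x t => deriv (deriv a) (x + t * Complex.I) + deriv (deriv b) (x - t * Complex.I)) := by
  have ha1 := ha.deriv isOpen_re_neg
  have hb1 := hb.deriv isOpen_re_neg
  have ha2 := ha1.deriv isOpen_re_neg
  have hb2 := hb1.deriv isOpen_re_neg
  have mp : ∀ x t : ℝ, x < 0 → ((x : ℂ) + t * Complex.I) ∈ {w : ℂ | w.re < 0} := by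
    intro x t hx; simpa using hx
  have mm : ∀ x t : ℝ, x < 0 → ((x : ℂ) - t * Complex.I) ∈ {w : ℂ | w.re < 0} := by
    intro x t hx; simpa using hx
  have dA : ∀ {g : ℂ → ℂ}, DifferentiableOn ℂ g {w | w.re < 0} → ∀ w ∈ {w : ℂ | w.re < 0},
      HasDerivAt g (deriv g w) w := fun hg w hw =>
    ((hg w hw).differentiableAt (isOpen_re_neg.mem_nhds hw)).hasDerivAt
  have lx : ∀ (k : ℂ) (x : ℝ), HasDerivAt (fun y : ℝ => (y : ℂ) + k) 1 x := fun k x =>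
    (Complex.ofRealCLM.hasDerivAt (x := x)).add_const k
  have lt : ∀ (k j : ℂ) (t : ℝ), HasDerivAt (fun y : ℝ => k + (y : ℂ) * j) j t := fun k j t => by
    simpa using ((Complex.ofRealCLM.hasDerivAt (x := t)).mul_const j).const_add k
  have xp : ∀ {g : ℂ → ℂ}, DifferentiableOn ℂ g {w | w.re < 0} → ∀ x < (0 : ℝ), ∀ t : ℝ,
      HasDerivAt (fun y : ℝ => g (y + t * Complex.I)) (deriv g (x + t * Complex.I)) x := by
    intro g hg x hx t
    have := (dA hg _ (mp x t hx)).comp x (lx (t * Complex.I) x)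
    rw [mul_one] at this
    exact this
  have xm : ∀ {g : ℂ → ℂ}, DifferentiableOn ℂ g {w | w.re < 0} → ∀ x < (0 : ℝ), ∀ t : ℝ,
      HasDerivAt (fun y : ℝ => g (y - t * Complex.I)) (deriv g (x - t * Complex.I)) x := by
    intro g hg x hx t
    have := xp hg x hx (-t)
    simpa [sub_eq_add_neg] using this
  have tp : ∀ {g : ℂ → ℂ}, DifferentiableOn ℂ g {w | w.re < 0} → ∀ x < (0 : ℝ), ∀ t : ℝ,
      HasDerivAt (fun y : ℝ => g (x + y * Complex.I))
        (deriv g (x + t * Complex.I) * Complex.I) t := by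
    intro g hg x hx t
    exact (dA hg _ (mp x t hx)).comp t (lt x Complex.I t)
  have tm : ∀ {g : ℂ → ℂ}, DifferentiableOn ℂ g {w | w.re < 0} → ∀ x < (0 : ℝ), ∀ t : ℝ,
      HasDerivAt (fun y : ℝ => g (x - y * Complex.I))
        (-(deriv g (x - t * Complex.I) * Complex.I)) t := by
    intro g hg x hx t
    have e : (x : ℂ) + (t : ℂ) * (-Complex.I) = x - t * Complex.I := by ring
    have h1 : HasDerivAt g (deriv g (x - t * Complex.I)) ((x : ℂ) + (t : ℂ) * (-Complex.I)) := by
      rw [e]; exact dA hg _ (mm x t hx)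
    have := h1.comp t (lt x (-Complex.I) t)
    simpa [sub_eq_add_neg, Function.comp_def] using this
  have cp : ∀ {g : ℂ → ℂ}, DifferentiableOn ℂ g {w | w.re < 0} →
      ContinuousOn (fun q : ℝ × ℝ => g (q.1 + q.2 * Complex.I)) strip := fun hg =>
    hg.continuousOn.comp (by fun_prop) fun q hq => mp q.1 q.2 hq.1
  have cm : ∀ {g : ℂ → ℂ}, DifferentiableOn ℂ g {w | w.re < 0} →
      ContinuousOn (fun q : ℝ × ℝ => g (q.1 - q.2 * Complex.I)) strip := fun hg =>
    hg.continuousOn.comp (by fun_prop) fun q hq => mm q.1 q.2 hq.1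
  have pd : ∀ {g : ℂ → ℂ}, (∀ w, g (w + 2 * Real.pi * Complex.I) = g w) →
      ∀ w, deriv g (w + 2 * Real.pi * Complex.I) = deriv g w := by
    intro g hg w
    have := deriv_comp_add_const g (2 * Real.pi * Complex.I) w
    rw [← this]
    congr 1
    exact funext hg
  have perp : ∀ {g : ℂ → ℂ}, (∀ w, g (w + 2 * Real.pi * Complex.I) = g w) → ∀ x : ℝ,
      g (x + ((2 * Real.pi : ℝ) : ℂ) * Complex.I) = g (x + ((0 : ℝ) : ℂ) * Complex.I) := by
    intro g hg x
    have := hg x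
    push_cast
    simpa using this
  have perm : ∀ {g : ℂ → ℂ}, (∀ w, g (w + 2 * Real.pi * Complex.I) = g w) → ∀ x : ℝ,
      g (x - ((2 * Real.pi : ℝ) : ℂ) * Complex.I) = g (x - ((0 : ℝ) : ℂ) * Complex.I) := by
    intro g hg x
    have := hg (x - 2 * Real.pi * Complex.I)
    push_cast
    simpa using this.symm
  refine ⟨?_, ?_, ?_, ?_, ?_, ?_, ?_, ?_, ?_, ?_, ?_⟩
  · exact fun x hx t => ((xp ha x hx t).add (xm hb x hx t)).sub_const c
  · intro x hx t
    refine (((tp ha x hx t).add (tm hb x hx t)).sub_const c).congr_deriv ?_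
    ring
  · exact fun x hx t => (xp ha1 x hx t).add (xm hb1 x hx t)
  · intro x hx t
    refine (((tp ha1 x hx t).sub (tm hb1 x hx t)).const_mul Complex.I).congr_deriv ?_
    linear_combination (deriv (deriv a) (x + t * Complex.I) +
      deriv (deriv b) (x - t * Complex.I)) * Complex.I_mul_I
  · exact ((cp ha).add (cm hb)).sub continuousOn_const
  · exact (cp ha1).add (cm hb1)
  · exact ((cp ha1).sub (cm hb1)).const_smul Complex.I
  · exact (cp ha2).add (cm hb2)
  · intro x _
    simp only [perp pa, perm pb]
  · intro x _
    simp only [perp (pd pa), perm (pd pb)]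
  · obtain ⟨C, hC⟩ := da
    obtain ⟨D, hD⟩ := db
    have hC0 : 0 ≤ C := (norm_nonneg _).trans (hC (-1) (by simp)).1
    have hD0 : 0 ≤ D := (norm_nonneg _).trans (hD (-1) (by simp)).1
    refine ⟨C + D + ‖c‖, fun x hx t => ?_⟩
    have h1 := hC (x + t * Complex.I) (by simpa using hx)
    have h2 := hD (x - t * Complex.I) (by simpa using hx)
    have e1 : ((x : ℂ) + t * Complex.I).re = x := by simp
    have e2 : ((x : ℂ) - t * Complex.I).re = x := by simp
    rw [e1] at h1
    rw [e2] at h2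
    constructor
    · calc _ ≤ ‖a (x + t * Complex.I)‖ + ‖b (x - t * Complex.I)‖ + ‖c‖ :=
            (norm_sub_le _ _).trans (add_le_add_left (norm_add_le _ _) _)
        _ ≤ _ := by gcongr; exacts [h1.1, h2.1]
    · refine (norm_add_le _ _).trans ((add_le_add h1.2 h2.2).trans ?_)
      have := Real.exp_pos x
      have := norm_nonneg c
      nlinarith

/-- The factor `exp w` from the chain rule is the source of the decay towards the centre of the
disk. For `re w ≤ -1` one has `|exp w| ≤ 1/2`, so the kernels are bounded by 4. -/
lemma cauchyInt_exp {e f : Torus → ℂ} (he : Measurable e) (he1 : ∀ t, ‖e t‖ = 1)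
    (hf : Integrable f arcMeasure) :
    (∀ w : ℂ, w.re < 0 → HasDerivAt (fun w => cauchyInt e f (Complex.exp w))
      (cauchyDeriv e f (Complex.exp w) * Complex.exp w) w) ∧
    (∃ C, ∀ w : ℂ, w.re ≤ -1 → ‖cauchyInt e f (Complex.exp w)‖ ≤ C ∧
      ‖deriv (fun w => cauchyInt e f (Complex.exp w)) w‖ ≤ C * Real.exp w.re) := by
  have h1 : ∀ w : ℂ, w.re < 0 → HasDerivAt (fun w => cauchyInt e f (Complex.exp w))
      (cauchyDeriv e f (Complex.exp w) * Complex.exp w) w := by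
    intro w hw
    refine (hasDerivAt_cauchyInt he he1 hf ?_).comp w (Complex.hasDerivAt_exp w)
    rw [Complex.norm_exp]; exact Real.exp_lt_one_iff.2 hw
  refine ⟨h1, (∫ t, ‖f t‖ ∂arcMeasure) * 4, fun w hw => ?_⟩
  have hn : ‖Complex.exp w‖ ≤ 1 / 2 := by
    rw [Complex.norm_exp]
    calc Real.exp w.re ≤ Real.exp (-1) := Real.exp_le_exp.2 hw
      _ ≤ 1 / 2 := by
        have := Real.exp_one_gt_d9
        rw [Real.exp_neg, ← one_div]
        gcongr
        linarith
  have hn1 : ‖Complex.exp w‖ < 1 := by linarith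
  constructor
  · unfold cauchyInt
    refine (norm_integral_le_integral_norm _).trans ?_
    rw [← integral_mul_const]
    refine integral_mono_of_nonneg (.of_forall fun t => norm_nonneg _) (hf.norm.mul_const 4)
      (.of_forall fun t => ?_)
    have := one_sub_norm_le_norm_one_sub_mul (Complex.exp w) (he1 t)
    simp only [norm_div]
    rw [div_le_iff₀ (by linarith)]
    nlinarith [norm_nonneg (f t)]
  · rw [(h1 w (by linarith)).deriv, norm_mul, Complex.norm_exp w]
    refine mul_le_mul_of_nonneg_right ?_ (Real.exp_pos _).le
    unfold cauchyDeriv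
    refine (norm_integral_le_integral_norm _).trans ?_
    rw [← integral_mul_const]
    refine integral_mono_of_nonneg (.of_forall fun t => norm_nonneg _) (hf.norm.mul_const 4)
      (.of_forall fun t => ?_)
    have := norm_cauchyDeriv_kernel_le he1 hn1 t
    simp only [norm_mul]
    refine mul_le_mul_of_nonneg_left (this.trans ?_) (norm_nonneg _)
    rw [div_le_iff₀ (by nlinarith)]
    nlinarith

lemma exp_mul_point (x t : ℝ) :
    (Real.exp x : ℂ) * point (t : Torus) = Complex.exp (x + t * Complex.I) := by
  rw [point_coe, Complex.exp_add, Complex.ofReal_exp]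

lemma conj_exp_mul_point (x t : ℝ) :
    (starRingEnd ℂ) ((Real.exp x : ℂ) * point (t : Torus)) = Complex.exp (x - t * Complex.I) := by
  rw [exp_mul_point, ← Complex.exp_conj]
  simp [sub_eq_add_neg]

lemma norm_exp_mul_point_lt {x : ℝ} (hx : x < 0) (t : Torus) :
    ‖(Real.exp x : ℂ) * point t‖ < 1 := by
  rw [norm_mul_point, abs_of_pos (Real.exp_pos x)]; exact Real.exp_lt_one_iff.2 hx

/-- The Poisson extension in logarithmic coordinates. -/
theorem exists_isStripHarmonic {f : Torus → ℂ} (hf : Integrable f arcMeasure) :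
    ∃ u ux ut w : ℝ → ℝ → ℂ, IsStripHarmonic u ux ut w ∧
      (∀ x < 0, ∀ t : ℝ, u x t = poissonExtension f (Real.exp x * point (t : Torus))) ∧
      (∀ x < 0, ∀ t : ℝ, ‖ux x t‖ ^ 2 + ‖ut x t‖ ^ 2 =
        Real.exp x ^ 2 * gradNormSq (poissonExtension f) (Real.exp x * point (t : Torus))) := by
  obtain ⟨a1, a2⟩ := cauchyInt_exp measurable_cpoint norm_cpoint hf
  obtain ⟨b1, b2⟩ := cauchyInt_exp measurable_point norm_point hf
  have pe : ∀ (g : ℂ → ℂ) (w : ℂ), g (Complex.exp (w + 2 * Real.pi * Complex.I)) =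
      g (Complex.exp w) := fun g w => by rw [Complex.exp_periodic w]
  refine ⟨_, _, _, _, isStripHarmonic_of_analytic (∫ t, f t ∂arcMeasure)
    (fun w hw => (a1 w hw).differentiableAt.differentiableWithinAt)
    (fun w hw => (b1 w hw).differentiableAt.differentiableWithinAt)
    (pe _) (pe _) a2 b2, ?_, ?_⟩
  · intro x hx t
    rw [poissonExtension_eq hf (norm_exp_mul_point_lt hx _), conj_exp_mul_point, exp_mul_point]
    rfl
  · intro x hx t
    rw [gradNormSq_poissonExtension hf (norm_exp_mul_point_lt hx _), conj_exp_mul_point,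
      exp_mul_point, (a1 _ (by simpa using hx)).deriv, (b1 _ (by simpa using hx)).deriv]
    change _ = _ * (2 * (‖cauchyDeriv cpoint f (Complex.exp (x + t * Complex.I))‖ ^ 2 +
      ‖cauchyDeriv point f (Complex.exp (x - t * Complex.I))‖ ^ 2))
    have n1 : ‖Complex.exp (x + t * Complex.I)‖ = Real.exp x := by rw [Complex.norm_exp]; simp
    have n2 : ‖Complex.exp (x - t * Complex.I)‖ = Real.exp x := by rw [Complex.norm_exp]; simp
    have key : ∀ p q : ℂ, ‖p + q‖ ^ 2 + ‖Complex.I * (p - q)‖ ^ 2 = 2 * (‖p‖ ^ 2 + ‖q‖ ^ 2) := by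
      intro p q
      simp only [← Complex.normSq_eq_norm_sq, Complex.normSq_apply]
      simp
      ring
    rw [key, norm_mul, norm_mul, n1, n2]
    ring

/-! ### The weighted energy inequality in the disk. -/

lemma lintegral_arcMeasure_eq (g : Torus → ℝ≥0∞) :
    ∫⁻ t, g t ∂arcMeasure =
      ENNReal.ofReal (2 * Real.pi)⁻¹ * ∫⁻ t in Ioc 0 (2 * Real.pi), g (t : Torus) := by
  rw [arcMeasure_eq, lintegral_smul_measure, smul_eq_mul,
    ← AddCircle.lintegral_preimage (2 * Real.pi) 0, zero_add]

lemma integral_arcMeasure_eq {E : Type*} [NormedAddCommGroup E] [NormedSpace ℝ E] (g : Torus → E) :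
    ∫ t, g t ∂arcMeasure = (2 * Real.pi)⁻¹ • ∫ t in (0)..(2 * Real.pi), g (t : Torus) := by
  unfold arcMeasure
  rw [AddCircle.integral_haarAddCircle, ← AddCircle.intervalIntegral_preimage (2 * Real.pi) 0,
    zero_add]

lemma setLIntegral_Ioo_zero_one_eq (g : ℝ → ℝ≥0∞) :
    ∫⁻ r in Ioo 0 1, g r = ∫⁻ x in Iio 0, ENNReal.ofReal (Real.exp x) * g (Real.exp x) := by
  have himg : Real.exp '' Iio 0 = Ioo 0 1 := by
    ext r
    constructor
    · rintro ⟨x, hx, rfl⟩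
      exact ⟨Real.exp_pos x, Real.exp_lt_one_iff.2 hx⟩
    · rintro ⟨h0, h1⟩
      exact ⟨Real.log r, Real.log_neg h0 h1, Real.exp_log h0⟩
  rw [← himg, lintegral_image_eq_lintegral_abs_deriv_mul measurableSet_Iio
    (fun x _ => (Real.hasDerivAt_exp x).hasDerivWithinAt) Real.exp_injective.injOn]
  simp_rw [abs_of_pos (Real.exp_pos _)]

/-- Jensen's inequality for concave powers. -/
lemma lintegral_rpow_le_rpow_lintegral {α : Type*} [MeasurableSpace α] {ν : Measure α}
    [IsProbabilityMeasure ν] {h : α → ℝ≥0∞} (hh : Measurable h) {s : ℝ} (hs0 : 0 ≤ s)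
    (hs1 : s ≤ 1) : ∫⁻ a, h a ^ s ∂ν ≤ (∫⁻ a, h a ∂ν) ^ s := by
  rcases hs0.eq_or_lt with rfl | hs0
  · simp
  rcases hs1.eq_or_lt with rfl | hs1
  · simp
  have hc : (1 / s).HolderConjugate (1 / (1 - s)) := by
    rw [Real.holderConjugate_iff]
    refine ⟨by rw [lt_div_iff₀ hs0]; linarith, by simp⟩
  have := ENNReal.lintegral_mul_le_Lp_mul_Lq ν hc (hh.pow_const s).aemeasurable
    (aemeasurable_const (b := (1 : ℝ≥0∞)))
  simp only [Pi.mul_apply, mul_one, ENNReal.one_rpow, lintegral_const, measure_univ,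
    ← ENNReal.rpow_mul, one_div_one_div, mul_one_div_cancel hs0.ne', ENNReal.rpow_one] at this
  exact this

lemma poissonL_eq_withDensity {ψ : Torus → ℝ≥0∞} (hψ : Measurable ψ) (z : ℂ) :
    poissonL ψ z = ∫⁻ t, ψ t ∂(arcMeasure.withDensity fun t => ENNReal.ofReal (ker z t)) := by
  rw [lintegral_withDensity_eq_lintegral_mul _ (measurable_ofReal_ker z) hψ]
  rfl

lemma isProbabilityMeasure_withDensity_ker {z : ℂ} (hz : ‖z‖ < 1) :
    IsProbabilityMeasure (arcMeasure.withDensity fun t => ENNReal.ofReal (ker z t)) :=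
  ⟨by rw [withDensity_apply _ MeasurableSet.univ, setLIntegral_univ, lintegral_ker hz]⟩

lemma poissonL_rpow_le {h : Torus → ℝ≥0∞} (hh : Measurable h) {s : ℝ} (hs0 : 0 ≤ s)
    (hs1 : s ≤ 1) {z : ℂ} (hz : ‖z‖ < 1) :
    poissonL (fun t => h t ^ s) z ≤ poissonL h z ^ s := by
  have := isProbabilityMeasure_withDensity_ker hz
  rw [poissonL_eq_withDensity (hh.pow_const s), poissonL_eq_withDensity hh]
  exact lintegral_rpow_le_rpow_lintegral hh hs0 hs1

lemma enorm_poissonExtension_le (f : Torus → ℂ) {z : ℂ} (hz : ‖z‖ < 1) :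
    ‖poissonExtension f z‖ₑ ≤ poissonL (fun t => ‖f t‖ₑ) z := by
  refine (enorm_integral_le_lintegral_enorm _).trans_eq (lintegral_congr fun t => ?_)
  change ‖(ker z t : ℂ) * f t‖ₑ = _
  rw [enorm_mul, ← Real.enorm_eq_ofReal (ker_pos hz t).le]
  congr 1
  rw [← ofReal_norm, ← ofReal_norm, Complex.norm_real]

/-- Cauchy–Schwarz for the Poisson probability measure applied to `|f| = (|f| h^(-s/2)) h^(s/2)`,
then Jensen for the concave power `s`. It bounds the boundary term of Green's formula on every
circle at once. -/
lemma enorm_poissonExtension_sq_le {f : Torus → ℂ} (hf : Measurable f) {h : Torus → ℝ≥0∞}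
    (hh : Measurable h) (h0 : ∀ t, h t ≠ 0) (ht : ∀ t, h t ≠ ∞) {s : ℝ} (hs0 : 0 ≤ s)
    (hs1 : s ≤ 1) {z : ℂ} (hz : ‖z‖ < 1) :
    ‖poissonExtension f z‖ₑ ^ 2 * poissonL h z ^ (-s) ≤
      poissonL (fun t => ‖f t‖ₑ ^ 2 * h t ^ (-s)) z := by
  have hP := isProbabilityMeasure_withDensity_ker hz
  have hfm : Measurable fun t => ‖f t‖ₑ := hf.enorm
  have m1 : Measurable fun t => ‖f t‖ₑ * h t ^ (-s / 2) := hfm.mul (hh.pow_const _)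
  have m2 : Measurable fun t => h t ^ (s / 2) := hh.pow_const _
  have hc : (2 : ℝ).HolderConjugate 2 := by rw [Real.holderConjugate_iff]; norm_num
  have h1 := ENNReal.lintegral_mul_le_Lp_mul_Lq
    (arcMeasure.withDensity fun t => ENNReal.ofReal (ker z t)) hc m1.aemeasurable m2.aemeasurable
  have e0 : ∀ t, ‖f t‖ₑ * h t ^ (-s / 2) * h t ^ (s / 2) = ‖f t‖ₑ := by
    intro t
    rw [mul_assoc, ← ENNReal.rpow_add _ _ (h0 t) (ht t)]
    simp [neg_div]
  have e1 : ∀ t, (‖f t‖ₑ * h t ^ (-s / 2)) ^ (2 : ℝ) = ‖f t‖ₑ ^ 2 * h t ^ (-s) := by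
    intro t
    rw [ENNReal.mul_rpow_of_nonneg _ _ (by norm_num), ← ENNReal.rpow_mul, ENNReal.rpow_two]
    congr 2; ring
  have e2 : ∀ t, (h t ^ (s / 2)) ^ (2 : ℝ) = h t ^ s := by
    intro t
    rw [← ENNReal.rpow_mul]; congr 1; ring
  simp only [Pi.mul_apply, e0, e1, e2] at h1
  have m3 : Measurable fun t => ‖f t‖ₑ ^ 2 * h t ^ (-s) := (hfm.pow_const 2).mul (hh.pow_const _)
  rw [← poissonL_eq_withDensity hfm, ← poissonL_eq_withDensity m3, ← poissonL_eq_withDensity (hh.pow_const _)] at h1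
  set A := poissonL (fun t => ‖f t‖ₑ ^ 2 * h t ^ (-s)) z with hA
  have h2 : ‖poissonExtension f z‖ₑ ^ 2 ≤ A * poissonL (fun t => h t ^ s) z := by
    calc ‖poissonExtension f z‖ₑ ^ 2 ≤ (A ^ (1 / (2 : ℝ)) *
          poissonL (fun t => h t ^ s) z ^ (1 / (2 : ℝ))) ^ 2 := by
          gcongr
          exact (enorm_poissonExtension_le f hz).trans h1
      _ = _ := by
          rw [mul_pow, ← ENNReal.rpow_two, ← ENNReal.rpow_two, ← ENNReal.rpow_mul,
            ← ENNReal.rpow_mul]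
          norm_num
  calc _ ≤ A * poissonL h z ^ s * poissonL h z ^ (-s) := by
        gcongr
        exact h2.trans (mul_le_mul_right (poissonL_rpow_le hh hs0 hs1 hz) _)
    _ ≤ A * 1 := by
        rw [mul_assoc]
        gcongr
        rw [ENNReal.rpow_neg]
        exact ENNReal.mul_inv_le_one _
    _ = A := mul_one A

/-- Passage to the limit in truncated weighted integrals over `x < 0`. -/
lemma lintegral_Iio_le_of_truncations {Φ : ℝ → ℝ≥0∞} (hΦ : AEMeasurable Φ (volume.restrict (Iio 0)))
    {R : ℝ≥0∞} {T : ℕ → ℝ} (hT : Filter.Tendsto T Filter.atTop (nhds 0))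
    (h : ∀ n : ℕ, ∫⁻ x in Ioc (-(n + 2 : ℝ)) (-(1 / (n + 2 : ℝ))),
      ENNReal.ofReal (-(1 / (n + 2 : ℝ)) - x) * Φ x ≤ R + ENNReal.ofReal (T n)) :
    ∫⁻ x in Iio 0, ENNReal.ofReal (-x) * Φ x ≤ R := by
  set G : ℕ → ℝ → ℝ≥0∞ := fun n => (Ioc (-(n + 2 : ℝ)) (-(1 / (n + 2 : ℝ)))).indicator
    fun x => ENNReal.ofReal (-(1 / (n + 2 : ℝ)) - x) * Φ x with hG
  have hsub : ∀ n : ℕ, Ioc (-(n + 2 : ℝ)) (-(1 / (n + 2 : ℝ))) ⊆ Iio 0 := by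
    intro n x hx
    have : 0 < 1 / (n + 2 : ℝ) := by positivity
    exact mem_Iio.2 (by linarith [hx.2])
  have hGm : ∀ n, AEMeasurable (G n) (volume.restrict (Iio 0)) := fun n =>
    (AEMeasurable.mul (by fun_prop) hΦ).indicator measurableSet_Ioc
  have hGint : ∀ n, ∫⁻ x in Iio 0, G n x ≤ R + ENNReal.ofReal (T n) := by
    intro n
    rw [hG, setLIntegral_indicator measurableSet_Ioc, inter_eq_left.2 (hsub n)]
    exact h n
  have hlim : ∀ x ∈ Iio (0 : ℝ), Filter.Tendsto (fun n => G n x) Filter.atTop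
      (nhds (ENNReal.ofReal (-x) * Φ x)) := by
    intro x (hx : x < 0)
    have ht : Filter.Tendsto (fun n : ℕ => 1 / (n + 2 : ℝ)) Filter.atTop (nhds 0) := by
      have := (tendsto_one_div_add_atTop_nhds_zero_nat (𝕜 := ℝ)).comp (Filter.tendsto_add_atTop_nat 1)
      refine this.congr fun n => ?_
      simp; ring
    have hev : ∀ᶠ n : ℕ in Filter.atTop, ENNReal.ofReal (-(1 / (n + 2 : ℝ)) - x) * Φ x = G n x := by
      have h1 := ht.eventually (gt_mem_nhds (show 0 < -x by linarith))
      have h2 := Filter.tendsto_atTop.1 (tendsto_natCast_atTop_atTop (R := ℝ)) (-x)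
      filter_upwards [h1, h2] with n hn1 hn2
      have : x ∈ Ioc (-(n + 2 : ℝ)) (-(1 / (n + 2 : ℝ))) := ⟨by linarith, by linarith⟩
      simp only [hG]
      rw [indicator_of_mem this]
    refine Filter.Tendsto.congr' hev ?_
    rcases eq_or_ne (Φ x) ∞ with hΦx | hΦx
    · refine ENNReal.Tendsto.mul_const ?_ (Or.inl (ENNReal.ofReal_pos.2 (by linarith)).ne')
      refine ENNReal.tendsto_ofReal ?_
      simpa using (ht.neg.sub_const x)
    · refine ENNReal.Tendsto.mul_const ?_ (Or.inr hΦx)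
      refine ENNReal.tendsto_ofReal ?_
      simpa using (ht.neg.sub_const x)
  calc ∫⁻ x in Iio 0, ENNReal.ofReal (-x) * Φ x
      = ∫⁻ x in Iio 0, Filter.liminf (fun n => G n x) Filter.atTop := by
        refine setLIntegral_congr_fun measurableSet_Iio fun x hx => ?_
        exact (hlim x hx).liminf_eq.symm
    _ ≤ Filter.liminf (fun n => ∫⁻ x in Iio 0, G n x) Filter.atTop := lintegral_liminf_le' hGm
    _ ≤ Filter.liminf (fun n => R + ENNReal.ofReal (T n)) Filter.atTop :=
        Filter.liminf_le_liminf (.of_forall hGint)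
    _ = R := by
        have : Filter.Tendsto (fun n => R + ENNReal.ofReal (T n)) Filter.atTop
            (nhds (R + ENNReal.ofReal 0)) := (ENNReal.tendsto_ofReal hT).const_add R
        rw [this.liminf_eq]; simp

lemma aemeasurable_lintegral_strip {D : ℝ → ℝ → ℝ} (hD : ContinuousOn (Function.uncurry D) strip) :
    AEMeasurable (fun x => ∫⁻ t in Ioc 0 (2 * Real.pi), ENNReal.ofReal (D x t))
      (volume.restrict (Iio 0)) := by
  have hms : MeasurableSet strip := measurableSet_Iio.prod MeasurableSet.univ
  have h1 : AEMeasurable (Function.uncurry D) (volume.restrict strip) := hD.aemeasurable hms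
  have h2 : AEMeasurable (Function.uncurry D)
      ((volume.restrict (Iio (0 : ℝ))).prod (volume.restrict (Ioc (0 : ℝ) (2 * Real.pi)))) := by
    rw [Measure.prod_restrict, ← Measure.volume_eq_prod]
    exact h1.mono_measure (Measure.restrict_mono (prod_mono_right (subset_univ _)) le_rfl)
  exact h2.ennreal_ofReal.lintegral_prod_right'

lemma lintegral_strip_truncation {D : ℝ → ℝ → ℝ} (hD : ContinuousOn (Function.uncurry D) strip)
    (h0 : ∀ x < 0, ∀ t, 0 ≤ D x t) {X ε : ℝ} (hε : 0 < ε) (hX : ε < X) :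
    ∫⁻ x in Ioc (-X) (-ε), ENNReal.ofReal (-ε - x) *
        ∫⁻ t in Ioc 0 (2 * Real.pi), ENNReal.ofReal (D x t) =
      ENNReal.ofReal (∫ x in (-X)..(-ε), (-ε - x) * ∫ t in (0)..(2 * Real.pi), D x t) := by
  have hin : ∀ x < 0, ∫⁻ t in Ioc 0 (2 * Real.pi), ENNReal.ofReal (D x t) =
      ENNReal.ofReal (∫ t in (0)..(2 * Real.pi), D x t) := by
    intro x hx
    rw [intervalIntegral.integral_of_le Real.two_pi_pos.le,
      ofReal_integral_eq_lintegral_ofReal _ (.of_forall fun t => h0 x hx t)]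
    exact ((hD.strip_section hx).intervalIntegrable 0 (2 * Real.pi)).1
  have hnn : ∀ x < 0, 0 ≤ ∫ t in (0)..(2 * Real.pi), D x t := fun x hx =>
    intervalIntegral.integral_nonneg Real.two_pi_pos.le fun t _ => h0 x hx t
  rw [intervalIntegral.integral_of_le (by linarith), ofReal_integral_eq_lintegral_ofReal]
  · refine setLIntegral_congr_fun measurableSet_Ioc fun x hx => ?_
    have hx0 : x < 0 := by linarith [hx.2]
    change ENNReal.ofReal (-ε - x) * _ = _
    rw [hin x hx0, ← ENNReal.ofReal_mul (by linarith [hx.2])]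
  · exact ((intervalIntegrable_integral_strip hD hε hX).continuousOn_mul
      (g := fun x => -ε - x) (by fun_prop)).1
  · refine (ae_restrict_iff' measurableSet_Ioc).2 (.of_forall fun x hx => ?_)
    exact mul_nonneg (by linarith [hx.2]) (hnn x (by linarith [hx.2]))

lemma tendsto_mul_exp_neg_nat (K : ℝ) :
    Filter.Tendsto (fun n : ℕ => ((n + 2 : ℝ) * (K * Real.exp (-(n + 2 : ℝ))))) Filter.atTop
      (nhds 0) := by
  have h1 := (Real.tendsto_pow_mul_exp_neg_atTop_nhds_zero 1).comp
    (Filter.tendsto_atTop_add_const_right _ (2 : ℝ) (tendsto_natCast_atTop_atTop (R := ℝ)))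
  have h2 := h1.const_mul K
  rw [mul_zero] at h2
  refine h2.congr fun n => ?_
  simp only [Function.comp, pow_one]
  ring

/-- Controls the derivative term at `x = -X`, with `E = exp (-X)`: the lower bound `c` tames the
negative powers of `v`, and each summand contains one decaying derivative. -/
lemma abs_wd1_le {s c C M E u v u' v' : ℝ} (hs0 : 0 ≤ s) (hc : 0 < c) (hv : c ≤ v)
    (hu : |u| ≤ C) (hu' : |u'| ≤ C * E) (hv' : |v'| ≤ M * E) (hE : 0 ≤ E) :
    |wd1 s u v u' v'| ≤ (2 * C * C * c ^ (-s) + s * C ^ 2 * M * c ^ (-s - 1)) * E := by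
  have hv0 : 0 < v := hc.trans_le hv
  have hC : 0 ≤ C := (abs_nonneg u).trans hu
  have r1 : v ^ (-s) ≤ c ^ (-s) := Real.rpow_le_rpow_of_nonpos hc hv (by linarith)
  have r2 : v ^ (-s - 1) ≤ c ^ (-s - 1) := Real.rpow_le_rpow_of_nonpos hc hv (by linarith)
  have p1 : 0 ≤ v ^ (-s) := Real.rpow_nonneg hv0.le _
  have p2 : 0 ≤ v ^ (-s - 1) := Real.rpow_nonneg hv0.le _
  have hM : 0 ≤ M * E := (abs_nonneg v').trans hv'
  have hCE : 0 ≤ C * E := mul_nonneg hC hE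
  unfold wd1
  calc _ ≤ |2 * u * u' * v ^ (-s)| + |s * u ^ 2 * v' * v ^ (-s - 1)| := abs_sub _ _
    _ = 2 * |u| * |u'| * v ^ (-s) + s * |u| ^ 2 * |v'| * v ^ (-s - 1) := by
      simp only [abs_mul, abs_pow, abs_of_nonneg p1, abs_of_nonneg p2, abs_of_nonneg hs0, abs_two]
    _ ≤ 2 * C * (C * E) * c ^ (-s) + s * C ^ 2 * (M * E) * c ^ (-s - 1) := by gcongr
    _ = _ := by ring

/-- The weighted energy inequality for a real harmonic function in the half strip. -/
lemma lintegral_weighted_energy_strip {s : ℝ} (hs0 : 0 ≤ s) (hs1 : s < 1)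
    {u ux ut w v vx vt q : ℝ → ℝ → ℝ}
    (hu : IsStripHarmonic u ux ut w) (hv : IsStripHarmonic v vx vt q) {c : ℝ} (hc : 0 < c)
    (hvc : ∀ x < 0, ∀ t, c ≤ v x t) {R : ℝ≥0∞}
    (hR : ∀ x < 0, ∫⁻ t in Ioc 0 (2 * Real.pi), ENNReal.ofReal (u x t ^ 2 * v x t ^ (-s)) ≤ R) :
    ∫⁻ x in Iio 0, ENNReal.ofReal (-x) * ∫⁻ t in Ioc 0 (2 * Real.pi),
        ENNReal.ofReal ((ux x t ^ 2 + ut x t ^ 2) * v x t ^ (-s)) ≤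
      ENNReal.ofReal ((1 + s) / (2 * (1 - s))) * R := by
  have h0 : ∀ x < 0, ∀ t, 0 < v x t := fun x hx t => hc.trans_le (hvc x hx t)
  set κ := (1 + s) / (2 * (1 - s)) with hκ
  have hκ0 : 0 < κ := by
    have : 0 < 1 - s := by linarith
    positivity
  rcases eq_or_ne R ∞ with rfl | hRt
  · rw [ENNReal.mul_top (ENNReal.ofReal_pos.2 hκ0).ne']; exact le_top
  have cr := continuousOn_weight hv.cu h0
  have cu' : ContinuousOn (fun q : ℝ × ℝ => u q.1 q.2) strip := hu.cu
  have cux' : ContinuousOn (fun q : ℝ × ℝ => ux q.1 q.2) strip := hu.cux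
  have cut' : ContinuousOn (fun q : ℝ × ℝ => ut q.1 q.2) strip := hu.cut
  have cr0 : ContinuousOn (fun q : ℝ × ℝ => v q.1 q.2 ^ (-s)) strip := cr _
  have cD : ContinuousOn (Function.uncurry fun x t => (ux x t ^ 2 + ut x t ^ 2) * v x t ^ (-s))
      strip := by
    change ContinuousOn (fun p : ℝ × ℝ => (ux p.1 p.2 ^ 2 + ut p.1 p.2 ^ 2) * v p.1 p.2 ^ (-s)) strip
    fun_prop
  have cF : ContinuousOn (Function.uncurry fun x t => u x t ^ 2 * v x t ^ (-s)) strip := by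
    change ContinuousOn (fun p : ℝ × ℝ => u p.1 p.2 ^ 2 * v p.1 p.2 ^ (-s)) strip
    fun_prop
  obtain ⟨C, hC⟩ := hu.decay
  obtain ⟨M, hM⟩ := hv.decay
  set K := 2 * C * C * c ^ (-s) + s * C ^ 2 * M * c ^ (-s - 1) with hK
  refine lintegral_Iio_le_of_truncations
    (T := fun n : ℕ => κ * ((n + 2 : ℝ) * (K * (2 * Real.pi) * Real.exp (-(n + 2 : ℝ)))))
    (aemeasurable_lintegral_strip cD) ?_ ?_
  · simpa using (tendsto_mul_exp_neg_nat (K * (2 * Real.pi))).const_mul κ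
  intro n
  -- With `X ≥ 2` one has `ε = 1/X < X`, and the decay bounds, valid for `x ≤ -1`, apply at `-X`.
  -- The leftover term is of order `X exp (-X)`.
  set X : ℝ := n + 2 with hX
  set ε : ℝ := 1 / X with hε
  have hX2 : 2 ≤ X := by rw [hX]; linarith [Nat.cast_nonneg (α := ℝ) n]
  have hε0 : 0 < ε := by positivity
  have hεX : ε < X := by
    rw [hε, div_lt_iff₀ (by linarith)]; nlinarith
  rw [lintegral_strip_truncation cD (fun x hx t => mul_nonneg (by positivity)
    (Real.rpow_nonneg (h0 x hx t).le _)) hε0 hεX]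
  have hmain := weighted_energy_strip hs0 hu hv h0 hε0 hεX
  set Y := ∫ x in (-X)..(-ε), (-ε - x) * ∫ t in (0)..(2 * Real.pi),
        (ux x t ^ 2 + ut x t ^ 2) * v x t ^ (-s) with hY
  have hb : |∫ t in (0)..(2 * Real.pi), wd1 s (u (-X) t) (v (-X) t) (ux (-X) t) (vx (-X) t)| ≤
      K * (2 * Real.pi) * Real.exp (-X) := by
    have := intervalIntegral.norm_integral_le_of_norm_le_const (a := 0) (b := 2 * Real.pi)
      (C := K * Real.exp (-X))
      (f := fun t => wd1 s (u (-X) t) (v (-X) t) (ux (-X) t) (vx (-X) t)) (fun t _ =>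
        abs_wd1_le hs0 hc (hvc (-X) (by linarith) t) (hC (-X) (by linarith) t).1
          (hC (-X) (by linarith) t).2 (hM (-X) (by linarith) t).2 (Real.exp_pos _).le)
    rw [sub_zero, abs_of_pos Real.two_pi_pos] at this
    refine this.trans (le_of_eq ?_)
    ring
  have hFR : ∫ t in (0)..(2 * Real.pi), u (-ε) t ^ 2 * v (-ε) t ^ (-s) ≤ R.toReal := by
    have hε' : -ε < 0 := by linarith
    have := hR (-ε) hε'
    rw [← ofReal_integral_eq_lintegral_ofReal, ← intervalIntegral.integral_of_le
      Real.two_pi_pos.le] at this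
    · exact (ENNReal.ofReal_le_iff_le_toReal hRt).1 this
    · exact ((cF.strip_section (F := fun x t => u x t ^ 2 * v x t ^ (-s)) hε').intervalIntegrable
        0 (2 * Real.pi)).1
    · exact .of_forall fun t => mul_nonneg (sq_nonneg _) (Real.rpow_nonneg (h0 _ hε' t).le _)
  have hYle : Y ≤ κ * R.toReal + κ * (X * (K * (2 * Real.pi) * Real.exp (-X))) := by
    have e : Y = κ * (2 * (1 - s) / (1 + s) * Y) := by
      have : 0 < 1 - s := by linarith
      rw [hκ]; field_simp
    rw [e, ← mul_add]
    refine mul_le_mul_of_nonneg_left (hmain.trans (add_le_add hFR ?_)) hκ0.le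
    have : 0 ≤ K * (2 * Real.pi) * Real.exp (-X) := (abs_nonneg _).trans hb
    calc _ ≤ (X - ε) * (K * (2 * Real.pi) * Real.exp (-X)) :=
          mul_le_mul_of_nonneg_left hb (by linarith)
      _ ≤ _ := mul_le_mul_of_nonneg_right (by linarith) this
  calc ENNReal.ofReal Y ≤ ENNReal.ofReal (κ * R.toReal) +
        ENNReal.ofReal (κ * (X * (K * (2 * Real.pi) * Real.exp (-X)))) :=
        (ENNReal.ofReal_le_ofReal hYle).trans ENNReal.ofReal_add_le
    _ = _ := by
        rw [ENNReal.ofReal_mul hκ0.le, ENNReal.ofReal_toReal hRt]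

lemma poissonExtension_ofReal (h : Torus → ℝ) (z : ℂ) :
    poissonExtension (fun t => (h t : ℂ)) z = ((∫ t, ker z t * h t ∂arcMeasure : ℝ) : ℂ) := by
  rw [← integral_complex_ofReal]
  refine integral_congr_ae (.of_forall fun t => ?_)
  change (ker z t : ℂ) * (h t : ℂ) = _
  push_cast
  rfl

lemma integrable_ker_mul {h : Torus → ℝ} (hh : Integrable h arcMeasure) {z : ℂ} (hz : ‖z‖ < 1) :
    Integrable (fun t => ker z t * h t) arcMeasure := by
  refine hh.bdd_mul (c := 2 / (1 - ‖z‖)) (continuous_ker hz).aestronglyMeasurable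
    (.of_forall fun t => ?_)
  rw [Real.norm_of_nonneg (ker_pos hz t).le]
  exact ker_le hz t

lemma ofReal_re_poissonExtension {h : Torus → ℝ} (hh : Integrable h arcMeasure) (h0 : ∀ t, 0 ≤ h t)
    {z : ℂ} (hz : ‖z‖ < 1) :
    ENNReal.ofReal (poissonExtension (fun t => (h t : ℂ)) z).re =
      poissonL (fun t => ENNReal.ofReal (h t)) z := by
  rw [poissonExtension_ofReal, Complex.ofReal_re, ofReal_integral_eq_lintegral_ofReal
    (integrable_ker_mul hh hz) (.of_forall fun t => mul_nonneg (ker_pos hz t).le (h0 t))]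
  exact lintegral_congr fun t => ENNReal.ofReal_mul (ker_pos hz t).le

lemma le_re_poissonExtension {h : Torus → ℝ} (hh : Integrable h arcMeasure) {c : ℝ}
    (hc : ∀ t, c ≤ h t) {z : ℂ} (hz : ‖z‖ < 1) :
    c ≤ (poissonExtension (fun t => (h t : ℂ)) z).re := by
  rw [poissonExtension_ofReal, Complex.ofReal_re]
  calc c = ∫ t, ker z t * c ∂arcMeasure := by rw [integral_mul_const, integral_ker hz, one_mul]
    _ ≤ _ := integral_mono ((integrable_ker hz).mul_const c) (integrable_ker_mul hh hz)
        fun t => mul_le_mul_of_nonneg_left (hc t) (ker_pos hz t).le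

/-- Polar integrals over the disk in logarithmic coordinates. -/
lemma lintegral_disk_eq_strip {K : ℂ → ℝ≥0∞} {Θ : ℝ → ℝ → ℝ≥0∞}
    (hK : ∀ x < 0, ∀ t : ℝ, ENNReal.ofReal (Real.exp x) ^ 2 * K (Real.exp x * point (t : Torus)) =
      Θ x t)
    (hΘ : AEMeasurable (Function.uncurry Θ) ((volume.restrict (Iio (0 : ℝ))).prod
      (volume.restrict (Ioc (0 : ℝ) (2 * Real.pi))))) :
    ∫⁻ t, (∫⁻ r in Ioo 0 1, ENNReal.ofReal (r * -Real.log r) * K (r * point t)) ∂arcMeasure =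
      ENNReal.ofReal (2 * Real.pi)⁻¹ * ∫⁻ x in Iio 0, ENNReal.ofReal (-x) *
        ∫⁻ t in Ioc 0 (2 * Real.pi), Θ x t := by
  rw [lintegral_arcMeasure_eq]
  congr 1
  -- With `r = e^x`, the weight `r log(1/r) dr` is `-x e^(2x) dx`, and `e^(2x)` is the conformal
  -- factor that converts the squared gradient.
  have e1 : ∀ t : ℝ, ∫⁻ r in Ioo 0 1, ENNReal.ofReal (r * -Real.log r) * K (r * point (t : Torus))
      = ∫⁻ x in Iio 0, ENNReal.ofReal (-x) * Θ x t := by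
    intro t
    rw [setLIntegral_Ioo_zero_one_eq]
    refine setLIntegral_congr_fun measurableSet_Iio fun x hx => ?_
    rw [← hK x hx t, Real.log_exp, ENNReal.ofReal_mul (Real.exp_pos x).le]
    ring
  simp_rw [e1]
  rw [lintegral_lintegral_swap]
  · refine lintegral_congr fun x => ?_
    rw [lintegral_const_mul' _ _ ENNReal.ofReal_ne_top]
  · have h1 : AEMeasurable (fun q : ℝ × ℝ => ENNReal.ofReal (-q.1) * Θ q.1 q.2)
        ((volume.restrict (Iio (0 : ℝ))).prod (volume.restrict (Ioc (0 : ℝ) (2 * Real.pi)))) :=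
      AEMeasurable.mul (by fun_prop) hΘ
    exact h1.prod_swap

lemma aemeasurable_strip {E : Type*} [MeasurableSpace E] [TopologicalSpace E] [BorelSpace E]
    [TopologicalSpace.PseudoMetrizableSpace E] {D : ℝ → ℝ → E}
    (hD : ContinuousOn (Function.uncurry D) strip) :
    AEMeasurable (Function.uncurry D) ((volume.restrict (Iio (0 : ℝ))).prod
      (volume.restrict (Ioc (0 : ℝ) (2 * Real.pi)))) := by
  have hms : MeasurableSet strip := measurableSet_Iio.prod MeasurableSet.univ
  rw [Measure.prod_restrict, ← Measure.volume_eq_prod]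
  exact (hD.aemeasurable hms).mono_measure
    (Measure.restrict_mono (prod_mono_right (subset_univ _)) le_rfl)

/-- The weighted energy inequality in the disk. -/
theorem lintegral_weighted_energy {s : ℝ} (hs0 : 0 ≤ s) (hs1 : s < 1) {f : Torus → ℂ}
    (hfm : Measurable f) (hf : Integrable f arcMeasure) {h : Torus → ℝ} (hhm : Measurable h)
    (hh : Integrable h arcMeasure) {c : ℝ} (hc : 0 < c) (hhc : ∀ t, c ≤ h t) :
    ∫⁻ t, (∫⁻ r in Ioo 0 1, ENNReal.ofReal (r * -Real.log r) *
        (ENNReal.ofReal (gradNormSq (poissonExtension f) (r * point t)) *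
          poissonL (fun t => ENNReal.ofReal (h t)) (r * point t) ^ (-s))) ∂arcMeasure ≤
      ENNReal.ofReal ((1 + s) / (1 - s)) *
        ∫⁻ t, ‖f t‖ₑ ^ 2 * ENNReal.ofReal (h t) ^ (-s) ∂arcMeasure := by
  obtain ⟨u, ux, ut, w, hu, hu1, hu2⟩ := exists_isStripHarmonic hf
  obtain ⟨v', vx, vt, q, hv, hv1, -⟩ :=
    exists_isStripHarmonic (f := fun t => (h t : ℂ)) hh.ofReal
  have hvr := hv.map Complex.reCLM
  set v : ℝ → ℝ → ℝ := fun x t => Complex.reCLM (v' x t) with hvdef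
  have hvc : ∀ x < 0, ∀ t, c ≤ v x t := fun x hx t => by
    simp only [hvdef, Complex.reCLM_apply, hv1 x hx t]
    exact le_re_poissonExtension hh hhc (norm_exp_mul_point_lt hx _)
  have hv0 : ∀ x < 0, ∀ t, 0 < v x t := fun x hx t => hc.trans_le (hvc x hx t)
  have hh0 : ∀ t, 0 < h t := fun t => hc.trans_le (hhc t)
  have hvP : ∀ x < 0, ∀ t : ℝ, ENNReal.ofReal (v x t ^ (-s)) =
      poissonL (fun t => ENNReal.ofReal (h t)) (Real.exp x * point (t : Torus)) ^ (-s) := by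
    intro x hx t
    rw [← ENNReal.ofReal_rpow_of_pos (hv0 x hx t), ← ofReal_re_poissonExtension hh
      (fun t => (hh0 t).le) (norm_exp_mul_point_lt hx _)]
    simp only [hvdef, Complex.reCLM_apply, hv1 x hx t]
  set R : ℝ≥0∞ := ENNReal.ofReal (2 * Real.pi) *
    ∫⁻ t, ‖f t‖ₑ ^ 2 * ENNReal.ofReal (h t) ^ (-s) ∂arcMeasure with hR
  -- On each circle the integrand is dominated by the Poisson integral of `|f|² h^(-s)`, whose
  -- circular mean does not depend on the radius.
  have hbd : ∀ (L : ℂ →L[ℝ] ℝ), (∀ z, |L z| ≤ ‖z‖) → ∀ x < 0,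
      ∫⁻ t in Ioc 0 (2 * Real.pi), ENNReal.ofReal (L (u x t) ^ 2 * v x t ^ (-s)) ≤ R := by
    intro L hL x hx
    have hz : ∀ t : Torus, ‖(Real.exp x : ℂ) * point t‖ < 1 := norm_exp_mul_point_lt hx
    calc _ ≤ ∫⁻ t in Ioc 0 (2 * Real.pi),
          poissonL (fun t => ‖f t‖ₑ ^ 2 * ENNReal.ofReal (h t) ^ (-s))
            (Real.exp x * point (t : Torus)) := by
          refine lintegral_mono fun t => ?_
          refine le_trans ?_ (enorm_poissonExtension_sq_le hfm hhm.ennreal_ofReal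
            (fun t => (ENNReal.ofReal_pos.2 (hh0 t)).ne') (fun t => ENNReal.ofReal_ne_top) hs0
            hs1.le (hz t))
          rw [ENNReal.ofReal_mul (sq_nonneg _), hvP x hx t]
          gcongr
          rw [← hu1 x hx t, ← ofReal_norm, ← ENNReal.ofReal_pow (norm_nonneg _), ← sq_abs]
          exact ENNReal.ofReal_le_ofReal (pow_le_pow_left₀ (abs_nonneg _) (hL _) 2)
      _ = ENNReal.ofReal (2 * Real.pi) * ∫⁻ t, poissonL (fun t => ‖f t‖ₑ ^ 2 *
            ENNReal.ofReal (h t) ^ (-s)) (Real.exp x * point t) ∂arcMeasure := by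
          rw [lintegral_arcMeasure_eq, ← mul_assoc, ← ENNReal.ofReal_mul Real.two_pi_pos.le,
            mul_inv_cancel₀ Real.two_pi_pos.ne', ENNReal.ofReal_one, one_mul]
      _ = R := by
          rw [lintegral_poissonL _ (Real.exp_pos x).le (Real.exp_lt_one_iff.2 hx)]
          exact (hfm.enorm.pow_const 2).mul (hhm.ennreal_ofReal.pow_const _)
  -- The strip inequality concerns real `u`, so it is applied to real and imaginary parts with the
  -- same weight and the same bound `R`; hence the doubled constant.
  have hre := lintegral_weighted_energy_strip hs0 hs1 (hu.map Complex.reCLM) hvr hc hvc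
    (hbd Complex.reCLM fun z => Complex.abs_re_le_norm z)
  have him := lintegral_weighted_energy_strip hs0 hs1 (hu.map Complex.imCLM) hvr hc hvc
    (hbd Complex.imCLM fun z => Complex.abs_im_le_norm z)
  have cr0 : ContinuousOn (fun q : ℝ × ℝ => v q.1 q.2 ^ (-s)) strip :=
    continuousOn_weight hvr.cu hv0 _
  have cD : ∀ L : ℂ →L[ℝ] ℝ, ContinuousOn (Function.uncurry fun x t =>
      (L (ux x t) ^ 2 + L (ut x t) ^ 2) * v x t ^ (-s)) strip := by
    intro L
    have c1 : ContinuousOn (fun q : ℝ × ℝ => L (ux q.1 q.2)) strip := (hu.map L).cux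
    have c2 : ContinuousOn (fun q : ℝ × ℝ => L (ut q.1 q.2)) strip := (hu.map L).cut
    exact ((c1.pow 2).add (c2.pow 2)).mul cr0
  set D : (ℂ →L[ℝ] ℝ) → ℝ → ℝ → ℝ := fun L x t => (L (ux x t) ^ 2 + L (ut x t) ^ 2) * v x t ^ (-s)
    with hD
  have hD0 : ∀ L, ∀ x < 0, ∀ t, 0 ≤ D L x t := fun L x hx t =>
    mul_nonneg (by positivity) (Real.rpow_nonneg (hv0 x hx t).le _)
  have hsum : ∀ z : ℂ, ‖z‖ ^ 2 = Complex.reCLM z ^ 2 + Complex.imCLM z ^ 2 := fun z => by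
    rw [← Complex.normSq_eq_norm_sq, Complex.normSq_apply, Complex.reCLM_apply,
      Complex.imCLM_apply]; ring
  rw [lintegral_disk_eq_strip (K := fun z => ENNReal.ofReal (gradNormSq (poissonExtension f) z) *
      poissonL (fun t => ENNReal.ofReal (h t)) z ^ (-s))
    (Θ := fun x t => ENNReal.ofReal ((‖ux x t‖ ^ 2 + ‖ut x t‖ ^ 2) * v x t ^ (-s)))]
  · calc _ ≤ ENNReal.ofReal (2 * Real.pi)⁻¹ * (
          (∫⁻ x in Iio 0, ENNReal.ofReal (-x) * ∫⁻ t in Ioc 0 (2 * Real.pi),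
            ENNReal.ofReal (D Complex.reCLM x t)) +
          ∫⁻ x in Iio 0, ENNReal.ofReal (-x) * ∫⁻ t in Ioc 0 (2 * Real.pi),
            ENNReal.ofReal (D Complex.imCLM x t)) := by
          gcongr
          have m1 : AEMeasurable (fun x => ENNReal.ofReal (-x) * ∫⁻ t in Ioc 0 (2 * Real.pi),
              ENNReal.ofReal (D Complex.reCLM x t)) (volume.restrict (Iio 0)) :=
            AEMeasurable.mul (by fun_prop) (aemeasurable_lintegral_strip (cD Complex.reCLM))
          rw [← lintegral_add_left' m1]
          refine setLIntegral_mono' measurableSet_Iio fun x (hx : x < 0) => ?_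
          rw [← mul_add, ← lintegral_add_left']
          · refine mul_le_mul_right (lintegral_mono fun t => le_of_eq ?_) _
            rw [← ENNReal.ofReal_add (hD0 _ x hx t) (hD0 _ x hx t)]
            congr 1
            simp only [hD, hsum]
            ring
          · exact ((cD Complex.reCLM).strip_section (F := fun x t => D Complex.reCLM x t)
              hx).measurable.ennreal_ofReal.aemeasurable
      _ ≤ ENNReal.ofReal (2 * Real.pi)⁻¹ * (ENNReal.ofReal ((1 + s) / (2 * (1 - s))) * R +
          ENNReal.ofReal ((1 + s) / (2 * (1 - s))) * R) :=
          mul_le_mul_right (add_le_add hre him) _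
      _ = _ := by
          have hs : 0 < 1 - s := by linarith
          rw [← add_mul, ← ENNReal.ofReal_add (by positivity) (by positivity), hR, ← mul_assoc,
            ← mul_assoc, ← ENNReal.ofReal_mul (by positivity), ← ENNReal.ofReal_mul (by positivity)]
          congr 2
          field_simp
          ring
  · intro x hx t
    rw [hu2 x hx t, ← hvP x hx t, ← ENNReal.ofReal_pow (Real.exp_pos x).le, ← mul_assoc,
      ← ENNReal.ofReal_mul (by positivity), ← ENNReal.ofReal_mul]
    unfold gradNormSq
    positivity
  · have c1 : ContinuousOn (fun q : ℝ × ℝ => ux q.1 q.2) strip := hu.cux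
    have c2 : ContinuousOn (fun q : ℝ × ℝ => ut q.1 q.2) strip := hu.cut
    have : ContinuousOn (Function.uncurry fun x t => (‖ux x t‖ ^ 2 + ‖ut x t‖ ^ 2) * v x t ^ (-s))
        strip := by
      change ContinuousOn (fun p : ℝ × ℝ => (‖ux p.1 p.2‖ ^ 2 + ‖ut p.1 p.2‖ ^ 2) *
        v p.1 p.2 ^ (-s)) strip
      fun_prop
    exact (aemeasurable_strip this).ennreal_ofReal

/-! ### The polarized Green formula. -/

lemma norm_mul_add_mul_le (a b c d : ℂ) :
    ‖a * c + b * d‖ ≤ √(‖a‖ ^ 2 + ‖b‖ ^ 2) * √(‖c‖ ^ 2 + ‖d‖ ^ 2) := by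
  rw [← Real.sqrt_mul (by positivity)]
  refine Real.le_sqrt_of_sq_le ?_
  have h1 : ‖a * c + b * d‖ ≤ ‖a‖ * ‖c‖ + ‖b‖ * ‖d‖ := by
    refine (norm_add_le _ _).trans_eq ?_
    rw [norm_mul, norm_mul]
  calc ‖a * c + b * d‖ ^ 2 ≤ (‖a‖ * ‖c‖ + ‖b‖ * ‖d‖) ^ 2 := pow_le_pow_left₀ (norm_nonneg _) h1 2
    _ ≤ _ := by nlinarith [sq_nonneg (‖a‖ * ‖d‖ - ‖b‖ * ‖c‖)]

/-- The polarized Green formula, as an inequality. -/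
lemma enorm_integral_mul_le_strip {u ux ut w v vx vt q : ℝ → ℝ → ℂ}
    (hu : IsStripHarmonic u ux ut w) (hv : IsStripHarmonic v vx vt q) {K : ℝ}
    (hvK : ∀ x ≤ -1, ∀ t, ‖v x t‖ ≤ K * Real.exp x) {ε : ℝ} (hε : 0 < ε) :
    ‖∫ t in (0)..(2 * Real.pi), u (-ε) t * v (-ε) t‖ₑ ≤
      2 * ∫⁻ x in Iio 0, ENNReal.ofReal (-x) * ∫⁻ t in Ioc 0 (2 * Real.pi),
        ENNReal.ofReal (√(‖ux x t‖ ^ 2 + ‖ut x t‖ ^ 2) * √(‖vx x t‖ ^ 2 + ‖vt x t‖ ^ 2)) := by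
  set B := 2 * ∫⁻ x in Iio 0, ENNReal.ofReal (-x) * ∫⁻ t in Ioc 0 (2 * Real.pi),
        ENNReal.ofReal (√(‖ux x t‖ ^ 2 + ‖ut x t‖ ^ 2) * √(‖vx x t‖ ^ 2 + ‖vt x t‖ ^ 2)) with hB
  obtain ⟨C, hC⟩ := hu.decay
  obtain ⟨M, hM⟩ := hv.decay
  have hC0 : 0 ≤ C := (norm_nonneg _).trans (hC (-1) le_rfl 0).1
  have cu : ContinuousOn (fun q : ℝ × ℝ => u q.1 q.2) strip := hu.cu
  have cux : ContinuousOn (fun q : ℝ × ℝ => ux q.1 q.2) strip := hu.cux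
  have cut : ContinuousOn (fun q : ℝ × ℝ => ut q.1 q.2) strip := hu.cut
  have cw : ContinuousOn (fun q : ℝ × ℝ => w q.1 q.2) strip := hu.cw
  have cv : ContinuousOn (fun q : ℝ × ℝ => v q.1 q.2) strip := hv.cu
  have cvx : ContinuousOn (fun q : ℝ × ℝ => vx q.1 q.2) strip := hv.cux
  have cvt : ContinuousOn (fun q : ℝ × ℝ => vt q.1 q.2) strip := hv.cut
  have cq : ContinuousOn (fun p : ℝ × ℝ => q p.1 p.2) strip := hv.cw
  -- Green's formula for the product `u v`, whose Laplacian is `2 ∇u · ∇v` because both factors are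
  -- harmonic.
  have hg : ∀ X, ε < X → _ := fun X hX => green_strip
    (F := fun x t => u x t * v x t) (F1 := fun x t => ux x t * v x t + u x t * vx x t)
    (F11 := fun x t => w x t * v x t + ux x t * vx x t + (ux x t * vx x t + u x t * q x t))
    (F2 := fun x t => ut x t * v x t + u x t * vt x t)
    (F22 := fun x t => -(w x t) * v x t + ut x t * vt x t + (ut x t * vt x t + u x t * -(q x t)))
    (fun x hx t => (hu.dx x hx t).mul (hv.dx x hx t))
    (fun x hx t => ((hu.dxx x hx t).mul (hv.dx x hx t)).add ((hu.dx x hx t).mul (hv.dxx x hx t)))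
    (fun x hx t => ((hu.dtt x hx t).mul (hv.dt x hx t)).add ((hu.dt x hx t).mul (hv.dtt x hx t)))
    (cu.mul cv) ((cux.mul cv).add (cu.mul cvx))
    (((cw.mul cv).add (cux.mul cvx)).add ((cux.mul cvx).add (cu.mul cq)))
    (((cw.neg.mul cv).add (cut.mul cvt)).add ((cut.mul cvt).add (cu.mul cq.neg)))
    (fun x hx => by simp only [hu.per x hx, hv.per x hx, hu.pert x hx, hv.pert x hx]) hε hX
  set K1 : ℝ := C * K * (2 * Real.pi) with hK1
  set K2 : ℝ := (C * |K| + C * M) * (2 * Real.pi) with hK2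
  -- Unlike the weighted case, the integral of `u v` at `-X` has no sign; it disappears in the limit
  -- only because `v` decays (`hvK`).
  have hbound : ∀ X, ε < X → 1 ≤ X →
      ‖∫ t in (0)..(2 * Real.pi), u (-ε) t * v (-ε) t‖ₑ ≤
        B + ENNReal.ofReal (K1 * Real.exp (-X) + X * (K2 * Real.exp (-X))) := by
    intro X hX hX1
    have hXε : -X ≤ -ε := by linarith
    have h1 := hg X hX
    have e1 : ∀ x t, w x t * v x t + ux x t * vx x t + (ux x t * vx x t + u x t * q x t) +
        (-(w x t) * v x t + ut x t * vt x t + (ut x t * vt x t + u x t * -(q x t))) =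
        2 * (ux x t * vx x t + ut x t * vt x t) := fun x t => by ring
    simp_rw [e1] at h1
    have h2 : ∫ t in (0)..(2 * Real.pi), u (-ε) t * v (-ε) t =
        (∫ x in (-X)..(-ε), (-ε - x) • ∫ t in (0)..(2 * Real.pi),
          2 * (ux x t * vx x t + ut x t * vt x t)) +
        ((∫ t in (0)..(2 * Real.pi), u (-X) t * v (-X) t) +
        (X - ε) • ∫ t in (0)..(2 * Real.pi), (ux (-X) t * v (-X) t + u (-X) t * vx (-X) t)) := by
      rw [h1]; abel
    have hXm : -X ≤ -1 := by linarith
    have b1 : ‖∫ t in (0)..(2 * Real.pi), u (-X) t * v (-X) t‖ ≤ K1 * Real.exp (-X) := by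
      have := intervalIntegral.norm_integral_le_of_norm_le_const (a := 0) (b := 2 * Real.pi)
        (C := C * (K * Real.exp (-X))) (f := fun t => u (-X) t * v (-X) t) (fun t _ => by
          rw [norm_mul]
          exact mul_le_mul (hC _ hXm t).1 (hvK _ hXm t) (norm_nonneg _) hC0)
      rw [sub_zero, abs_of_pos Real.two_pi_pos] at this
      refine this.trans (le_of_eq ?_)
      ring
    have b2 : ‖∫ t in (0)..(2 * Real.pi), (ux (-X) t * v (-X) t + u (-X) t * vx (-X) t)‖ ≤
        K2 * Real.exp (-X) := by
      have he1 : Real.exp (-X) ≤ 1 := by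
        rw [← Real.exp_zero]; exact Real.exp_le_exp.2 (by linarith)
      have he0 := Real.exp_pos (-X)
      have := intervalIntegral.norm_integral_le_of_norm_le_const (a := 0) (b := 2 * Real.pi)
        (C := (C * |K| + C * M) * Real.exp (-X))
        (f := fun t => ux (-X) t * v (-X) t + u (-X) t * vx (-X) t) (fun t _ => by
          have k1 : ‖v (-X) t‖ ≤ |K| := (hvK _ hXm t).trans (by
            calc K * Real.exp (-X) ≤ |K| * Real.exp (-X) := by gcongr; exact le_abs_self K
              _ ≤ |K| * 1 := by gcongr
              _ = |K| := mul_one _)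
          calc _ ≤ ‖ux (-X) t‖ * ‖v (-X) t‖ + ‖u (-X) t‖ * ‖vx (-X) t‖ := by
                refine (norm_add_le _ _).trans_eq ?_
                rw [norm_mul, norm_mul]
            _ ≤ C * Real.exp (-X) * |K| + C * (M * Real.exp (-X)) :=
                add_le_add (mul_le_mul (hC _ hXm t).2 k1 (norm_nonneg _) (by positivity))
                  (mul_le_mul (hC _ hXm t).1 (hM _ hXm t).2 (norm_nonneg _) hC0)
            _ = _ := by ring)
      rw [sub_zero, abs_of_pos Real.two_pi_pos] at this
      refine this.trans (le_of_eq ?_)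
      ring
    rw [h2]
    refine (enorm_add_le _ _).trans (add_le_add ?_ ?_)
    · rw [intervalIntegral.integral_of_le hXε]
      refine (enorm_integral_le_lintegral_enorm _).trans ?_
      rw [hB, ← lintegral_const_mul' _ _ (by norm_num)]
      refine (lintegral_mono_set (s := Ioc (-X) (-ε)) (t := Iio 0) fun x hx => mem_Iio.2 (by linarith [hx.2])).trans' ?_
      refine setLIntegral_mono' measurableSet_Ioc fun x hx => ?_
      rw [enorm_smul, mul_left_comm]
      have hx2 := hx.2
      refine mul_le_mul' ?_ ?_
      · rw [Real.enorm_eq_ofReal (by linarith)]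
        exact ENNReal.ofReal_le_ofReal (by linarith)
      · rw [intervalIntegral.integral_of_le Real.two_pi_pos.le]
        refine (enorm_integral_le_lintegral_enorm _).trans ?_
        rw [← lintegral_const_mul' _ _ (by norm_num)]
        refine lintegral_mono fun t => ?_
        rw [enorm_mul]
        refine mul_le_mul' (by simp [← ofReal_norm]) ?_
        rw [← ofReal_norm]
        exact ENNReal.ofReal_le_ofReal (norm_mul_add_mul_le _ _ _ _)
    · rw [← ofReal_norm]
      refine ENNReal.ofReal_le_ofReal ((norm_add_le _ _).trans (add_le_add b1 ?_))
      rw [norm_smul, Real.norm_of_nonneg (by linarith)]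
      exact mul_le_mul (by linarith) b2 (norm_nonneg _) (by linarith)
  have hlim : Filter.Tendsto (fun n : ℕ => B + ENNReal.ofReal (K1 * Real.exp (-(n + 2 : ℝ)) +
      (n + 2 : ℝ) * (K2 * Real.exp (-(n + 2 : ℝ))))) Filter.atTop (nhds B) := by
    have t1 : Filter.Tendsto (fun n : ℕ => K1 * Real.exp (-(n + 2 : ℝ))) Filter.atTop (nhds 0) := by
      have := (Real.tendsto_exp_neg_atTop_nhds_zero.comp (Filter.tendsto_atTop_add_const_right _
        (2 : ℝ) (tendsto_natCast_atTop_atTop (R := ℝ)))).const_mul K1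
      simpa using this
    have := (ENNReal.tendsto_ofReal (t1.add (tendsto_mul_exp_neg_nat K2))).const_add B
    simpa using this
  refine ge_of_tendsto hlim ?_
  have h2 := Filter.tendsto_atTop.1 (tendsto_natCast_atTop_atTop (R := ℝ)) ε
  filter_upwards [h2] with n hn
  exact hbound (n + 2) (by linarith) (by linarith [Nat.cast_nonneg (α := ℝ) n])

lemma abs_ker_sub_one_le {z : ℂ} (hz : ‖z‖ ≤ 1 / 2) (t : Torus) : |ker z t - 1| ≤ 16 * ‖z‖ := by
  have h1 := one_sub_norm_le z t
  have h2 : ‖point t - z‖ ≤ 1 + ‖z‖ := (norm_sub_le _ _).trans_eq (by simp)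
  have h0 := norm_nonneg z
  have hp : 0 < ‖point t - z‖ := by linarith
  rw [ker_eq, div_sub_one (by positivity), abs_div, abs_of_pos (pow_pos hp 2),
    div_le_iff₀ (pow_pos hp 2), abs_le]
  have h3 : 1 / 4 ≤ ‖point t - z‖ ^ 2 := by nlinarith
  have h4 : ‖point t - z‖ ^ 2 ≤ (1 + ‖z‖) ^ 2 := by gcongr
  have h5 : (1 - ‖z‖) ^ 2 ≤ ‖point t - z‖ ^ 2 := pow_le_pow_left₀ (by linarith) h1 2
  have h6 : 4 * ‖z‖ ≤ 16 * ‖z‖ * ‖point t - z‖ ^ 2 := by nlinarith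
  constructor <;> nlinarith

/-- Because `h` has mean zero, 1 may be subtracted from the kernel, which gains a factor `|z|`. This
is the decay at the centre of the disk that the polarized Green formula requires. -/
lemma norm_poissonExtension_le_of_integral_eq_zero {h : Torus → ℂ} (hh : Integrable h arcMeasure)
    (h0 : ∫ t, h t ∂arcMeasure = 0) {z : ℂ} (hz : ‖z‖ ≤ 1 / 2) :
    ‖poissonExtension h z‖ ≤ 16 * (∫ t, ‖h t‖ ∂arcMeasure) * ‖z‖ := by
  have hz1 : ‖z‖ < 1 := by linarith
  have hi : Integrable (fun t => (ker z t : ℂ) * h t) arcMeasure := by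
    refine hh.bdd_mul (c := 2 / (1 - ‖z‖))
      (Complex.continuous_ofReal.comp (continuous_ker hz1)).aestronglyMeasurable
      (.of_forall fun t => ?_)
    rw [Complex.norm_real, Real.norm_of_nonneg (ker_pos hz1 t).le]
    exact ker_le hz1 t
  have e : poissonExtension h z = ∫ t, ((ker z t : ℂ) - 1) * h t ∂arcMeasure := by
    have : ∀ t, ((ker z t : ℂ) - 1) * h t = (ker z t : ℂ) * h t - h t := fun t => by ring
    simp_rw [this]
    rw [integral_sub hi hh, h0, sub_zero]
    rfl
  rw [e]
  refine (norm_integral_le_integral_norm _).trans ?_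
  rw [mul_right_comm, ← integral_const_mul]
  refine integral_mono_of_nonneg (.of_forall fun t => norm_nonneg _) (hh.norm.const_mul _)
    (.of_forall fun t => ?_)
  simp only [norm_mul]
  refine mul_le_mul_of_nonneg_right ?_ (norm_nonneg _)
  rw [← Complex.ofReal_one, ← Complex.ofReal_sub, Complex.norm_real]
  exact abs_ker_sub_one_le hz t

/-- The pairing of two dilated Poisson extensions is controlled by their gradients. -/
theorem enorm_integral_poissonExtension_mul_le {f h : Torus → ℂ} (hf : Integrable f arcMeasure)
    (hh : Integrable h arcMeasure) (h0 : ∫ t, h t ∂arcMeasure = 0) {ρ : ℝ} (hρ0 : 0 < ρ)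
    (hρ1 : ρ < 1) :
    ‖∫ t, poissonExtension f (ρ * point t) * poissonExtension h (ρ * point t) ∂arcMeasure‖ₑ ≤
      2 * ∫⁻ t, (∫⁻ r in Ioo 0 1, ENNReal.ofReal (r * -Real.log r) *
        ENNReal.ofReal (√(gradNormSq (poissonExtension f) (r * point t)) *
          √(gradNormSq (poissonExtension h) (r * point t)))) ∂arcMeasure := by
  obtain ⟨u, ux, ut, w, hu, hu1, hu2⟩ := exists_isStripHarmonic hf
  obtain ⟨v, vx, vt, q, hv, hv1, hv2⟩ := exists_isStripHarmonic hh
  have hlog : Real.log ρ < 0 := Real.log_neg hρ0 hρ1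
  have hvK : ∀ x ≤ -1, ∀ t, ‖v x t‖ ≤ 16 * (∫ t, ‖h t‖ ∂arcMeasure) * Real.exp x := by
    intro x hx t
    have hn : ‖(Real.exp x : ℂ) * point (t : Torus)‖ = Real.exp x := by
      rw [norm_mul_point, abs_of_pos (Real.exp_pos x)]
    have hexp : Real.exp x ≤ 1 / 2 :=
      calc Real.exp x ≤ Real.exp (-1) := Real.exp_le_exp.2 hx
        _ ≤ 1 / 2 := by
          have := Real.exp_one_gt_d9
          rw [Real.exp_neg, ← one_div]
          gcongr
          linarith
    rw [hv1 x (by linarith) t]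
    refine (norm_poissonExtension_le_of_integral_eq_zero hh h0 (by rwa [hn])).trans_eq ?_
    rw [hn]
  have key := enorm_integral_mul_le_strip hu hv hvK (ε := -Real.log ρ) (by linarith)
  rw [neg_neg] at key
  have e1 : ∫ t, poissonExtension f (ρ * point t) * poissonExtension h (ρ * point t) ∂arcMeasure =
      (2 * Real.pi)⁻¹ • ∫ t in (0)..(2 * Real.pi), u (Real.log ρ) t * v (Real.log ρ) t := by
    rw [integral_arcMeasure_eq]
    congr 1
    refine intervalIntegral.integral_congr fun t _ => ?_
    simp only [hu1 _ hlog, hv1 _ hlog, Real.exp_log hρ0]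
  rw [lintegral_disk_eq_strip (K := fun z => ENNReal.ofReal (√(gradNormSq (poissonExtension f) z) *
      √(gradNormSq (poissonExtension h) z))) (Θ := fun x t => ENNReal.ofReal
      (√(‖ux x t‖ ^ 2 + ‖ut x t‖ ^ 2) * √(‖vx x t‖ ^ 2 + ‖vt x t‖ ^ 2)))]
  · rw [e1, enorm_smul, Real.enorm_eq_ofReal (by positivity), mul_left_comm]
    exact mul_le_mul_right key _
  · intro x hx t
    rw [hu2 x hx t, hv2 x hx t, ← ENNReal.ofReal_pow (Real.exp_pos x).le,
      ← ENNReal.ofReal_mul (by positivity), Real.sqrt_mul (by positivity),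
      Real.sqrt_mul (by positivity), Real.sqrt_sq (Real.exp_pos x).le]
    congr 1
    ring
  · have c1 : ContinuousOn (fun q : ℝ × ℝ => ux q.1 q.2) strip := hu.cux
    have c2 : ContinuousOn (fun q : ℝ × ℝ => ut q.1 q.2) strip := hu.cut
    have c3 : ContinuousOn (fun q : ℝ × ℝ => vx q.1 q.2) strip := hv.cux
    have c4 : ContinuousOn (fun q : ℝ × ℝ => vt q.1 q.2) strip := hv.cut
    have : ContinuousOn (Function.uncurry fun x t => √(‖ux x t‖ ^ 2 + ‖ut x t‖ ^ 2) *
        √(‖vx x t‖ ^ 2 + ‖vt x t‖ ^ 2)) strip := by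
      change ContinuousOn (fun p : ℝ × ℝ => √(‖ux p.1 p.2‖ ^ 2 + ‖ut p.1 p.2‖ ^ 2) *
        √(‖vx p.1 p.2‖ ^ 2 + ‖vt p.1 p.2‖ ^ 2)) strip
      fun_prop
    exact (aemeasurable_strip this).ennreal_ofReal

/-! ### Boundary convergence of Poisson integrals and the duality pairing. -/

lemma poissonExtension_congr_ae {f g : Torus → ℂ} (h : f =ᵐ[arcMeasure] g) :
    poissonExtension f = poissonExtension g := by
  ext z
  refine integral_congr_ae ?_
  filter_upwards [h] with t ht
  rw [ht]

lemma integrable_ker_mul_complex {f : Torus → ℂ} (hf : Integrable f arcMeasure) {z : ℂ}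
    (hz : ‖z‖ < 1) : Integrable (fun t => (ker z t : ℂ) * f t) arcMeasure := by
  refine hf.bdd_mul (c := 2 / (1 - ‖z‖))
    (Complex.continuous_ofReal.comp (continuous_ker hz)).aestronglyMeasurable
    (.of_forall fun t => ?_)
  rw [Complex.norm_real, Real.norm_of_nonneg (ker_pos hz t).le]
  exact ker_le hz t

lemma poissonExtension_sub {f g : Torus → ℂ} (hf : Integrable f arcMeasure)
    (hg : Integrable g arcMeasure) {z : ℂ} (hz : ‖z‖ < 1) :
    poissonExtension (fun t => f t - g t) z = poissonExtension f z - poissonExtension g z := by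
  change ∫ t, (ker z t : ℂ) * (f t - g t) ∂arcMeasure =
    (∫ t, (ker z t : ℂ) * f t ∂arcMeasure) - ∫ t, (ker z t : ℂ) * g t ∂arcMeasure
  rw [← integral_sub (integrable_ker_mul_complex hf hz) (integrable_ker_mul_complex hg hz)]
  refine integral_congr_ae (.of_forall fun t => ?_)
  simp only [mul_sub]

lemma poissonExtension_const (c : ℂ) {z : ℂ} (hz : ‖z‖ < 1) :
    poissonExtension (fun _ => c) z = c := by
  change ∫ t, (ker z t : ℂ) * c ∂arcMeasure = c
  rw [integral_mul_const, integral_complex_ofReal, integral_ker hz]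
  simp

lemma norm_mul_point_lt_one {ρ : ℝ} (h0 : 0 ≤ ρ) (h1 : ρ < 1) (t : Torus) :
    ‖(ρ : ℂ) * point t‖ < 1 := by
  rw [norm_mul_point, abs_of_nonneg h0]; exact h1

lemma continuous_poissonExtension_circle {f : Torus → ℂ} (hf : Integrable f arcMeasure) {ρ : ℝ}
    (h0 : 0 ≤ ρ) (h1 : ρ < 1) : Continuous fun t => poissonExtension f (ρ * point t) := by
  rw [continuous_iff_continuousAt]
  intro t
  have hz := norm_mul_point_lt_one h0 h1
  simp_rw [fun t => poissonExtension_eq hf (hz t)]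
  have c1 : ContinuousAt (fun s => (ρ : ℂ) * point s) t :=
    (continuous_const.mul continuous_point).continuousAt
  have c2 : ContinuousAt (fun s => (starRingEnd ℂ) ((ρ : ℂ) * point s)) t :=
    (Complex.continuous_conj.comp (continuous_const.mul continuous_point)).continuousAt
  refine ContinuousAt.sub (ContinuousAt.add ?_ ?_) continuousAt_const
  · exact ContinuousAt.comp (g := anaPart f) (hasDerivAt_anaPart hf (hz t)).continuousAt c1
  · refine ContinuousAt.comp (g := coanaPart f) (hasDerivAt_coanaPart hf ?_).continuousAt c2
    simpa using hz t

/-- Jensen's inequality for Poisson averages. -/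
lemma poissonL_rpow_le_poissonL {ψ : Torus → ℝ≥0∞} (hψ : Measurable ψ) {p : ℝ} (hp : 1 ≤ p) {z : ℂ}
    (hz : ‖z‖ < 1) : poissonL ψ z ^ p ≤ poissonL (fun t => ψ t ^ p) z := by
  have hp0 : 0 < p := by linarith
  have := poissonL_rpow_le (h := fun t => ψ t ^ p) (hψ.pow_const p) (s := 1 / p) (by positivity)
    (by rw [div_le_one hp0]; exact hp) hz
  simp only [← ENNReal.rpow_mul, mul_one_div_cancel hp0.ne', ENNReal.rpow_one] at this
  rw [one_div, ENNReal.le_rpow_inv_iff hp0] at this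
  exact this

/-- Jensen inside the Poisson average, which then preserves the integral. The estimate is uniform in
the radius, as the density argument for convergence needs. -/
lemma lintegral_enorm_poissonExtension_rpow_le {f : Torus → ℂ} (hf : AEStronglyMeasurable f arcMeasure)
    {p : ℝ} (hp : 1 ≤ p) {ρ : ℝ} (h0 : 0 ≤ ρ) (h1 : ρ < 1) :
    ∫⁻ t, ‖poissonExtension f (ρ * point t)‖ₑ ^ p ∂arcMeasure ≤ ∫⁻ t, ‖f t‖ₑ ^ p ∂arcMeasure := by
  rw [poissonExtension_congr_ae hf.ae_eq_mk]
  have e : ∫⁻ t, ‖f t‖ₑ ^ p ∂arcMeasure = ∫⁻ t, ‖hf.mk f t‖ₑ ^ p ∂arcMeasure := by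
    refine lintegral_congr_ae ?_
    filter_upwards [hf.ae_eq_mk] with t ht
    rw [← ht]
  rw [e]
  have hm : Measurable (hf.mk f) := hf.stronglyMeasurable_mk.measurable
  calc _ ≤ ∫⁻ t, poissonL (fun s => ‖hf.mk f s‖ₑ ^ p) (ρ * point t) ∂arcMeasure := by
        refine lintegral_mono fun t => ?_
        have hz := norm_mul_point_lt_one h0 h1 t
        exact (ENNReal.rpow_le_rpow (enorm_poissonExtension_le _ hz) (by linarith)).trans
          (poissonL_rpow_le_poissonL hm.enorm hp hz)
    _ = _ := lintegral_poissonL (hm.enorm.pow_const p) h0 h1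

lemma eLpNorm_ofReal {f : Torus → ℂ} {p : ℝ} (hp : 0 < p) :
    eLpNorm f (ENNReal.ofReal p) arcMeasure = (∫⁻ t, ‖f t‖ₑ ^ p ∂arcMeasure) ^ (1 / p) := by
  rw [eLpNorm_eq_lintegral_rpow_enorm_toReal (ENNReal.ofReal_pos.2 hp).ne' ENNReal.ofReal_ne_top,
    ENNReal.toReal_ofReal hp.le]

lemma eLpNorm_poissonExtension_le {f : Torus → ℂ} (hf : AEStronglyMeasurable f arcMeasure)
    {p : ℝ} (hp : 1 ≤ p) {ρ : ℝ} (h0 : 0 ≤ ρ) (h1 : ρ < 1) :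
    eLpNorm (fun t => poissonExtension f (ρ * point t)) (ENNReal.ofReal p) arcMeasure ≤
      eLpNorm f (ENNReal.ofReal p) arcMeasure := by
  rw [eLpNorm_ofReal (by linarith), eLpNorm_ofReal (by linarith)]
  exact ENNReal.rpow_le_rpow (lintegral_enorm_poissonExtension_rpow_le hf hp h0 h1)
    (by have : 0 < p := by linarith
        positivity)

lemma MemLp.integrable_arc {f : Torus → ℂ} {p : ℝ} (hp : 1 ≤ p)
    (hf : MemLp f (ENNReal.ofReal p) arcMeasure) : Integrable f arcMeasure :=
  hf.integrable (by simpa using ENNReal.ofReal_le_ofReal hp)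

/-- Uniform convergence of the Poisson integrals of a continuous function. -/
lemma exists_norm_poissonExtension_sub_le {g : Torus → ℂ} (hg : Continuous g) {ε : ℝ} (hε : 0 < ε) :
    ∃ ρ₀ : ℝ, ρ₀ < 1 ∧ ∀ ρ : ℝ, ρ ∈ Ioo ρ₀ 1 → ∀ t, ‖poissonExtension g (ρ * point t) - g t‖ ≤ ε := by
  have huc : UniformContinuous g := CompactSpace.uniformContinuous_of_continuous hg
  obtain ⟨δ, hδ, hδg⟩ := Metric.uniformContinuous_iff.1 huc (ε / 2) (by linarith)
  obtain ⟨B, hB⟩ : ∃ B, ∀ t, ‖g t‖ ≤ B := by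
    obtain ⟨B, hB⟩ := isCompact_univ.exists_bound_of_continuousOn hg.continuousOn
    exact ⟨B, fun t => hB t trivial⟩
  have hB0 : 0 ≤ B := (norm_nonneg _).trans (hB 0)
  have hπ := Real.pi_pos
  -- At angular distance at least `δ` the kernel is at most `2 (1 - ρ) π²/δ²` and `g` varies by at
  -- most `2B`; `κ` is the product without the factor `1 - ρ`.
  set κ : ℝ := 4 * B * (Real.pi ^ 2 / δ ^ 2) with hκ
  have hκ0 : 0 ≤ κ := by positivity
  refine ⟨max 0 (1 - ε / (2 * (κ + 1))), ?_, ?_⟩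
  · rw [max_lt_iff]
    refine ⟨one_pos, ?_⟩
    have : 0 < ε / (2 * (κ + 1)) := by positivity
    linarith
  intro ρ hρ t
  have hρ0 : 0 < ρ := (le_max_left _ _).trans_lt hρ.1
  have hρ2 : 1 - ε / (2 * (κ + 1)) < ρ := (le_max_right _ _).trans_lt hρ.1
  have hz := norm_mul_point_lt_one hρ0.le hρ.2 t
  have hgi : Integrable g arcMeasure := by
    refine Integrable.of_bound hg.aestronglyMeasurable B (.of_forall hB)
  have e : poissonExtension g (ρ * point t) - g t =
      ∫ s, (ker (ρ * point t) s : ℂ) * (g s - g t) ∂arcMeasure := by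
    conv_lhs => rw [← poissonExtension_const (g t) hz]
    rw [← poissonExtension_sub hgi (integrable_const _) hz]
    rfl
  rw [e]
  refine (norm_integral_le_integral_norm _).trans ?_
  have hb : ∀ s, ‖(ker (ρ * point t) s : ℂ) * (g s - g t)‖ ≤
      ε / 2 * ker (ρ * point t) s + κ * (1 - ρ) := by
    intro s
    have hk := ker_pos hz s
    rw [norm_mul, Complex.norm_real, Real.norm_of_nonneg hk.le]
    rcases lt_or_ge (dist s t) δ with hd | hd
    · have := (hδg hd).le
      rw [dist_eq_norm] at this
      have h1 : 0 ≤ κ * (1 - ρ) := mul_nonneg hκ0 (by linarith [hρ.2])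
      nlinarith
    · rw [dist_eq_norm] at hd
      have h1 : ‖g s - g t‖ ≤ 2 * B := (norm_sub_le _ _).trans (by linarith [hB s, hB t])
      have h2 : ker (ρ * point t) s ≤ 2 * (1 - ρ) * (Real.pi ^ 2 / δ ^ 2) := by
        have hch := norm_sub_le_chord s t
        have h3 : δ / Real.pi ≤ ‖point s - ρ * point t‖ := by
          have h4 : ‖point s - point t‖ ≤ ‖point s - ρ * point t‖ + (1 - ρ) := by
            have : point s - point t = (point s - ρ * point t) + ((ρ - 1 : ℝ) : ℂ) * point t := by
              push_cast; ring
            rw [this]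
            refine (norm_add_le _ _).trans_eq ?_
            rw [norm_mul_point, abs_of_nonpos (by linarith [hρ.2])]
            ring
          have h5 := one_sub_norm_le (ρ * point t) s
          rw [norm_mul_point, abs_of_pos hρ0] at h5
          have h6 : 2 / Real.pi * δ ≤ 2 / Real.pi * ‖s - t‖ := by gcongr
          have h7 : 2 / Real.pi * δ = 2 * (δ / Real.pi) := by ring
          linarith
        rw [ker_eq, norm_mul_point, abs_of_pos hρ0]
        have h8 : (δ / Real.pi) ^ 2 ≤ ‖point s - ρ * point t‖ ^ 2 :=
          pow_le_pow_left₀ (by positivity) h3 2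
        rw [div_le_iff₀ (lt_of_lt_of_le (by positivity) h8)]
        calc 1 - ρ ^ 2 ≤ 2 * (1 - ρ) := by nlinarith [hρ.2]
          _ = 2 * (1 - ρ) * (Real.pi ^ 2 / δ ^ 2) * (δ / Real.pi) ^ 2 := by field_simp
          _ ≤ _ := by
            refine mul_le_mul_of_nonneg_left h8 ?_
            have : 0 ≤ 1 - ρ := by linarith [hρ.2]
            positivity
      calc _ ≤ 2 * (1 - ρ) * (Real.pi ^ 2 / δ ^ 2) * (2 * B) :=
            mul_le_mul h2 h1 (norm_nonneg _) (hk.le.trans h2)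
        _ = κ * (1 - ρ) := by rw [hκ]; ring
        _ ≤ _ := by nlinarith
  calc _ ≤ ∫ s, (ε / 2 * ker (ρ * point t) s + κ * (1 - ρ)) ∂arcMeasure := by
        refine integral_mono_of_nonneg (.of_forall fun s => norm_nonneg _) ?_ (.of_forall hb)
        exact ((integrable_ker hz).const_mul _).add (integrable_const _)
    _ = ε / 2 + κ * (1 - ρ) := by
        rw [integral_add ((integrable_ker hz).const_mul _) (integrable_const _), integral_const_mul,
          integral_ker hz]
        simp
    _ ≤ ε / 2 + ε / 2 := by
        gcongr
        have h1 : 1 - ρ ≤ ε / (2 * (κ + 1)) := by linarith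
        calc κ * (1 - ρ) ≤ (κ + 1) * (1 - ρ) :=
              mul_le_mul_of_nonneg_right (by linarith) (by linarith [hρ.2])
          _ ≤ (κ + 1) * (ε / (2 * (κ + 1))) := by gcongr
          _ = ε / 2 := by field_simp
    _ = ε := by ring

/-- `L^p` convergence of Poisson integrals. -/
lemma tendsto_eLpNorm_poissonExtension_sub {f : Torus → ℂ} {p : ℝ} (hp : 1 ≤ p)
    (hf : MemLp f (ENNReal.ofReal p) arcMeasure) :
    Filter.Tendsto (fun ρ : ℝ => eLpNorm (fun t => poissonExtension f (ρ * point t) - f t)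
      (ENNReal.ofReal p) arcMeasure) (nhdsWithin 1 (Iio 1)) (nhds 0) := by
  have hp1 : 1 ≤ ENNReal.ofReal p := by simpa using ENNReal.ofReal_le_ofReal hp
  have hfi := MemLp.integrable_arc hp hf
  rw [ENNReal.tendsto_nhds_zero]
  intro ε hε
  obtain ⟨η, hη0, hη⟩ : ∃ η : ℝ, 0 < η ∧ ENNReal.ofReal η * 3 ≤ ε := by
    rcases eq_or_ne ε ∞ with rfl | ht
    · exact ⟨1, one_pos, le_top⟩
    · refine ⟨ε.toReal / 3, div_pos (ENNReal.toReal_pos hε.ne' ht) (by norm_num), ?_⟩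
      rw [show (3 : ℝ≥0∞) = ENNReal.ofReal 3 by norm_num, ← ENNReal.ofReal_mul (by positivity),
        div_mul_cancel₀ _ (by norm_num), ENNReal.ofReal_toReal ht]
  obtain ⟨g, hg1, hg2⟩ := hf.exists_boundedContinuous_eLpNorm_sub_le ENNReal.ofReal_ne_top
    (ENNReal.ofReal_pos.2 hη0).ne'
  obtain ⟨ρ₀, hρ₀, hρ⟩ := exists_norm_poissonExtension_sub_le g.continuous hη0
  have hev : Ioo (max 0 ρ₀) 1 ∈ nhdsWithin (1 : ℝ) (Iio 1) :=
    Ioo_mem_nhdsLT (max_lt one_pos hρ₀)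
  filter_upwards [hev] with ρ hρm
  have hρ0 : 0 ≤ ρ := (le_max_left _ _).trans hρm.1.le
  have hgi := MemLp.integrable_arc hp hg2
  have e : (fun t => poissonExtension f (ρ * point t) - f t) =
      (fun t => poissonExtension (fun s => f s - g s) (ρ * point t)) +
      ((fun t => poissonExtension g (ρ * point t) - g t) + fun t => g t - f t) := by
    ext t
    simp only [Pi.add_apply, poissonExtension_sub hfi hgi (norm_mul_point_lt_one hρ0 hρm.2 t)]
    ring
  have hfg : AEStronglyMeasurable (fun s => f s - g s) arcMeasure :=
    hf.aestronglyMeasurable.sub hg2.aestronglyMeasurable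
  have m1 := (continuous_poissonExtension_circle (hfi.sub hgi) hρ0 hρm.2).aestronglyMeasurable
    (μ := arcMeasure)
  have m2 : AEStronglyMeasurable (fun t => poissonExtension g (ρ * point t) - g t) arcMeasure :=
    ((continuous_poissonExtension_circle hgi hρ0 hρm.2).sub g.continuous).aestronglyMeasurable
  have m3 : AEStronglyMeasurable (fun t => g t - f t) arcMeasure :=
    hg2.aestronglyMeasurable.sub hf.aestronglyMeasurable
  rw [e]
  refine (eLpNorm_add_le m1 (m2.add m3) hp1).trans ?_
  refine (add_le_add (eLpNorm_poissonExtension_le hfg hp hρ0 hρm.2)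
    (eLpNorm_add_le m2 m3 hp1)).trans ?_
  have b1 : eLpNorm (fun s => f s - g s) (ENNReal.ofReal p) arcMeasure ≤ ENNReal.ofReal η := hg1
  have b3 : eLpNorm (fun t => g t - f t) (ENNReal.ofReal p) arcMeasure ≤ ENNReal.ofReal η := by
    refine le_trans (le_of_eq ?_) b1
    exact eLpNorm_sub_comm _ _ _ _
  have b2 : eLpNorm (fun t => poissonExtension g (ρ * point t) - g t) (ENNReal.ofReal p) arcMeasure
      ≤ ENNReal.ofReal η := by
    refine (eLpNorm_le_of_ae_bound (C := η) (.of_forall fun t =>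
      hρ ρ ⟨(le_max_right _ _).trans_lt hρm.1, hρm.2⟩ t)).trans ?_
    simp
  refine le_trans (add_le_add b1 (add_le_add b2 b3)) (le_trans (le_of_eq ?_) hη)
  ring

lemma lintegral_enorm_mul_le {p q : ℝ} (hpq : p.HolderConjugate q) {f g : Torus → ℂ}
    (hf : AEStronglyMeasurable f arcMeasure) (hg : AEStronglyMeasurable g arcMeasure) :
    ∫⁻ t, ‖f t * g t‖ₑ ∂arcMeasure ≤
      eLpNorm f (ENNReal.ofReal p) arcMeasure * eLpNorm g (ENNReal.ofReal q) arcMeasure := by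
  rw [eLpNorm_ofReal hpq.pos, eLpNorm_ofReal hpq.symm.pos]
  simp_rw [enorm_mul]
  exact ENNReal.lintegral_mul_le_Lp_mul_Lq arcMeasure hpq hf.enorm hg.enorm

/-- The duality pairing is controlled by the gradients of the Poisson extensions. -/
theorem enorm_integral_mul_le_gradient {p q : ℝ} (hpq : p.HolderConjugate q) {f h : Torus → ℂ}
    (hf : MemLp f (ENNReal.ofReal p) arcMeasure) (hh : MemLp h (ENNReal.ofReal q) arcMeasure)
    (h0 : ∫ t, h t ∂arcMeasure = 0) :
    ‖∫ t, f t * h t ∂arcMeasure‖ₑ ≤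
      2 * ∫⁻ t, (∫⁻ r in Ioo 0 1, ENNReal.ofReal (r * -Real.log r) *
        ENNReal.ofReal (√(gradNormSq (poissonExtension f) (r * point t)) *
          √(gradNormSq (poissonExtension h) (r * point t)))) ∂arcMeasure := by
  have hp1 : 1 ≤ p := hpq.lt.le
  have hq1 : 1 ≤ q := hpq.symm.lt.le
  have hfi := MemLp.integrable_arc hp1 hf
  have hhi := MemLp.integrable_arc hq1 hh
  set B := 2 * ∫⁻ t, (∫⁻ r in Ioo 0 1, ENNReal.ofReal (r * -Real.log r) *
        ENNReal.ofReal (√(gradNormSq (poissonExtension f) (r * point t)) *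
          √(gradNormSq (poissonExtension h) (r * point t)))) ∂arcMeasure with hB
  set N := eLpNorm f (ENNReal.ofReal p) arcMeasure with hN
  set M := eLpNorm h (ENNReal.ofReal q) arcMeasure with hM
  have t1 := tendsto_eLpNorm_poissonExtension_sub hp1 hf
  have t2 := tendsto_eLpNorm_poissonExtension_sub hq1 hh
  -- The bound `B` holds for the pairing of the dilates at every `ρ < 1`; by Hölder the error in
  -- replacing `f` and `h` by their dilates is at most `‖F - f‖_p ‖h‖_q + ‖f‖_p ‖H - h‖_q`, which
  -- tends to zero.
  have hlim := ((ENNReal.Tendsto.mul_const t1 (Or.inr hh.eLpNorm_ne_top)).add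
    (ENNReal.Tendsto.const_mul t2 (Or.inr hf.eLpNorm_ne_top))).const_add B
  simp only [zero_mul, mul_zero, add_zero] at hlim
  refine ge_of_tendsto hlim ?_
  have hev : Ioo (0 : ℝ) 1 ∈ nhdsWithin (1 : ℝ) (Iio 1) := Ioo_mem_nhdsLT one_pos
  filter_upwards [hev] with ρ hρ
  have hcf := continuous_poissonExtension_circle hfi hρ.1.le hρ.2
  have hch := continuous_poissonExtension_circle hhi hρ.1.le hρ.2
  set F := fun t => poissonExtension f (ρ * point t) with hF
  set H := fun t => poissonExtension h (ρ * point t) with hH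
  have i1 : Integrable (fun t => F t * H t) arcMeasure :=
    (hcf.mul hch).integrable_of_hasCompactSupport (HasCompactSupport.of_compactSpace _)
  have hconj : ENNReal.HolderConjugate (ENNReal.ofReal p) (ENNReal.ofReal q) := hpq.ennrealOfReal
  have i2 : Integrable (fun t => f t * h t) arcMeasure := hf.integrable_mul hh
  have e : ∫ t, f t * h t ∂arcMeasure = (∫ t, F t * H t ∂arcMeasure) +
      ∫ t, (f t * h t - F t * H t) ∂arcMeasure := by
    rw [integral_sub i2 i1]; ring
  rw [e]
  refine (enorm_add_le _ _).trans (add_le_add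
    (enorm_integral_poissonExtension_mul_le hfi hhi h0 hρ.1 hρ.2) ?_)
  refine (enorm_integral_le_lintegral_enorm _).trans ?_
  have hmF : AEStronglyMeasurable F arcMeasure := hcf.aestronglyMeasurable
  have hmH : AEStronglyMeasurable H arcMeasure := hch.aestronglyMeasurable
  have k1 := lintegral_enorm_mul_le hpq (hmF.sub hf.aestronglyMeasurable) hmH
  have k2 := lintegral_enorm_mul_le hpq hf.aestronglyMeasurable (hmH.sub hh.aestronglyMeasurable)
  have k3 : eLpNorm H (ENNReal.ofReal q) arcMeasure ≤ M :=
    eLpNorm_poissonExtension_le hh.aestronglyMeasurable hq1 hρ.1.le hρ.2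
  calc _ ≤ ∫⁻ t, (‖(F - f) t * H t‖ₑ + ‖f t * (H - h) t‖ₑ) ∂arcMeasure := by
        refine lintegral_mono fun t => ?_
        have : f t * h t - F t * H t = -((F - f) t * H t) + -(f t * (H - h) t) := by
          simp only [Pi.sub_apply]; ring
        rw [this]
        refine (enorm_add_le _ _).trans_eq ?_
        rw [enorm_neg, enorm_neg]
    _ = (∫⁻ t, ‖(F - f) t * H t‖ₑ ∂arcMeasure) + ∫⁻ t, ‖f t * (H - h) t‖ₑ ∂arcMeasure :=
        lintegral_add_left' ((hmF.sub hf.aestronglyMeasurable).mul hmH).enorm _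
    _ ≤ _ := add_le_add (k1.trans (mul_le_mul_right k3 _)) k2

/-! ### The Littlewood–Paley function and Poisson averages of the energy. -/

/-- The squared length of the gradient of the Poisson extension, as an extended real. -/
def energy (f : Torus → ℂ) (z : ℂ) : ℝ≥0∞ := ENNReal.ofReal (gradNormSq (poissonExtension f) z)

/-- The square of the Littlewood–Paley function. -/
def gsq (f : Torus → ℂ) (t : Torus) : ℝ≥0∞ :=
  ∫⁻ r in Ioo (0 : ℝ) 1,
    ENNReal.ofReal (gradNormSq (poissonExtension f) ((r : ℂ) * point t) * (1 - r ^ 2))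

lemma gradNormSq_nonneg (u : ℂ → ℂ) (z : ℂ) : 0 ≤ gradNormSq u z := by
  unfold gradNormSq; positivity

lemma measurable_gradNormSq (u : ℂ → ℂ) : Measurable (gradNormSq u) := by
  unfold gradNormSq
  exact ((measurable_fderiv_apply_const ℝ u 1).norm.pow_const 2).add
    ((measurable_fderiv_apply_const ℝ u Complex.I).norm.pow_const 2)

lemma measurable_energy (f : Torus → ℂ) : Measurable (energy f) :=
  (measurable_gradNormSq _).ennreal_ofReal

lemma measurable_mul_point : Measurable fun q : Torus × ℝ => (q.2 : ℂ) * point q.1 :=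
  (Complex.measurable_ofReal.comp measurable_snd).mul (measurable_point.comp measurable_fst)

lemma measurable_radial_lintegral {F : ℂ → ℝ≥0∞} (hF : Measurable F) {w : ℝ → ℝ≥0∞}
    (hw : Measurable w) (s : Set ℝ) :
    Measurable fun t => ∫⁻ r in s, w r * F (r * point t) := by
  refine Measurable.lintegral_prod_right' (f := fun q : Torus × ℝ => w q.2 * F (q.2 * point q.1)) ?_
  exact (hw.comp measurable_snd).mul (hF.comp measurable_mul_point)

lemma measurable_gsq (f : Torus → ℂ) : Measurable (gsq f) := by
  unfold gsq
  refine Measurable.lintegral_prod_right' (f := fun q : Torus × ℝ => ENNReal.ofReal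
    (gradNormSq (poissonExtension f) ((q.2 : ℂ) * point q.1) * (1 - q.2 ^ 2))) ?_
  exact (((measurable_gradNormSq _).comp measurable_mul_point).mul
    (by fun_prop)).ennreal_ofReal

/-- Complex conjugation exchanges the two parts, so every estimate needs to be made only for
`anaDeriv`, applied to `f` and to its conjugate. -/
lemma norm_coanaDeriv_conj (f : Torus → ℂ) (z : ℂ) :
    ‖coanaDeriv f ((starRingEnd ℂ) z)‖ = ‖anaDeriv (fun t => (starRingEnd ℂ) (f t)) z‖ := by
  rw [← RCLike.norm_conj]
  congr 1
  unfold coanaDeriv anaDeriv cauchyDeriv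
  rw [← integral_conj]
  refine integral_congr_ae (.of_forall fun t => ?_)
  simp [cpoint]

lemma energy_eq {f : Torus → ℂ} (hf : Integrable f arcMeasure) {z : ℂ} (hz : ‖z‖ < 1) :
    energy f z = 2 * (‖anaDeriv f z‖ₑ ^ 2 +
      ‖anaDeriv (fun t => (starRingEnd ℂ) (f t)) z‖ₑ ^ 2) := by
  unfold energy
  rw [gradNormSq_poissonExtension hf hz, norm_coanaDeriv_conj, ENNReal.ofReal_mul (by norm_num),
    ENNReal.ofReal_add (by positivity) (by positivity), ENNReal.ofReal_pow (norm_nonneg _),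
    ENNReal.ofReal_pow (norm_nonneg _), ofReal_norm, ofReal_norm]
  norm_num

lemma enorm_anaDeriv_kernel (z : ℂ) (t : Torus) :
    ‖cpoint t / (1 - z * cpoint t) ^ 2‖ₑ = ENNReal.ofReal (1 / ‖point t - z‖ ^ 2) := by
  rw [← ofReal_norm, norm_div, norm_pow, norm_cpoint, cpoint, norm_one_sub_mul_conj_point]

lemma enorm_anaDeriv_le (f : Torus → ℂ) (z : ℂ) :
    ‖anaDeriv f z‖ₑ ≤ ∫⁻ t, ‖f t‖ₑ * ENNReal.ofReal (1 / ‖point t - z‖ ^ 2) ∂arcMeasure := by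
  refine (enorm_integral_le_lintegral_enorm _).trans_eq (lintegral_congr fun t => ?_)
  rw [enorm_mul, enorm_anaDeriv_kernel]

lemma energy_le {f : Torus → ℂ} (hf : Integrable f arcMeasure) {z : ℂ} (hz : ‖z‖ < 1) {B : ℝ≥0∞}
    (h1 : ‖anaDeriv f z‖ₑ ≤ B) (h2 : ‖anaDeriv (fun t => (starRingEnd ℂ) (f t)) z‖ₑ ≤ B) :
    energy f z ≤ 4 * B ^ 2 := by
  rw [energy_eq hf hz]
  calc _ ≤ 2 * (B ^ 2 + B ^ 2) := by gcongr
    _ = _ := by ring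

lemma energy_le_lintegral {f : Torus → ℂ} (hf : Integrable f arcMeasure) {z : ℂ} (hz : ‖z‖ < 1) :
    energy f z ≤
      4 * (∫⁻ t, ‖f t‖ₑ * ENNReal.ofReal (1 / ‖point t - z‖ ^ 2) ∂arcMeasure) ^ 2 := by
  refine energy_le hf hz (enorm_anaDeriv_le f z) ((enorm_anaDeriv_le _ z).trans_eq ?_)
  refine lintegral_congr fun t => ?_
  rw [← ofReal_norm, ← ofReal_norm, RCLike.norm_conj]

lemma energy_le_of_norm_le_half {f : Torus → ℂ} (hf : Integrable f arcMeasure) {z : ℂ}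
    (hz : ‖z‖ ≤ 1 / 2) : energy f z ≤ 64 * (∫⁻ t, ‖f t‖ₑ ∂arcMeasure) ^ 2 := by
  have hz1 : ‖z‖ < 1 := by linarith
  refine (energy_le_lintegral hf hz1).trans ?_
  have : ∫⁻ t, ‖f t‖ₑ * ENNReal.ofReal (1 / ‖point t - z‖ ^ 2) ∂arcMeasure ≤
      4 * ∫⁻ t, ‖f t‖ₑ ∂arcMeasure := by
    rw [← lintegral_const_mul' _ _ (by norm_num)]
    refine lintegral_mono fun t => ?_
    rw [mul_comm]
    refine mul_le_mul_left ?_ _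
    rw [show (4 : ℝ≥0∞) = ENNReal.ofReal 4 by norm_num]
    refine ENNReal.ofReal_le_ofReal ?_
    have h1 := one_sub_norm_le z t
    rw [div_le_iff₀ (by have := norm_point_sub_pos hz1 t; positivity)]
    nlinarith
  calc _ ≤ 4 * (4 * ∫⁻ t, ‖f t‖ₑ ∂arcMeasure) ^ 2 := by gcongr
    _ = _ := by ring

lemma differentiableOn_anaDeriv {f : Torus → ℂ} (hf : Integrable f arcMeasure) :
    DifferentiableOn ℂ (anaDeriv f) (Metric.ball 0 1) := by
  have h1 : DifferentiableOn ℂ (anaPart f) (Metric.ball 0 1) := fun z hz =>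
    (hasDerivAt_anaPart hf (by simpa using hz)).differentiableAt.differentiableWithinAt
  refine (h1.deriv Metric.isOpen_ball).congr fun z hz => ?_
  exact (hasDerivAt_anaPart hf (by simpa using hz)).deriv.symm

lemma continuous_anaDeriv_circle {f : Torus → ℂ} (hf : Integrable f arcMeasure) {ρ : ℝ}
    (hρ : ρ ∈ Ioo (0 : ℝ) 1) : Continuous fun s => anaDeriv f (ρ * point s) := by
  rw [continuous_iff_continuousAt]
  intro s
  have h1 : ContinuousAt (anaDeriv f) (ρ * point s) :=
    ((differentiableOn_anaDeriv hf).differentiableAt (Metric.isOpen_ball.mem_nhds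
      (by simpa using norm_mul_point_lt hρ s))).continuousAt
  exact ContinuousAt.comp (g := anaDeriv f) h1 (continuous_const.mul continuous_point).continuousAt

/-- Sub-mean value property for the derivative of the analytic part. -/
lemma enorm_anaDeriv_sq_le {f : Torus → ℂ} (hf : Integrable f arcMeasure) {ρ : ℝ}
    (hρ : ρ ∈ Ioo (0 : ℝ) 1) (t : Torus) :
    ‖anaDeriv f ((ρ ^ 2 : ℝ) * point t)‖ₑ ^ 2 ≤
      poissonL (fun s => ‖anaDeriv f (ρ * point s)‖ₑ ^ 2) (ρ * point t) := by
  have hz : ‖(ρ : ℂ) * point t‖ < 1 := norm_mul_point_lt hρ t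
  have hdc : DiffContOnCl ℂ (fun w => anaDeriv f (ρ * w)) (Metric.ball 0 1) := by
    refine DifferentiableOn.diffContOnCl ?_
    rw [closure_ball _ one_ne_zero]
    refine (differentiableOn_anaDeriv hf).comp (by fun_prop) fun w hw => ?_
    have hw' : ‖w‖ ≤ 1 := by simpa using hw
    have : ‖(ρ : ℂ) * w‖ < 1 := by
      rw [norm_mul, Complex.norm_real, Real.norm_of_nonneg hρ.1.le]
      nlinarith [hρ.1, hρ.2, norm_nonneg w]
    simpa using this
  have key := hdc.circleAverage_poissonKernel_smul (w := (ρ : ℂ) * point t) (by simpa using hz)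
  rw [circleAverage_eq_integral] at key
  -- The dilate by `ρ` is analytic across the closed disk, so its value at `ρ * point t` is the
  -- Poisson average of its boundary values; Jensen for the square then applies.
  have e : anaDeriv f ((ρ ^ 2 : ℝ) * point t) =
      poissonExtension (fun s => anaDeriv f (ρ * point s)) (ρ * point t) := by
    have : ((ρ ^ 2 : ℝ) : ℂ) * point t = ρ * (ρ * point t) := by push_cast; ring
    rw [this, ← key]
    refine integral_congr_ae (.of_forall fun s => ?_)
    simp
  have hc := continuous_anaDeriv_circle hf hρ
  rw [e]
  have h2 := poissonL_rpow_le_poissonL (p := 2) hc.measurable.enorm (by norm_num) hz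
  simp only [ENNReal.rpow_two] at h2
  exact (pow_le_pow_left₀ zero_le (enorm_poissonExtension_le _ hz) 2).trans h2

lemma integrable_conj {f : Torus → ℂ} (hf : Integrable f arcMeasure) :
    Integrable (fun t => (starRingEnd ℂ) (f t)) arcMeasure :=
  (Complex.conjLIE.toContinuousLinearEquiv : ℂ →L[ℝ] ℂ).integrable_comp hf

lemma measurable_enorm_anaDeriv_circle {f : Torus → ℂ} (hf : Integrable f arcMeasure) {ρ : ℝ}
    (hρ : ρ ∈ Ioo (0 : ℝ) 1) : Measurable fun s => ‖anaDeriv f (ρ * point s)‖ₑ := by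
  exact (continuous_anaDeriv_circle hf hρ).measurable.enorm

/-- The squared gradient at radius `ρ²` is dominated by a Poisson average of the one at `ρ`. -/
lemma energy_sq_radius_le {f : Torus → ℂ} (hf : Integrable f arcMeasure) {ρ : ℝ}
    (hρ : ρ ∈ Ioo (0 : ℝ) 1) (t : Torus) :
    energy f ((ρ ^ 2 : ℝ) * point t) ≤ poissonL (fun s => energy f (ρ * point s)) (ρ * point t) := by
  have hρ2 : ρ ^ 2 ∈ Ioo (0 : ℝ) 1 := ⟨by have := hρ.1; positivity, by nlinarith [hρ.1, hρ.2]⟩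
  simp_rw [energy_eq hf (norm_mul_point_lt hρ2 _), energy_eq hf (norm_mul_point_lt hρ _)]
  have m1 := (measurable_enorm_anaDeriv_circle hf hρ).pow_const 2
  have m2 := (measurable_enorm_anaDeriv_circle (integrable_conj hf) hρ).pow_const 2
  have m3 : Measurable fun s => ‖anaDeriv f (ρ * point s)‖ₑ ^ 2 +
      ‖anaDeriv (fun t => (starRingEnd ℂ) (f t)) (ρ * point s)‖ₑ ^ 2 := m1.add m2
  rw [poissonL_const_mul _ m3, poissonL_add m1]
  gcongr
  · exact enorm_anaDeriv_sq_le hf hρ t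
  · exact enorm_anaDeriv_sq_le (integrable_conj hf) hρ t

lemma setLIntegral_Ioo_sq (g : ℝ → ℝ≥0∞) :
    ∫⁻ r in Ioo 0 1, g r = ∫⁻ ρ in Ioo 0 1, ENNReal.ofReal (2 * ρ) * g (ρ ^ 2) := by
  have himg : (fun x : ℝ => x ^ 2) '' Ioo 0 1 = Ioo 0 1 := by
    ext r
    constructor
    · rintro ⟨x, hx, rfl⟩
      exact ⟨by have := hx.1; positivity, by nlinarith [hx.1, hx.2]⟩
    · rintro ⟨h0, h1⟩
      refine ⟨√r, ⟨Real.sqrt_pos.2 h0, ?_⟩, Real.sq_sqrt h0.le⟩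
      rw [Real.sqrt_lt' one_pos]; simpa using h1
  conv_lhs => rw [← himg]
  rw [lintegral_image_eq_lintegral_abs_deriv_mul measurableSet_Ioo (f' := fun x => 2 * x)
    (fun x _ => by simpa using (hasDerivAt_pow 2 x).hasDerivWithinAt)]
  · refine setLIntegral_congr_fun measurableSet_Ioo fun x hx => ?_
    have : 0 < 2 * x := by linarith [hx.1]
    simp only [abs_of_pos this]
  · intro x hx y hy h
    exact (sq_eq_sq₀ hx.1.le hy.1.le).1 h

/-- Poisson averaging at a fixed radius is self-adjoint, by Tonelli and `ker_symm`. -/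
lemma lintegral_poissonL_mul {φ ψ : Torus → ℝ≥0∞} (hφ : Measurable φ) (hψ : Measurable ψ) (ρ : ℝ) :
    ∫⁻ t, poissonL ψ (ρ * point t) * φ t ∂arcMeasure =
      ∫⁻ t, ψ t * poissonL φ (ρ * point t) ∂arcMeasure := by
  unfold poissonL
  have mk : Measurable fun q : Torus × Torus => ENNReal.ofReal (ker (ρ * point q.1) q.2) := by
    have : Measurable fun q : Torus × Torus => ((ρ : ℂ) * point q.1, q.2) :=
      ((measurable_point.comp measurable_fst).const_mul _).prodMk measurable_snd
    exact (measurable_ker.comp this).ennreal_ofReal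
  have e1 : ∀ t, (∫⁻ s, ENNReal.ofReal (ker (ρ * point t) s) * ψ s
      ∂arcMeasure) * φ t = ∫⁻ s, ENNReal.ofReal (ker (ρ * point t) s) * ψ s *
        φ t ∂arcMeasure := fun t =>
    (lintegral_mul_const _ ((measurable_ofReal_ker _).mul hψ)).symm
  have e2 : ∀ t, ψ t * (∫⁻ s, ENNReal.ofReal (ker (ρ * point t) s) * φ s
      ∂arcMeasure) = ∫⁻ s, ψ t * (ENNReal.ofReal (ker (ρ * point t) s) * φ s)
        ∂arcMeasure := fun t =>
    (lintegral_const_mul _ ((measurable_ofReal_ker _).mul hφ)).symm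
  simp_rw [e1, e2]
  rw [lintegral_lintegral_swap]
  · refine lintegral_congr fun t => lintegral_congr fun s => ?_
    rw [ker_symm ρ s t]; ring
  · exact ((mk.mul (hψ.comp measurable_snd)).mul (hφ.comp measurable_fst)).aemeasurable

/-- Trades a weight on the circle for its Poisson extension inside the disk. After the substitution
`r = ρ²` the energy is dominated by a Poisson average at radius `ρ`, and self-adjointness moves this
average onto `φ`. -/
lemma lintegral_gsq_mul_le {f : Torus → ℂ} (hf : Integrable f arcMeasure) {φ : Torus → ℝ≥0∞}
    (hφ : Measurable φ) :
    ∫⁻ t, gsq f t * φ t ∂arcMeasure ≤ 8 * ∫⁻ t, (∫⁻ r in Ioo 0 1,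
      ENNReal.ofReal (r * -Real.log r) * (energy f (r * point t) * poissonL φ (r * point t)))
        ∂arcMeasure := by
  have hE := measurable_energy f
  have mE : ∀ ρ : ℝ, Measurable fun s => energy f (ρ * point s) := fun ρ =>
    hE.comp (measurable_point.const_mul _)
  have mlog : Measurable fun r : ℝ => ENNReal.ofReal (r * -Real.log r) := by fun_prop
  have b1 : ∀ t, gsq f t ≤ ∫⁻ r in Ioo 0 1, 8 * (ENNReal.ofReal (r * -Real.log r) *
      poissonL (fun s => energy f (r * point s)) (r * point t)) := by
    intro t
    unfold gsq
    rw [setLIntegral_Ioo_sq]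
    refine setLIntegral_mono' measurableSet_Ioo fun ρ hρ => ?_
    have hl : 1 - ρ ≤ -Real.log ρ := by linarith [Real.log_le_sub_one_of_pos hρ.1]
    rw [ENNReal.ofReal_mul (gradNormSq_nonneg _ _), mul_left_comm, ← ENNReal.ofReal_mul (by
      linarith [hρ.1]), mul_comm]
    calc _ ≤ ENNReal.ofReal (8 * (ρ * -Real.log ρ)) *
          poissonL (fun s => energy f (ρ * point s)) (ρ * point t) := by
          -- The Jacobian `2ρ` times `1 - ρ⁴ ≤ 4(1 - ρ) ≤ 4 log(1/ρ)` gives the constant 8.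
          refine mul_le_mul' (ENNReal.ofReal_le_ofReal ?_) (energy_sq_radius_le hf hρ t)
          have h0 := hρ.1
          have h1 := hρ.2
          have : 1 - (ρ ^ 2) ^ 2 ≤ 4 * (1 - ρ) := by
            have h2 : ρ ^ 2 ≤ 1 := by nlinarith
            nlinarith
          nlinarith
      _ = _ := by
          rw [ENNReal.ofReal_mul (by norm_num), mul_assoc]; norm_num
  have mker : Measurable fun q : (Torus × ℝ) × Torus => ENNReal.ofReal (ker (q.1.2 * point q.1.1) q.2) := by
    have : Measurable fun q : (Torus × ℝ) × Torus => ((q.1.2 : ℂ) * point q.1.1, q.2) :=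
      (measurable_mul_point.comp measurable_fst).prodMk measurable_snd
    exact (measurable_ker.comp this).ennreal_ofReal
  have mPE : Measurable fun q : Torus × ℝ =>
      poissonL (fun s => energy f (q.2 * point s)) (q.2 * point q.1) := by
    unfold poissonL
    refine Measurable.lintegral_prod_right' (f := fun q : (Torus × ℝ) × Torus =>
      ENNReal.ofReal (ker (q.1.2 * point q.1.1) q.2) * energy f (q.1.2 * point q.2)) ?_
    refine mker.mul (hE.comp ?_)
    exact (Complex.measurable_ofReal.comp (measurable_snd.comp measurable_fst)).mul
      (measurable_point.comp measurable_snd)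
  have mP1 : ∀ t, Measurable fun r : ℝ =>
      poissonL (fun s => energy f (r * point s)) (r * point t) := fun t =>
    mPE.comp (g := fun q : Torus × ℝ => poissonL (fun s => energy f (q.2 * point s)) (q.2 * point q.1))
      (f := fun r : ℝ => (t, r)) (measurable_const.prodMk measurable_id)
  have mP2 : ∀ ρ : ℝ, Measurable fun t =>
      poissonL (fun s => energy f (ρ * point s)) (ρ * point t) := fun ρ =>
    (measurable_poissonL (mE ρ)).comp (measurable_point.const_mul _)
  have mA : Measurable fun q : Torus × ℝ => ENNReal.ofReal (q.2 * -Real.log q.2) *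
      (poissonL (fun s => energy f (q.2 * point s)) (q.2 * point q.1) * φ q.1) :=
    (mlog.comp measurable_snd).mul (mPE.mul (hφ.comp measurable_fst))
  have mPφ : Measurable fun q : Torus × ℝ => poissonL φ (q.2 * point q.1) :=
    (measurable_poissonL hφ).comp measurable_mul_point
  have mB : Measurable fun q : Torus × ℝ => ENNReal.ofReal (q.2 * -Real.log q.2) *
      (energy f (q.2 * point q.1) * poissonL φ (q.2 * point q.1)) :=
    (mlog.comp measurable_snd).mul ((hE.comp measurable_mul_point).mul mPφ)
  calc _ ≤ ∫⁻ t, 8 * (∫⁻ r in Ioo 0 1, ENNReal.ofReal (r * -Real.log r) *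
        (poissonL (fun s => energy f (r * point s)) (r * point t) * φ t)) ∂arcMeasure := by
        refine lintegral_mono fun t => (mul_le_mul_left (b1 t) _).trans_eq ?_
        rw [lintegral_const_mul' _ _ (by norm_num), mul_assoc, ← lintegral_mul_const]
        · congr 1
          refine lintegral_congr fun r => ?_
          ring
        · exact mlog.mul (mP1 t)
    _ = 8 * ∫⁻ t, (∫⁻ r in Ioo 0 1, ENNReal.ofReal (r * -Real.log r) *
        (poissonL (fun s => energy f (r * point s)) (r * point t) * φ t)) ∂arcMeasure :=
        lintegral_const_mul' _ _ (by norm_num)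
    _ = _ := by
        congr 1
        refine (lintegral_lintegral_swap mA.aemeasurable).trans
          (Eq.trans ?_ (lintegral_lintegral_swap mB.aemeasurable).symm)
        refine setLIntegral_congr_fun measurableSet_Ioo fun ρ hρ => ?_
        have a1 : Measurable fun t => poissonL (fun s => energy f (ρ * point s)) (ρ * point t) *
          φ t := (mP2 ρ).mul hφ
        have a2 : Measurable fun t => energy f (ρ * point t) * poissonL φ (ρ * point t) :=
          (mE ρ).mul ((measurable_poissonL hφ).comp (measurable_point.const_mul _))
        rw [lintegral_const_mul _ a1, lintegral_const_mul _ a2, lintegral_poissonL_mul hφ (mE ρ)]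

lemma measurable_ofReal_mul_neg_log : Measurable fun r : ℝ => ENNReal.ofReal (r * -Real.log r) := by
  fun_prop

/-- The weights `1 - r²` and `r log(1/r)` are comparable near the circle but not near the origin.
For `r ≤ 1/2` the gradient is bounded by the `L¹` norm, which accounts for the first term. -/
lemma gsq_le {f : Torus → ℂ} (hf : Integrable f arcMeasure) (t : Torus) :
    gsq f t ≤ 64 * (∫⁻ t, ‖f t‖ₑ ∂arcMeasure) ^ 2 +
      4 * ∫⁻ r in Ioo 0 1, ENNReal.ofReal (r * -Real.log r) * energy f (r * point t) := by
  set N := 64 * (∫⁻ t, ‖f t‖ₑ ∂arcMeasure) ^ 2 with hN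
  calc gsq f t ≤ ∫⁻ r in Ioo 0 1, (N + 4 * (ENNReal.ofReal (r * -Real.log r) *
        energy f (r * point t))) := by
        refine setLIntegral_mono' measurableSet_Ioo fun r hr => ?_
        have h0 := hr.1
        have h1 := hr.2
        rw [ENNReal.ofReal_mul (gradNormSq_nonneg _ _)]
        change energy f _ * _ ≤ _
        rcases le_total r (1 / 2) with h | h
        · refine le_add_right ?_
          calc _ ≤ energy f (r * point t) * 1 := by
                refine mul_le_mul_right ?_ _
                rw [ENNReal.ofReal_le_one]; nlinarith
            _ ≤ N := by
                rw [mul_one]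
                refine energy_le_of_norm_le_half hf ?_
                rw [norm_mul_point, abs_of_pos h0]; exact h
        · refine le_add_left ?_
          rw [← mul_assoc, mul_comm]
          refine mul_le_mul_left ?_ _
          rw [show (4 : ℝ≥0∞) = ENNReal.ofReal 4 by norm_num, ← ENNReal.ofReal_mul (by norm_num)]
          refine ENNReal.ofReal_le_ofReal ?_
          have hl : 1 - r ≤ -Real.log r := by linarith [Real.log_le_sub_one_of_pos h0]
          nlinarith
    _ = _ := by
        rw [lintegral_add_left measurable_const, lintegral_const, lintegral_const_mul' _ _ (by norm_num)]
        simp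

lemma poissonL_ofReal_ne_top {h : Torus → ℝ} (hh : Integrable h arcMeasure) (h0 : ∀ t, 0 ≤ h t)
    {z : ℂ} (hz : ‖z‖ < 1) : poissonL (fun t => ENNReal.ofReal (h t)) z ≠ ∞ := by
  rw [← ofReal_re_poissonExtension hh h0 hz]
  exact ENNReal.ofReal_ne_top

lemma lintegral_enorm_rpow_ne_top {f : Torus → ℂ} {p : ℝ} (hp0 : 0 < p)
    (hf : MemLp f (ENNReal.ofReal p) arcMeasure) : ∫⁻ t, ‖f t‖ₑ ^ p ∂arcMeasure ≠ ∞ := by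
  have := hf.eLpNorm_ne_top
  rw [eLpNorm_ofReal hp0] at this
  intro h
  rw [h, ENNReal.top_rpow_of_pos (by positivity)] at this
  exact this rfl

lemma arcMeasure_univ : arcMeasure univ = 1 := by
  unfold arcMeasure; simp

/-! ### The `L^p` bound for exponents at most two. -/

/-- The weighted energy inequality with `h = |f| + ε` and `s = 2 - p` has right side comparable to
`∫ h^p`. Removing the factor `(Ph)^(-s)` costs a power of the maximal function of `h`, and Hölder
with the maximal theorem finishes. -/
theorem exists_lintegral_gsq_rpow_le_of_le_two {p : ℝ} (hp : 1 < p) (hp2 : p ≤ 2) :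
    ∃ C : ℝ≥0∞, C ≠ ∞ ∧ ∀ f : Torus → ℂ, Measurable f → MemLp f (ENNReal.ofReal p) arcMeasure →
      ∫⁻ t, gsq f t ^ (p / 2) ∂arcMeasure ≤ C * ∫⁻ t, ‖f t‖ₑ ^ p ∂arcMeasure := by
  obtain ⟨Cm, hCm1, hCm⟩ := exists_lintegral_maxP_rpow_le hp
  set s : ℝ := 2 - p with hs
  have hp0 : 0 < p := by linarith
  set c1 : ℝ≥0∞ := ENNReal.ofReal ((1 + s) / (1 - s)) with hc1
  set c2 : ℝ≥0∞ := 18 ^ p * ENNReal.ofReal Cm with hc2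
  refine ⟨64 ^ (p / 2) + 4 ^ (p / 2) * (c1 ^ (p / 2) * c2 ^ (1 - p / 2) * (2 ^ (p - 1) * 2)), ?_, ?_⟩
  · have t1 : c1 ^ (p / 2) ≠ ∞ := ENNReal.rpow_ne_top_of_nonneg (by positivity) ENNReal.ofReal_ne_top
    have t2 : c2 ^ (1 - p / 2) ≠ ∞ := ENNReal.rpow_ne_top_of_nonneg (by linarith)
      (ENNReal.mul_ne_top (ENNReal.rpow_ne_top_of_nonneg hp0.le (by norm_num)) ENNReal.ofReal_ne_top)
    have t3 : (64 : ℝ≥0∞) ^ (p / 2) ≠ ∞ := ENNReal.rpow_ne_top_of_nonneg (by positivity) (by norm_num)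
    have t4 : (4 : ℝ≥0∞) ^ (p / 2) ≠ ∞ := ENNReal.rpow_ne_top_of_nonneg (by positivity) (by norm_num)
    have t5 : (2 : ℝ≥0∞) ^ (p - 1) ≠ ∞ := ENNReal.rpow_ne_top_of_nonneg (by linarith) (by norm_num)
    exact ENNReal.add_ne_top.2 ⟨t3, ENNReal.mul_ne_top t4 (ENNReal.mul_ne_top
      (ENNReal.mul_ne_top t1 t2) (ENNReal.mul_ne_top t5 (by norm_num)))⟩
  intro f hfm hf
  have hfi := MemLp.integrable_arc hp.le hf
  set A := ∫⁻ t, ‖f t‖ₑ ^ p ∂arcMeasure with hA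
  have hAt : A ≠ ∞ := lintegral_enorm_rpow_ne_top hp0 hf
  set N := ∫⁻ t, ‖f t‖ₑ ∂arcMeasure with hN
  have hNA : N ^ p ≤ A := by
    have h1 := lintegral_rpow_le_rpow_lintegral (ν := arcMeasure) (h := fun t => ‖f t‖ₑ ^ p)
      (hfm.enorm.pow_const p) (s := p⁻¹) (by positivity) (inv_le_one_of_one_le₀ hp.le)
    simp only [← ENNReal.rpow_mul, mul_inv_cancel₀ hp0.ne', ENNReal.rpow_one] at h1
    rwa [ENNReal.le_rpow_inv_iff hp0] at h1
  -- Below, `ε` is the `L^p` norm of `f`, which has to be positive. If it is zero, the gradient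
  -- vanishes identically.
  rcases eq_or_ne A 0 with hA0 | hA0
  · have hN0 : N = 0 := by
      rw [hA0] at hNA
      exact (ENNReal.rpow_eq_zero_iff_of_pos hp0).1 (le_antisymm hNA zero_le)
    have hg0 : ∀ t, gsq f t = 0 := by
      intro t
      unfold gsq
      rw [setLIntegral_congr_fun (g := fun _ => (0 : ℝ≥0∞)) measurableSet_Ioo]
      · simp
      · intro r hr
        simp only
        rw [ENNReal.ofReal_mul (gradNormSq_nonneg _ _)]
        change energy f _ * _ = 0
        have h1 := energy_le_lintegral hfi (norm_mul_point_lt hr t)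
        have h2 : ∫⁻ s, ‖f s‖ₑ * ENNReal.ofReal (1 / ‖point s - r * point t‖ ^ 2) ∂arcMeasure = 0 := by
          rw [hN, lintegral_eq_zero_iff hfm.enorm] at hN0
          rw [lintegral_congr_ae (g := fun _ => (0 : ℝ≥0∞))]
          · simp
          · filter_upwards [hN0] with s hs
            simp only [Pi.zero_apply] at hs
            rw [hs, zero_mul]
        rw [h2] at h1
        have h3 : energy f (r * point t) = 0 := le_antisymm (h1.trans (by simp)) zero_le
        rw [h3, zero_mul]
    simp only [hg0]
    rw [ENNReal.zero_rpow_of_pos (by positivity)]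
    simp
  -- With `ε = ‖f‖_p` the function `h` is bounded below while `∫ h^p` stays comparable to `∫ |f|^p`,
  -- so no limit `ε → 0` is required.
  set ε : ℝ := (A ^ (1 / p)).toReal with hε
  have hAp0 : A ^ (1 / p) ≠ 0 := by
    rw [Ne, ENNReal.rpow_eq_zero_iff_of_pos (by positivity)]; exact hA0
  have hApt : A ^ (1 / p) ≠ ∞ := ENNReal.rpow_ne_top_of_nonneg (by positivity) hAt
  have hε0 : 0 < ε := ENNReal.toReal_pos hAp0 hApt
  have hεA : ENNReal.ofReal ε ^ p = A := by
    rw [hε, ENNReal.ofReal_toReal hApt, ← ENNReal.rpow_mul, one_div_mul_cancel hp0.ne',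
      ENNReal.rpow_one]
  set h : Torus → ℝ := fun t => ‖f t‖ + ε with hh
  have hhm : Measurable h := hfm.norm.add_const ε
  have hhi : Integrable h arcMeasure := hfi.norm.add (integrable_const ε)
  have hhε : ∀ t, ε ≤ h t := fun t => by simp [hh]
  set H : Torus → ℝ≥0∞ := fun t => ENNReal.ofReal (h t) with hH
  have hHm : Measurable H := hhm.ennreal_ofReal
  have hH0 : ∀ t, H t ≠ 0 := fun t => (ENNReal.ofReal_pos.2 (hε0.trans_le (hhε t))).ne'
  have hHt : ∀ t, H t ≠ ∞ := fun t => ENNReal.ofReal_ne_top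
  have hHf : ∀ t, H t = ‖f t‖ₑ + ENNReal.ofReal ε := fun t => by
    rw [hH, ← ofReal_norm, ← ENNReal.ofReal_add (norm_nonneg _) hε0.le]
  have hB : ∫⁻ t, H t ^ p ∂arcMeasure ≤ 2 ^ (p - 1) * 2 * A := by
    calc _ ≤ ∫⁻ t, 2 ^ (p - 1) * (‖f t‖ₑ ^ p + A) ∂arcMeasure := by
          refine lintegral_mono fun t => ?_
          rw [hHf, ← hεA]
          exact ENNReal.rpow_add_le_mul_rpow_add_rpow _ _ hp.le
      _ = _ := by
          rw [lintegral_const_mul' _ _ (ENNReal.rpow_ne_top_of_nonneg (by linarith) (by norm_num)),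
            lintegral_add_right _ measurable_const, ← hA, lintegral_const]
          rw [arcMeasure_univ]; ring
  set M := maxP H with hM
  have hMm : Measurable M := measurable_maxP hHm
  set K : Torus → ℝ≥0∞ := fun t => ∫⁻ r in Ioo 0 1, ENNReal.ofReal (r * -Real.log r) *
        (energy f (r * point t) * poissonL H (r * point t) ^ (-s)) with hK
  have mEP : Measurable fun z => energy f z * poissonL H z ^ (-s) :=
    (measurable_energy f).mul ((measurable_poissonL hHm).pow_const _)
  have hKm : Measurable K := measurable_radial_lintegral mEP measurable_ofReal_mul_neg_log _
  have hKB : ∫⁻ t, K t ∂arcMeasure ≤ c1 * ∫⁻ t, H t ^ p ∂arcMeasure := by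
    refine (lintegral_weighted_energy (s := s) (by linarith) (by linarith) hfm hfi hhm hhi hε0 hhε).trans ?_
    refine mul_le_mul_right (lintegral_mono fun t => ?_) _
    change ‖f t‖ₑ ^ 2 * H t ^ (-s) ≤ H t ^ p
    calc _ ≤ H t ^ (2 : ℝ) * H t ^ (-s) := by
          refine mul_le_mul_left ?_ _
          rw [ENNReal.rpow_two]
          refine pow_le_pow_left₀ zero_le ?_ 2
          rw [hHf]; exact le_self_add
      _ = _ := by
          rw [← ENNReal.rpow_add _ _ (hH0 t) (hHt t)]
          congr 1; rw [hs]; ring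
  set G : Torus → ℝ≥0∞ := fun t => ∫⁻ r in Ioo 0 1, ENNReal.ofReal (r * -Real.log r) *
        energy f (r * point t) with hG
  have hGK : ∀ t, G t ≤ (18 * M t) ^ s * K t := by
    intro t
    have mr : Measurable fun r : ℝ => ENNReal.ofReal (r * -Real.log r) *
        (energy f (r * point t) * poissonL H (r * point t) ^ (-s)) :=
      measurable_ofReal_mul_neg_log.mul (mEP.comp (Complex.measurable_ofReal.mul_const _))
    simp only [hG, hK]
    rw [← lintegral_const_mul _ mr]
    refine setLIntegral_mono' measurableSet_Ioo fun r hr => ?_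
    have hz := norm_mul_point_lt hr t
    have hPt : poissonL H (r * point t) ≠ ∞ :=
      poissonL_ofReal_ne_top hhi (fun t => hε0.le.trans (hhε t)) hz
    have hP0 : poissonL H (r * point t) ≠ 0 := by
      have : ENNReal.ofReal ε ≤ poissonL H (r * point t) := by
        rw [← poissonL_const (ENNReal.ofReal ε) hz]
        exact poissonL_mono (fun t => ENNReal.ofReal_le_ofReal (hhε t)) _
      exact ((ENNReal.ofReal_pos.2 hε0).trans_le this).ne'
    rw [mul_left_comm]
    refine mul_le_mul_right ?_ _
    calc energy f (r * point t) = poissonL H (r * point t) ^ s *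
          (energy f (r * point t) * poissonL H (r * point t) ^ (-s)) := by
          rw [mul_left_comm, ← ENNReal.rpow_add _ _ hP0 hPt]; simp
      _ ≤ _ := mul_le_mul_left (ENNReal.rpow_le_rpow (poissonL_le_maxP H hr.1.le hr.2 t)
          (by linarith)) _
  have hGp : ∫⁻ t, G t ^ (p / 2) ∂arcMeasure ≤
      c1 ^ (p / 2) * c2 ^ (1 - p / 2) * (2 ^ (p - 1) * 2 * A) := by
    -- Since `s (p/2) = p (1 - p/2)`, Hölder with weights `p/2` and `1 - p/2` separates the weighted
    -- energy from the `p`-th power of the maximal function.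
    calc _ ≤ ∫⁻ t, K t ^ (p / 2) * ((18 * M t) ^ p) ^ (1 - p / 2) ∂arcMeasure := by
          refine lintegral_mono fun t => ?_
          refine (ENNReal.rpow_le_rpow (hGK t) (by positivity)).trans_eq ?_
          rw [ENNReal.mul_rpow_of_nonneg _ _ (by positivity), ← ENNReal.rpow_mul, ← ENNReal.rpow_mul,
            mul_comm]
          congr 2
          rw [hs]; ring
      _ ≤ (∫⁻ t, K t ∂arcMeasure) ^ (p / 2) * (∫⁻ t, (18 * M t) ^ p ∂arcMeasure) ^ (1 - p / 2) :=
          ENNReal.lintegral_mul_norm_pow_le hKm.aemeasurable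
            ((hMm.const_mul 18).pow_const p).aemeasurable (by positivity) (by linarith) (by ring)
      _ ≤ (c1 * ∫⁻ t, H t ^ p ∂arcMeasure) ^ (p / 2) *
          (c2 * ∫⁻ t, H t ^ p ∂arcMeasure) ^ (1 - p / 2) := by
          refine mul_le_mul' (ENNReal.rpow_le_rpow hKB (by positivity))
            (ENNReal.rpow_le_rpow ?_ (by linarith))
          simp_rw [ENNReal.mul_rpow_of_nonneg _ _ hp0.le]
          rw [lintegral_const_mul' _ _ (ENNReal.rpow_ne_top_of_nonneg hp0.le (by norm_num)), hc2,
            mul_assoc]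
          exact mul_le_mul_right (hCm H hHm) _
      _ = c1 ^ (p / 2) * c2 ^ (1 - p / 2) * ∫⁻ t, H t ^ p ∂arcMeasure := by
          rw [ENNReal.mul_rpow_of_nonneg _ _ (by positivity), ENNReal.mul_rpow_of_nonneg _ _ (by linarith),
            mul_mul_mul_comm, ← ENNReal.rpow_add_of_nonneg _ _ (by positivity) (by linarith)]
          norm_num
      _ ≤ _ := mul_le_mul_right hB _
  have mG : Measurable G := measurable_radial_lintegral (measurable_energy f)
    measurable_ofReal_mul_neg_log _
  calc ∫⁻ t, gsq f t ^ (p / 2) ∂arcMeasure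
      ≤ ∫⁻ t, (64 ^ (p / 2) * N ^ p + 4 ^ (p / 2) * G t ^ (p / 2)) ∂arcMeasure := by
        refine lintegral_mono fun t => ?_
        refine (ENNReal.rpow_le_rpow (gsq_le hfi t) (by positivity)).trans ?_
        refine (ENNReal.rpow_add_le_add_rpow _ _ (by positivity) (by linarith)).trans_eq ?_
        rw [ENNReal.mul_rpow_of_nonneg _ _ (by positivity), ENNReal.mul_rpow_of_nonneg _ _ (by positivity),
          ← ENNReal.rpow_two, ← ENNReal.rpow_mul, mul_div_cancel₀ _ two_ne_zero]
    _ = 64 ^ (p / 2) * N ^ p + 4 ^ (p / 2) * ∫⁻ t, G t ^ (p / 2) ∂arcMeasure := by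
        rw [lintegral_add_left measurable_const, lintegral_const, lintegral_const_mul _
          (mG.pow_const _)]
        rw [arcMeasure_univ, mul_one]
    _ ≤ 64 ^ (p / 2) * A + 4 ^ (p / 2) *
          (c1 ^ (p / 2) * c2 ^ (1 - p / 2) * (2 ^ (p - 1) * 2 * A)) := by gcongr
    _ = _ := by ring

/-! ### Negative powers of majorants and the `L^p` bound for exponents above two. -/

/-- The least `k` with the first property works: by minimality when `k > 0`, and because the value
is `ℓ` itself when `k = 0`. It assigns a scale to each point in the dyadic decompositions. -/
lemma exists_dyadic_scale (x : ℝ) {ℓ : ℝ} (hℓ : 0 < ℓ) :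
    ∃ k : ℕ, x ≤ 2 ^ k * ℓ ∧ 2 ^ k * ℓ ≤ 2 * max x ℓ := by
  have hex : ∃ k : ℕ, x ≤ 2 ^ k * ℓ := by
    obtain ⟨k, hk⟩ := pow_unbounded_of_one_lt (x / ℓ) (one_lt_two : (1 : ℝ) < 2)
    exact ⟨k, ((div_lt_iff₀ hℓ).1 hk).le⟩
  classical
  refine ⟨Nat.find hex, Nat.find_spec hex, ?_⟩
  rcases Nat.eq_zero_or_pos (Nat.find hex) with h | h
  · rw [h]; linarith [le_max_right x ℓ]
  · have h1 := Nat.find_min hex (m := Nat.find hex - 1) (by omega)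
    have h2 : (2 : ℝ) ^ Nat.find hex = 2 * 2 ^ (Nat.find hex - 1) := by
      rw [← pow_succ', Nat.sub_add_cancel h]
    rw [h2]
    linarith [le_max_left x ℓ]

/-- An arc is at most `π/2` times its chord, and the chord is at most `D + (1 - r) ≤ 2D`, with `D`
the distance on the right. -/
lemma norm_sub_le_pi_mul {r : ℝ} (h1 : r < 1) (h0 : 0 ≤ r) (s t : Torus) :
    ‖s - t‖ ≤ Real.pi * ‖point s - r * point t‖ := by
  have hπ := Real.pi_pos
  have hch := norm_sub_le_chord s t
  have h4 : ‖point s - point t‖ ≤ ‖point s - r * point t‖ + (1 - r) := by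
    have : point s - point t = (point s - r * point t) + ((r - 1 : ℝ) : ℂ) * point t := by
      push_cast; ring
    rw [this]
    refine (norm_add_le _ _).trans_eq ?_
    rw [norm_mul_point, abs_of_nonpos (by linarith)]
    ring
  have h5 := one_sub_norm_le (r * point t) s
  rw [norm_mul_point, abs_of_nonneg h0] at h5
  have h6 : 2 / Real.pi * ‖s - t‖ ≤ 2 * ‖point s - r * point t‖ := by linarith
  calc ‖s - t‖ = Real.pi / 2 * (2 / Real.pi * ‖s - t‖) := by field_simp
    _ ≤ Real.pi / 2 * (2 * ‖point s - r * point t‖) := by gcongr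
    _ = _ := by ring

/-- At angular scale `2^k (1 - r)` the kernel is of size `4^(-k)/(1 - r)` and the extra factor of
size `2^(kb)`. Each scale contributes a multiple of `2^(k(b-1))`, summable because `b < 1`. -/
lemma exists_lintegral_ker_mul_rpow_le {b : ℝ} (hb1 : b < 1) :
    ∃ C : ℝ≥0∞, C ≠ ∞ ∧ ∀ r ∈ Ico (0 : ℝ) 1, ∀ t₀ : Torus,
      ∫⁻ t, ENNReal.ofReal (ker (r * point t₀) t * (‖point t - r * point t₀‖ / (1 - r)) ^ b)
        ∂arcMeasure ≤ C := by
  have hπ := Real.pi_pos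
  have hq : (2 : ℝ) ^ (b - 1) < 1 := Real.rpow_lt_one_of_one_lt_of_neg one_lt_two (by linarith)
  refine ⟨∑' k : ℕ, ENNReal.ofReal (4 * (2 * Real.pi) ^ (1 - b) * ((2 : ℝ) ^ (b - 1)) ^ k), ?_, ?_⟩
  · exact ((summable_geometric_of_lt_one (by positivity) hq).mul_left _).tsum_ofReal_ne_top
  intro r hr t₀
  set h := 1 - r with hh
  have hh0 : 0 < h := by linarith [hr.2]
  have hz := norm_mul_point_lt_one hr.1 hr.2 t₀
  calc _ ≤ ∫⁻ t, ∑' k : ℕ, (Metric.closedBall t₀ (2 ^ k * h)).indicator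
        (fun _ => ENNReal.ofReal (2 / h * (2 ^ k / (2 * Real.pi)) ^ (b - 2))) t ∂arcMeasure := by
        refine lintegral_mono fun t => ?_
        obtain ⟨k, hk1, hk2⟩ := exists_dyadic_scale ‖t - t₀‖ hh0
        refine le_trans ?_ (ENNReal.le_tsum k)
        rw [indicator_of_mem (by simpa [dist_eq_norm] using hk1)]
        refine ENNReal.ofReal_le_ofReal ?_
        set D := ‖point t - r * point t₀‖ with hD
        have hD0 : 0 < D := norm_point_sub_pos hz t
        have hhD : h ≤ D := by
          have := one_sub_norm_le (r * point t₀) t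
          rwa [norm_mul_point, abs_of_nonneg hr.1] at this
        have hDk : 2 ^ k * h ≤ 2 * Real.pi * D := by
          refine hk2.trans ?_
          rw [mul_assoc]
          refine mul_le_mul_of_nonneg_left (max_le (norm_sub_le_pi_mul hr.2 hr.1 t t₀) ?_) (by norm_num)
          nlinarith [Real.pi_gt_three]
        have hDk' : 2 ^ k / (2 * Real.pi) ≤ D / h := by
          rw [div_le_div_iff₀ (by positivity) hh0]; linarith
        have hker : ker (r * point t₀) t ≤ 2 / h * (D / h) ^ (-2 : ℝ) := by
          rw [ker_eq, norm_mul_point, abs_of_nonneg hr.1, Real.rpow_neg (by positivity), Real.rpow_two,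
            ← hD]
          have : 2 / h * ((D / h) ^ 2)⁻¹ = 2 * h / D ^ 2 := by field_simp
          rw [this]
          gcongr
          nlinarith [hr.1, hr.2]
        calc _ ≤ 2 / h * (D / h) ^ (-2 : ℝ) * (D / h) ^ b := by gcongr
          _ = 2 / h * (D / h) ^ (b - 2) := by
              rw [mul_assoc, ← Real.rpow_add (by positivity)]; congr 2; ring
          _ ≤ _ := by
              refine mul_le_mul_of_nonneg_left ?_ (by positivity)
              exact Real.rpow_le_rpow_of_nonpos (by positivity) hDk' (by linarith)
    _ = ∑' k : ℕ, ∫⁻ t, (Metric.closedBall t₀ (2 ^ k * h)).indicator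
        (fun _ => ENNReal.ofReal (2 / h * (2 ^ k / (2 * Real.pi)) ^ (b - 2))) t ∂arcMeasure :=
        lintegral_tsum fun k =>
          (measurable_const.indicator Metric.isClosed_closedBall.measurableSet).aemeasurable
    _ ≤ _ := by
        refine ENNReal.tsum_le_tsum fun k => ?_
        rw [lintegral_indicator Metric.isClosed_closedBall.measurableSet, setLIntegral_const,
          arcMeasure_closedBall, ← ENNReal.ofReal_mul (by positivity)]
        refine ENNReal.ofReal_le_ofReal ?_
        calc _ ≤ 2 / h * (2 ^ k / (2 * Real.pi)) ^ (b - 2) * (2 ^ k * h / Real.pi) := by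
              gcongr
              exact min_le_right _ _
          _ = 4 * ((2 ^ k / (2 * Real.pi)) ^ (b - 2) * (2 ^ k / (2 * Real.pi))) := by
              field_simp; ring
          _ = 4 * (2 ^ k / (2 * Real.pi)) ^ (b - 1) := by
              rw [← Real.rpow_add_one (by positivity)]; congr 2; ring
          _ = _ := by
              rw [Real.div_rpow (by positivity) (by positivity), ← Real.rpow_natCast,
                ← Real.rpow_natCast, ← Real.rpow_mul (by norm_num), ← Real.rpow_mul (by norm_num),
                mul_comm (k : ℝ), div_eq_mul_inv, ← Real.rpow_neg (by positivity)]
              rw [neg_sub]; ring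

/-- Harnack between `r * point t₀`, at distance `D` from `point t`, and the point of the ray through
`t` at height `D/2`. The kernels differ by a factor `25 D/(1 - r)`, only linear in `D`, and
`poissonL_le_maxP` supplies the 18 in `450 = 25 * 18`. -/
lemma poissonL_le_mul_maxP (W : Torus → ℝ≥0∞) {r : ℝ} (hr : r ∈ Ico (0 : ℝ) 1) (t₀ t : Torus) :
    poissonL W (r * point t₀) ≤
      ENNReal.ofReal (450 * (‖point t - r * point t₀‖ / (1 - r))) * maxP W t := by
  set h := 1 - r with hh
  have hh0 : 0 < h := by linarith [hr.2]
  have hz := norm_mul_point_lt_one hr.1 hr.2 t₀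
  set D := ‖point t - r * point t₀‖ with hD
  have hD0 : 0 < D := norm_point_sub_pos hz t
  have hhD : h ≤ D := by
    have := one_sub_norm_le (r * point t₀) t
    rwa [norm_mul_point, abs_of_nonneg hr.1] at this
  have hD2 : D ≤ 2 := by
    refine (norm_sub_le _ _).trans ?_
    rw [norm_point, norm_mul_point, abs_of_nonneg hr.1]; linarith [hr.2]
  have hρ0 : 0 ≤ 1 - D / 2 := by linarith
  have hρ1 : 1 - D / 2 < 1 := by linarith
  have hw := norm_mul_point_lt_one hρ0 hρ1 t
  have hker : ∀ s, ker (r * point t₀) s ≤ 25 * (D / h) * ker ((1 - D / 2 : ℝ) * point t) s := by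
    intro s
    refine (ker_le_harnack hz hw s).trans ?_
    refine mul_le_mul_of_nonneg_right ?_ (ker_pos hw s).le
    rw [norm_mul_point, norm_mul_point, abs_of_nonneg hr.1, abs_of_nonneg hρ0, ← hh]
    have hd : ‖(r : ℂ) * point t₀ - (1 - D / 2 : ℝ) * point t‖ ≤ 3 / 2 * D := by
      have : (r : ℂ) * point t₀ - (1 - D / 2 : ℝ) * point t =
          -(point t - r * point t₀) + (D / 2 : ℝ) * point t := by push_cast; ring
      rw [this]
      refine (norm_add_le _ _).trans ?_
      rw [norm_neg, norm_mul_point, abs_of_pos (by positivity)]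
      linarith
    have e1 : (1 - r ^ 2) / (1 - (1 - D / 2) ^ 2) ≤ 4 * h / D := by
      rw [div_le_div_iff₀ (by nlinarith) hD0]
      have a1 : 1 - r ^ 2 ≤ 2 * h := by nlinarith [hr.1, hr.2]
      have a2 : D / 2 ≤ 1 - (1 - D / 2) ^ 2 := by nlinarith
      nlinarith
    have e2 : 1 + ‖(r : ℂ) * point t₀ - (1 - D / 2 : ℝ) * point t‖ / h ≤ 5 / 2 * (D / h) := by
      have a1 : 1 ≤ D / h := by rwa [one_le_div hh0]
      have a2 : ‖(r : ℂ) * point t₀ - (1 - D / 2 : ℝ) * point t‖ / h ≤ 3 / 2 * (D / h) := by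
        rw [← mul_div_assoc]; gcongr
      linarith
    calc _ ≤ 4 * h / D * (5 / 2 * (D / h)) ^ 2 := by gcongr
      _ = 25 * (D / h) := by field_simp; ring
  calc poissonL W (r * point t₀) ≤
        ∫⁻ s, ENNReal.ofReal (25 * (D / h)) * (ENNReal.ofReal (ker ((1 - D / 2 : ℝ) * point t) s) * W s)
          ∂arcMeasure := by
        refine lintegral_mono fun s => ?_
        rw [← mul_assoc, ← ENNReal.ofReal_mul (by positivity)]
        exact mul_le_mul_left (ENNReal.ofReal_le_ofReal (hker s)) _
    _ = ENNReal.ofReal (25 * (D / h)) * poissonL W ((1 - D / 2 : ℝ) * point t) :=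
        lintegral_const_mul' _ _ ENNReal.ofReal_ne_top
    _ ≤ ENNReal.ofReal (25 * (D / h)) * (18 * maxP W t) :=
        mul_le_mul_right (poissonL_le_maxP W hρ0 hρ1 t) _
    _ = _ := by
        rw [← mul_assoc, show (18 : ℝ≥0∞) = ENNReal.ofReal 18 by norm_num,
          ← ENNReal.ofReal_mul (by positivity)]
        congr 2; ring

/-- Reverse Jensen inequality for negative powers of a function dominated by its own maximal
function. -/
lemma exists_poissonL_rpow_neg_le {b : ℝ} (hb0 : 0 < b) (hb1 : b < 1) {A : ℝ} (hA : 1 ≤ A) :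
    ∃ C : ℝ≥0∞, C ≠ ∞ ∧ ∀ W : Torus → ℝ≥0∞, (∀ t, maxP W t ≤ ENNReal.ofReal A * W t) →
      ∀ r ∈ Ico (0 : ℝ) 1, ∀ t₀ : Torus,
        poissonL (fun t => W t ^ (-b)) (r * point t₀) ≤ C * poissonL W (r * point t₀) ^ (-b) := by
  obtain ⟨C, hC, h⟩ := exists_lintegral_ker_mul_rpow_le hb1
  have hAt : ENNReal.ofReal ((450 * A) ^ b) ≠ ∞ := ENNReal.ofReal_ne_top
  refine ⟨ENNReal.ofReal ((450 * A) ^ b) * C, ENNReal.mul_ne_top hAt hC, ?_⟩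
  intro W hW r hr t₀
  have hz := norm_mul_point_lt_one hr.1 hr.2 t₀
  have hpt : ∀ t, W t ^ (-b) ≤ ENNReal.ofReal ((450 * A) ^ b) *
      ENNReal.ofReal ((‖point t - r * point t₀‖ / (1 - r)) ^ b) *
        poissonL W (r * point t₀) ^ (-b) := by
    intro t
    -- At `t` the function `W` is at least `1/(450 A κ)` times its Poisson average. Hence `W^(-b)`
    -- exceeds the corresponding power of the average by at most a multiple of `κ^b`, which the
    -- kernel integrates for `b < 1`.
    set κ := ‖point t - r * point t₀‖ / (1 - r) with hκ
    have hκ0 : 0 < κ := div_pos (norm_point_sub_pos hz t) (by linarith [hr.2])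
    have h1 : poissonL W (r * point t₀) ≤ ENNReal.ofReal (450 * A * κ) * W t := by
      refine (poissonL_le_mul_maxP W hr t₀ t).trans ((mul_le_mul_right (hW t) _).trans_eq ?_)
      rw [← mul_assoc, ← ENNReal.ofReal_mul (by positivity)]
      congr 2; ring
    have hm : 0 < 450 * A * κ := by positivity
    have h2 := ENNReal.rpow_le_rpow h1 hb0.le
    rw [ENNReal.mul_rpow_of_nonneg _ _ hb0.le, ENNReal.ofReal_rpow_of_pos hm] at h2
    rw [← ENNReal.ofReal_mul (by positivity), ← Real.mul_rpow (by positivity) hκ0.le,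
      ENNReal.rpow_neg, ENNReal.rpow_neg]
    set m := ENNReal.ofReal ((450 * A * κ) ^ b) with hmdef
    have hm0 : m ≠ 0 := (ENNReal.ofReal_pos.2 (by positivity)).ne'
    have hmt : m ≠ ∞ := ENNReal.ofReal_ne_top
    have h3 := ENNReal.inv_le_inv.2 h2
    rw [ENNReal.mul_inv (Or.inl hm0) (Or.inl hmt)] at h3
    calc (W t ^ b)⁻¹ = m * (m⁻¹ * (W t ^ b)⁻¹) := by
          rw [← mul_assoc, ENNReal.mul_inv_cancel hm0 hmt, one_mul]
      _ ≤ _ := mul_le_mul_right h3 _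
  calc _ ≤ ∫⁻ t, ENNReal.ofReal ((450 * A) ^ b) * poissonL W (r * point t₀) ^ (-b) *
        ENNReal.ofReal (ker (r * point t₀) t * (‖point t - r * point t₀‖ / (1 - r)) ^ b)
          ∂arcMeasure := by
        refine lintegral_mono fun t => ?_
        refine (mul_le_mul_right (hpt t) _).trans_eq ?_
        rw [ENNReal.ofReal_mul (ker_pos hz t).le]
        ring
    _ = ENNReal.ofReal ((450 * A) ^ b) * poissonL W (r * point t₀) ^ (-b) *
        ∫⁻ t, ENNReal.ofReal (ker (r * point t₀) t * (‖point t - r * point t₀‖ / (1 - r)) ^ b)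
          ∂arcMeasure := by
        refine lintegral_const_mul _ (Measurable.ennreal_ofReal ?_)
        exact (continuous_ker hz).measurable.mul
          (((measurable_point.sub_const _).norm.div_const _).pow_const _)
    _ ≤ ENNReal.ofReal ((450 * A) ^ b) * poissonL W (r * point t₀) ^ (-b) * C :=
        mul_le_mul_right (h r hr t₀) _
    _ = _ := by ring

/-- The first radius, `rad 0 = 0`, gives the mean. For a majorant controlled by its maximal function
this is a positive lower bound, unless the mean vanishes. -/
lemma lintegral_le_maxP (W : Torus → ℝ≥0∞) (t : Torus) : ∫⁻ s, W s ∂arcMeasure ≤ maxP W t := by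
  refine le_trans (le_of_eq ?_) (le_iSup _ 0)
  unfold poissonL
  refine lintegral_congr fun s => ?_
  have : ker ((rad 0 : ℂ) * point t) s = 1 := by
    rw [ker_eq]; simp [rad]
  rw [this]; simp

/-- Weighted estimate for the Littlewood–Paley function with a majorant of the weight. -/
lemma exists_lintegral_gsq_mul_le {b Q : ℝ} (hb0 : 0 < b) (hb1 : b < 1) (hQ : 1 < Q) :
    ∃ C : ℝ≥0∞, C ≠ ∞ ∧ ∀ f : Torus → ℂ, Measurable f → Integrable f arcMeasure →
      ∀ φ : Torus → ℝ≥0∞, Measurable φ → ∀ c : ℝ≥0∞, c ≠ ∞ → (∀ t, φ t ≤ c) →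
      ∃ W : Torus → ℝ≥0∞, Measurable W ∧
        ∫⁻ t, W t ^ Q ∂arcMeasure ≤ C * ∫⁻ t, φ t ^ (Q / (b * b)) ∂arcMeasure ∧
        ∫⁻ t, gsq f t * φ t ∂arcMeasure ≤ C * ∫⁻ t, ‖f t‖ₑ ^ 2 * W t ^ (b * b) ∂arcMeasure := by
  obtain ⟨A, hA1, hmaj⟩ := exists_maxP_majorant hQ
  obtain ⟨C1, hC1t, hC1⟩ := exists_poissonL_rpow_neg_le hb0 hb1 hA1
  have hδ0 : 0 < b * b := by positivity
  have hδ1 : b * b ≤ 1 := by nlinarith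
  set κ : ℝ≥0∞ := 8 * (C1 ^ b * ENNReal.ofReal ((1 + b) / (1 - b))) with hκ
  have hC1b : C1 ^ b ≠ ∞ := ENNReal.rpow_ne_top_of_nonneg hb0.le hC1t
  refine ⟨ENNReal.ofReal A + κ, ENNReal.add_ne_top.2 ⟨ENNReal.ofReal_ne_top,
    ENNReal.mul_ne_top (by norm_num) (ENNReal.mul_ne_top hC1b ENNReal.ofReal_ne_top)⟩, ?_⟩
  intro f hfm hfi φ hφ c hc hφc
  -- If `φ` vanishes almost everywhere, `W = 0` serves. Otherwise the positive integral bounds `W`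
  -- from below, so `W^(-b)` is a bounded weight.
  rcases eq_or_ne (∫⁻ t, φ t ^ (1 / (b * b)) ∂arcMeasure) 0 with h0 | h0
  · refine ⟨fun _ => 0, measurable_const, by simp [ENNReal.zero_rpow_of_pos (by linarith : 0 < Q)], ?_⟩
    rw [lintegral_eq_zero_iff (hφ.pow_const _)] at h0
    rw [lintegral_congr_ae (g := fun _ => (0 : ℝ≥0∞))]
    · simp
    · filter_upwards [h0] with t ht
      simp only [Pi.zero_apply] at ht
      rw [ENNReal.rpow_eq_zero_iff_of_pos (by positivity)] at ht
      rw [ht, mul_zero]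
  -- The majorant is taken of `φ^(1/b²)`, so that `φ ≤ W^(b²)`.
  obtain ⟨W, hWm, hψW, hWmax, hWQ, hWc⟩ := hmaj (fun t => φ t ^ (1 / (b * b))) (hφ.pow_const _)
  have hφW : ∀ t, φ t ≤ W t ^ (b * b) := by
    intro t
    have := ENNReal.rpow_le_rpow (hψW t) hδ0.le
    simp only [← ENNReal.rpow_mul] at this
    rwa [one_div_mul_cancel hδ0.ne', ENNReal.rpow_one] at this
  refine ⟨W, hWm, ?_, ?_⟩
  · refine hWQ.trans ?_
    simp only [← ENNReal.rpow_mul]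
    rw [one_div_mul_eq_div]
    exact mul_le_mul_left le_self_add _
  set c' : ℝ≥0∞ := 2 * c ^ (1 / (b * b)) + 1 with hc'
  have hc't : c' ≠ ∞ := ENNReal.add_ne_top.2 ⟨ENNReal.mul_ne_top (by norm_num)
    (ENNReal.rpow_ne_top_of_nonneg (by positivity) hc), by norm_num⟩
  have hWc' : ∀ t, W t ≤ c' := fun t =>
    (hWc _ (fun t => ENNReal.rpow_le_rpow (hφc t) (by positivity)) t).trans le_self_add
  set m : ℝ≥0∞ := (∫⁻ t, φ t ^ (1 / (b * b)) ∂arcMeasure) / ENNReal.ofReal A with hm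
  have hm0 : m ≠ 0 := ENNReal.div_ne_zero.2 ⟨h0, ENNReal.ofReal_ne_top⟩
  have hmW : ∀ t, m ≤ W t := by
    intro t
    refine ENNReal.div_le_of_le_mul' ?_
    exact ((lintegral_mono hψW).trans (lintegral_le_maxP W t)).trans (hWmax t)
  have hnegb : ∀ x y : ℝ≥0∞, x ≤ y → y ^ (-b) ≤ x ^ (-b) := fun x y hxy => by
    rw [ENNReal.rpow_neg, ENNReal.rpow_neg]
    exact ENNReal.inv_le_inv.2 (ENNReal.rpow_le_rpow hxy hb0.le)
  have hmt : m ^ (-b) ≠ ∞ := by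
    rw [ENNReal.rpow_neg]
    exact ENNReal.inv_ne_top.2 (by rw [Ne, ENNReal.rpow_eq_zero_iff_of_pos hb0]; exact hm0)
  have hVt : ∀ t, W t ^ (-b) ≠ ∞ := fun t => ((hnegb _ _ (hmW t)).trans_lt hmt.lt_top).ne
  have hV0 : c' ^ (-b) ≠ 0 := by
    rw [ENNReal.rpow_neg]
    exact ENNReal.inv_ne_zero.2 (ENNReal.rpow_ne_top_of_nonneg hb0.le hc't)
  have hVc : ∀ t, c' ^ (-b) ≤ W t ^ (-b) := fun t => hnegb _ _ (hWc' t)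
  have hV1 : c' ^ (-b) ≠ ∞ := ((hVc 0).trans_lt (hVt 0).lt_top).ne
  set h : Torus → ℝ := fun t => (W t ^ (-b)).toReal with hh
  have hhV : ∀ t, ENNReal.ofReal (h t) = W t ^ (-b) := fun t => ENNReal.ofReal_toReal (hVt t)
  have hhm : Measurable h := (hWm.pow_const _).ennreal_toReal
  have hhi : Integrable h arcMeasure := by
    refine Integrable.of_bound hhm.aestronglyMeasurable (m ^ (-b)).toReal (.of_forall fun t => ?_)
    rw [Real.norm_of_nonneg ENNReal.toReal_nonneg]
    exact ENNReal.toReal_mono hmt (hnegb _ _ (hmW t))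
  -- The boundary weight is `h = W^(-b)` with `s = b`, so that `h^(-s) = W^(b²)`.
  have key := lintegral_weighted_energy hb0.le hb1 hfm hfi hhm hhi (ENNReal.toReal_pos hV0 hV1)
    (fun t => ENNReal.toReal_mono (hVt t) (hVc t))
  simp only [hhV, ← ENNReal.rpow_mul, neg_mul_neg] at key
  -- Jensen replaces `P(W^(b²))` by `(PW)^(b²)`; the reverse Jensen inequality for `W^(-b)`, raised
  -- to the power `b`, turns this into the weight occurring in `key`.
  have hpt : ∀ r ∈ Ioo (0 : ℝ) 1, ∀ t, poissonL φ (r * point t) ≤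
      C1 ^ b * poissonL (fun t => W t ^ (-b)) (r * point t) ^ (-b) := by
    intro r hr t
    have hz := norm_mul_point_lt hr t
    refine ((poissonL_mono hφW _).trans (poissonL_rpow_le hWm hδ0.le hδ1 hz)).trans ?_
    set P := poissonL W (r * point t) with hP
    set X := poissonL (fun t => W t ^ (-b)) (r * point t) with hX
    have hX0 : X ≠ 0 := by
      have : c' ^ (-b) ≤ X := by
        rw [← poissonL_const (c' ^ (-b)) hz]
        exact poissonL_mono hVc _
      exact (lt_of_lt_of_le (pos_iff_ne_zero.2 hV0) this).ne'
    have h1 := ENNReal.rpow_le_rpow (hC1 W hWmax r ⟨hr.1.le, hr.2⟩ t) hb0.le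
    rw [ENNReal.mul_rpow_of_nonneg _ _ hb0.le, ← ENNReal.rpow_mul, neg_mul, ENNReal.rpow_neg] at h1
    rw [ENNReal.rpow_neg, ← div_eq_mul_inv, ENNReal.le_div_iff_mul_le
      (Or.inl (by rw [Ne, ENNReal.rpow_eq_zero_iff_of_pos hb0]; exact hX0)) (Or.inr hC1b)]
    calc P ^ (b * b) * X ^ b ≤ P ^ (b * b) * (C1 ^ b * (P ^ (b * b))⁻¹) := mul_le_mul_right h1 _
      _ = C1 ^ b * (P ^ (b * b) * (P ^ (b * b))⁻¹) := by ring
      _ ≤ C1 ^ b * 1 := mul_le_mul_right (ENNReal.mul_inv_le_one _) _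
      _ = _ := mul_one _
  calc _ ≤ 8 * ∫⁻ t, (∫⁻ r in Ioo 0 1, ENNReal.ofReal (r * -Real.log r) *
        (energy f (r * point t) * poissonL φ (r * point t))) ∂arcMeasure :=
        lintegral_gsq_mul_le hfi hφ
    _ ≤ 8 * ∫⁻ t, (∫⁻ r in Ioo 0 1, C1 ^ b * (ENNReal.ofReal (r * -Real.log r) *
        (energy f (r * point t) * poissonL (fun t => W t ^ (-b)) (r * point t) ^ (-b))))
          ∂arcMeasure := by
        refine mul_le_mul_right (lintegral_mono fun t =>
          setLIntegral_mono' measurableSet_Ioo fun r hr => ?_) _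
        calc _ ≤ ENNReal.ofReal (r * -Real.log r) * (energy f (r * point t) *
              (C1 ^ b * poissonL (fun t => W t ^ (-b)) (r * point t) ^ (-b))) :=
              mul_le_mul_right (mul_le_mul_right (hpt r hr t) _) _
          _ = _ := by ring
    _ = 8 * (C1 ^ b * ∫⁻ t, (∫⁻ r in Ioo 0 1, ENNReal.ofReal (r * -Real.log r) *
        (energy f (r * point t) * poissonL (fun t => W t ^ (-b)) (r * point t) ^ (-b)))
          ∂arcMeasure) := by
        simp_rw [lintegral_const_mul' _ _ hC1b]
    _ ≤ 8 * (C1 ^ b * (ENNReal.ofReal ((1 + b) / (1 - b)) *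
        ∫⁻ t, ‖f t‖ₑ ^ 2 * W t ^ (b * b) ∂arcMeasure)) := by
        refine mul_le_mul_right (mul_le_mul_right key _) _
    _ = κ * ∫⁻ t, ‖f t‖ₑ ^ 2 * W t ^ (b * b) ∂arcMeasure := by rw [hκ]; ring
    _ ≤ _ := mul_le_mul_left le_add_self _

/-- Testing `gsq f` against its own power `p/2 - 1` reproduces the integral to be bounded. The
weighted estimate returns that integral to the power `1 - 2/p < 1`, which is then absorbed. -/
theorem exists_lintegral_gsq_rpow_le_of_two_lt {p : ℝ} (hp : 2 < p) :
    ∃ C : ℝ≥0∞, C ≠ ∞ ∧ ∀ f : Torus → ℂ, Measurable f → MemLp f (ENNReal.ofReal p) arcMeasure →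
      ∫⁻ t, gsq f t ^ (p / 2) ∂arcMeasure ≤ C * ∫⁻ t, ‖f t‖ₑ ^ p ∂arcMeasure := by
  have hp0 : 0 < p := by linarith
  have hp2 : 0 < p - 2 := by linarith
  -- The exponents make `W^(b²) = (W^Q)^(1 - 2/p)`, as Hölder against `|f|²` requires, and make
  -- `Q/b² = p/(p - 2)`, the conjugate of `p/2`. That `Q > 1` is the inequality `(p - 1)² > p(p -
  -- 2)`.
  set b : ℝ := (p - 1) / p with hb
  set Q : ℝ := (p - 1) ^ 2 / (p * (p - 2)) with hQdef
  have hb0 : 0 < b := div_pos (by linarith) hp0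
  have hb1 : b < 1 := by rw [hb, div_lt_one hp0]; linarith
  have hQ : 1 < Q := by rw [hQdef, one_lt_div (by positivity)]; nlinarith
  have hQ1 : Q * (1 - 2 / p) = b * b := by rw [hQdef, hb]; field_simp
  have hQ2 : (p / 2 - 1) * (Q / (b * b)) = p / 2 := by
    have : p - 1 ≠ 0 := by linarith
    rw [hQdef, hb]; field_simp
  have hθ : 0 ≤ 1 - 2 / p := by rw [sub_nonneg, div_le_one hp0]; linarith
  obtain ⟨C, hCt, hC⟩ := exists_lintegral_gsq_mul_le hb0 hb1 hQ
  set D : ℝ≥0∞ := C * C ^ (1 - 2 / p) with hD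
  have hDt : D ≠ ∞ := ENNReal.mul_ne_top hCt (ENNReal.rpow_ne_top_of_nonneg hθ hCt)
  refine ⟨D ^ (p / 2), ENNReal.rpow_ne_top_of_nonneg (by positivity) hDt, ?_⟩
  intro f hfm hf
  have hfi := MemLp.integrable_arc (by linarith) hf
  set A := ∫⁻ t, ‖f t‖ₑ ^ p ∂arcMeasure with hA
  have hgm := measurable_gsq f
  have hmin : ∀ n : ℕ, Measurable fun t => min (gsq f t) (n : ℝ≥0∞) := fun n =>
    hgm.min measurable_const
  -- Truncation at `n` keeps `S` finite, so a power of it can be divided out; monotone convergence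
  -- removes the truncation.
  have hS : ∀ n : ℕ, ∫⁻ t, min (gsq f t) (n : ℝ≥0∞) ^ (p / 2) ∂arcMeasure ≤ D ^ (p / 2) * A := by
    intro n
    set S := ∫⁻ t, min (gsq f t) (n : ℝ≥0∞) ^ (p / 2) ∂arcMeasure with hSdef
    have hSt : S ≠ ∞ := by
      have : S ≤ (n : ℝ≥0∞) ^ (p / 2) := by
        calc S ≤ ∫⁻ _, (n : ℝ≥0∞) ^ (p / 2) ∂arcMeasure :=
              lintegral_mono fun t => ENNReal.rpow_le_rpow (min_le_right _ _) (by positivity)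
          _ = _ := by rw [lintegral_const, arcMeasure_univ, mul_one]
      exact ne_top_of_le_ne_top
        (ENNReal.rpow_ne_top_of_nonneg (by positivity) (ENNReal.natCast_ne_top n)) this
    rcases eq_or_ne S 0 with hS0 | hS0
    · rw [hS0]; exact zero_le
    obtain ⟨W, hWm, hWQ, hWf⟩ := hC f hfm hfi (fun t => min (gsq f t) (n : ℝ≥0∞) ^ (p / 2 - 1))
      ((hmin n).pow_const _) ((n : ℝ≥0∞) ^ (p / 2 - 1))
      (ENNReal.rpow_ne_top_of_nonneg (by linarith) (ENNReal.natCast_ne_top n))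
      (fun t => ENNReal.rpow_le_rpow (min_le_right _ _) (by linarith))
    simp only [← ENNReal.rpow_mul, hQ2] at hWQ
    have h1 : S ≤ D * A ^ (2 / p) * S ^ (1 - 2 / p) := by
      calc S ≤ ∫⁻ t, gsq f t * min (gsq f t) (n : ℝ≥0∞) ^ (p / 2 - 1) ∂arcMeasure := by
            refine lintegral_mono fun t => ?_
            calc _ = min (gsq f t) (n : ℝ≥0∞) ^ (1 : ℝ) * min (gsq f t) (n : ℝ≥0∞) ^ (p / 2 - 1) := by
                  rw [← ENNReal.rpow_add_of_nonneg _ _ (by norm_num) (by linarith)]; congr 1; ring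
              _ ≤ _ := by
                  rw [ENNReal.rpow_one]
                  exact mul_le_mul_left (min_le_left _ _) _
        _ ≤ C * ∫⁻ t, ‖f t‖ₑ ^ 2 * W t ^ (b * b) ∂arcMeasure := hWf
        _ = C * ∫⁻ t, (‖f t‖ₑ ^ p) ^ (2 / p) * (W t ^ Q) ^ (1 - 2 / p) ∂arcMeasure := by
            congr 1
            refine lintegral_congr fun t => ?_
            rw [← ENNReal.rpow_mul, ← ENNReal.rpow_mul, hQ1, mul_div_cancel₀ _ hp0.ne',
              ENNReal.rpow_two]
        _ ≤ C * (A ^ (2 / p) * (∫⁻ t, W t ^ Q ∂arcMeasure) ^ (1 - 2 / p)) :=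
            mul_le_mul_right (ENNReal.lintegral_mul_norm_pow_le (hfm.enorm.pow_const p).aemeasurable
              (hWm.pow_const Q).aemeasurable (by positivity) hθ (by ring)) _
        _ ≤ C * (A ^ (2 / p) * (C * S) ^ (1 - 2 / p)) :=
            mul_le_mul_right (mul_le_mul_right (ENNReal.rpow_le_rpow hWQ hθ) _) _
        _ = _ := by rw [ENNReal.mul_rpow_of_nonneg _ _ hθ, hD]; ring
    have hSθ0 : S ^ (1 - 2 / p) ≠ 0 := by
      rw [Ne, ENNReal.rpow_eq_zero_iff]
      push Not
      exact ⟨fun h => absurd h hS0, fun h => absurd h hSt⟩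
    have hSθt : S ^ (1 - 2 / p) ≠ ∞ := ENNReal.rpow_ne_top_of_nonneg hθ hSt
    have h2 : S ^ (2 / p) ≤ D * A ^ (2 / p) := by
      rw [← ENNReal.mul_le_mul_iff_left hSθ0 hSθt]
      refine le_trans (le_of_eq ?_) h1
      rw [← ENNReal.rpow_add_of_nonneg _ _ (by positivity) hθ]
      simp
    have h3 := ENNReal.rpow_le_rpow h2 (by positivity : 0 ≤ p / 2)
    rw [ENNReal.mul_rpow_of_nonneg _ _ (by positivity), ← ENNReal.rpow_mul, ← ENNReal.rpow_mul,
      div_mul_div_cancel₀ hp0.ne', div_self two_ne_zero] at h3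
    simpa using h3
  have hlim : Filter.Tendsto (fun n : ℕ => ∫⁻ t, min (gsq f t) (n : ℝ≥0∞) ^ (p / 2) ∂arcMeasure)
      Filter.atTop (nhds (∫⁻ t, gsq f t ^ (p / 2) ∂arcMeasure)) := by
    refine lintegral_tendsto_of_tendsto_of_monotone
      (fun n => ((hmin n).pow_const _).aemeasurable) (.of_forall fun t => ?_) (.of_forall fun t => ?_)
    · intro n m hnm
      exact ENNReal.rpow_le_rpow (min_le_min_left _ (by exact_mod_cast hnm)) (by positivity)
    · have h1 : Filter.Tendsto (fun n : ℕ => min (gsq f t) (n : ℝ≥0∞)) Filter.atTop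
          (nhds (min (gsq f t) ∞)) :=
        tendsto_const_nhds.min ENNReal.tendsto_nat_nhds_top
      rw [min_eq_left le_top] at h1
      exact (ENNReal.continuous_rpow_const.tendsto _).comp h1
  exact le_of_tendsto' hlim hS

/-- The Littlewood–Paley square function is bounded on `L^p` for `1 < p < ∞`. -/
theorem exists_lintegral_gsq_rpow_le {p : ℝ} (hp : 1 < p) :
    ∃ C : ℝ≥0∞, C ≠ ∞ ∧ ∀ f : Torus → ℂ, MemLp f (ENNReal.ofReal p) arcMeasure →
      ∫⁻ t, gsq f t ^ (p / 2) ∂arcMeasure ≤ C * ∫⁻ t, ‖f t‖ₑ ^ p ∂arcMeasure := by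
  obtain ⟨C, hC, h⟩ : ∃ C : ℝ≥0∞, C ≠ ∞ ∧ ∀ f : Torus → ℂ, Measurable f →
      MemLp f (ENNReal.ofReal p) arcMeasure →
      ∫⁻ t, gsq f t ^ (p / 2) ∂arcMeasure ≤ C * ∫⁻ t, ‖f t‖ₑ ^ p ∂arcMeasure := by
    rcases le_or_gt p 2 with h2 | h2
    · exact exists_lintegral_gsq_rpow_le_of_le_two hp h2
    · exact exists_lintegral_gsq_rpow_le_of_two_lt h2
  refine ⟨C, hC, fun f hf => ?_⟩
  have hae := hf.aestronglyMeasurable.ae_eq_mk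
  have h1 := h _ hf.aestronglyMeasurable.stronglyMeasurable_mk.measurable (hf.ae_eq hae)
  have e1 : gsq f = gsq (hf.aestronglyMeasurable.mk f) := by
    unfold gsq
    rw [poissonExtension_congr_ae hae]
  have e2 : ∫⁻ t, ‖f t‖ₑ ^ p ∂arcMeasure =
      ∫⁻ t, ‖hf.aestronglyMeasurable.mk f t‖ₑ ^ p ∂arcMeasure := by
    refine lintegral_congr_ae ?_
    filter_upwards [hae] with t ht
    rw [← ht]
  rwa [e1, e2]

/-! ### Arcs and reduction of the two seminorms to symmetric arcs. -/

/-- The symmetric closed arc with center `c` and normalized length `min x 1`. -/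
def arc (c : Torus) (x : ℝ) : Set Torus := Metric.closedBall c (Real.pi * x)

lemma measurableSet_arc (c : Torus) (x : ℝ) : MeasurableSet (arc c x) :=
  Metric.isClosed_closedBall.measurableSet

lemma mem_arc {c t : Torus} {x : ℝ} : t ∈ arc c x ↔ ‖t - c‖ ≤ Real.pi * x := by
  rw [arc, Metric.mem_closedBall, dist_eq_norm]

lemma arc_mono (c : Torus) {x y : ℝ} (h : x ≤ y) : arc c x ⊆ arc c y :=
  Metric.closedBall_subset_closedBall (mul_le_mul_of_nonneg_left h Real.pi_pos.le)

lemma arc_min_one (c : Torus) (x : ℝ) : arc c (min x 1) = arc c x := by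
  rcases le_total x 1 with h | h
  · rw [min_eq_left h]
  · rw [min_eq_right h]
    have : ∀ y : ℝ, 1 ≤ y → arc c y = univ := fun y hy =>
      eq_univ_of_forall fun t => mem_arc.2 ((norm_le_pi _).trans (by nlinarith [Real.pi_pos]))
    rw [this 1 le_rfl, this x h]

lemma arcMeasure_arc (c : Torus) (x : ℝ) : arcMeasure (arc c x) = ENNReal.ofReal (min x 1) := by
  rw [arc, arcMeasure_closedBall, mul_div_cancel_left₀ _ Real.pi_pos.ne', min_comm]

lemma arcLength_arc (c : Torus) {x : ℝ} (h0 : 0 ≤ x) (h1 : x ≤ 1) : arcLength (arc c x) = x := by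
  rw [arcLength, measureReal_def, arcMeasure_arc, min_eq_left h1, ENNReal.toReal_ofReal h0]

lemma norm_coe_le_abs (y : ℝ) : ‖(y : Torus)‖ ≤ |y| := by
  simpa using QuotientAddGroup.norm_mk_le_norm (S := AddSubgroup.zmultiples (2 * Real.pi)) (m := y)

lemma exists_coe_add_eq (x : ℝ) (u : Torus) : ∃ y : ℝ, ((x + y : ℝ) : Torus) = u ∧ |y| = ‖u - x‖ := by
  obtain ⟨y, hy, -, hn⟩ := exists_real_rep (u - x)
  refine ⟨y, ?_, hn.symm⟩
  rw [AddCircle.coe_add, hy]; abel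

lemma isArc_arc (c : Torus) {x : ℝ} (h0 : 0 < x) (h1 : x ≤ 1) : IsArc (arc c x) := by
  obtain ⟨a, rfl⟩ : ∃ a : ℝ, (a : Torus) = c := QuotientAddGroup.mk_surjective c
  have hπ := Real.pi_pos
  have hx : 0 < Real.pi * x := by positivity
  have hx1 : Real.pi * x ≤ Real.pi := by nlinarith
  refine ⟨a - Real.pi * x, a + Real.pi * x, by linarith, by linarith,
    Icc (a - Real.pi * x) (a + Real.pi * x), Ioo_subset_Icc_self, le_rfl, ?_⟩
  ext u
  rw [mem_arc]
  constructor
  · intro hu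
    obtain ⟨y, rfl, hy⟩ := exists_coe_add_eq a u
    rw [← hy, abs_le] at hu
    exact ⟨a + y, ⟨by linarith [hu.1], by linarith [hu.2]⟩, rfl⟩
  · rintro ⟨y, hy, rfl⟩
    have : ((y : ℝ) : Torus) - (a : Torus) = ((y - a : ℝ) : Torus) := by rw [AddCircle.coe_sub]
    simp only [this]
    refine (norm_coe_le_abs _).trans ?_
    rw [abs_le]
    exact ⟨by linarith [hy.1], by linarith [hy.2]⟩

/-- The arc lies between an open and a closed ball about its midpoint, and these differ by a null
set. -/
lemma IsArc.exists_ae_eq_arc {I : Set Torus} (hI : IsArc I) :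
    ∃ (c : Torus) (ℓ : ℝ), 0 < ℓ ∧ ℓ ≤ 1 ∧ I =ᵐ[arcMeasure] arc c ℓ := by
  obtain ⟨a, b, hab, hb, J, hJ1, hJ2, rfl⟩ := hI
  have hπ := Real.pi_pos
  have hρ : Real.pi * ((b - a) / (2 * Real.pi)) = (b - a) / 2 := by field_simp
  refine ⟨((a + b) / 2 : ℝ), (b - a) / (2 * Real.pi), by apply div_pos <;> linarith, ?_, ?_⟩
  · rw [div_le_one (by positivity)]; linarith
  have h1 : (fun x : ℝ => (x : Torus)) '' J ⊆ arc ((a + b) / 2 : ℝ) ((b - a) / (2 * Real.pi)) := by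
    rintro _ ⟨y, hy, rfl⟩
    rw [mem_arc, hρ]
    have : ((y : ℝ) : Torus) - (((a + b) / 2 : ℝ) : Torus) = ((y - (a + b) / 2 : ℝ) : Torus) := by
      rw [AddCircle.coe_sub]
    simp only [this]
    refine (norm_coe_le_abs _).trans ?_
    have := hJ2 hy
    rw [abs_le]
    exact ⟨by linarith [this.1], by linarith [this.2]⟩
  have h2 : Metric.ball (((a + b) / 2 : ℝ) : Torus) (Real.pi * ((b - a) / (2 * Real.pi))) ⊆
      (fun x : ℝ => (x : Torus)) '' J := by
    intro u hu
    rw [Metric.mem_ball, dist_eq_norm, hρ] at hu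
    obtain ⟨y, rfl, hy⟩ := exists_coe_add_eq ((a + b) / 2) u
    rw [← hy, abs_lt] at hu
    exact ⟨(a + b) / 2 + y, hJ1 ⟨by linarith [hu.1], by linarith [hu.2]⟩, rfl⟩
  refine Filter.EventuallyLE.antisymm (LE.le.eventuallyLE h1) ?_
  exact (closedBall_ae_eq_ball _ _).le.trans (LE.le.eventuallyLE h2)

/-- Reduction of a supremum over all arcs to symmetric closed arcs. -/
lemma iSup_isArc_lt_top_iff {p η : ℝ} (hp : 0 < p) (Φ : Set Torus → ℝ≥0∞)
    (hΦ : ∀ I J, I =ᵐ[arcMeasure] J → Φ I = Φ J) :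
    (⨆ (I : Set Torus) (_ : IsArc I), (ENNReal.ofReal (arcLength I ^ (-η)) * Φ I) ^ (1 / p)) < ∞ ↔
      ∃ K : ℝ≥0∞, K ≠ ∞ ∧ ∀ (c : Torus) (ℓ : ℝ), 0 < ℓ → ℓ ≤ 1 →
        Φ (arc c ℓ) ≤ K * ENNReal.ofReal (ℓ ^ η) := by
  have hcancel : ∀ ℓ : ℝ, 0 < ℓ → ENNReal.ofReal (ℓ ^ η) * ENNReal.ofReal (ℓ ^ (-η)) = 1 := by
    intro ℓ h0
    rw [← ENNReal.ofReal_mul (by positivity), ← Real.rpow_add h0]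
    simp
  constructor
  · intro h
    set M := ⨆ (I : Set Torus) (_ : IsArc I),
      (ENNReal.ofReal (arcLength I ^ (-η)) * Φ I) ^ (1 / p) with hM
    refine ⟨M ^ p, ENNReal.rpow_ne_top_of_nonneg hp.le h.ne, fun c ℓ h0 h1 => ?_⟩
    have h2 : (ENNReal.ofReal (ℓ ^ (-η)) * Φ (arc c ℓ)) ^ (1 / p) ≤ M := by
      have := le_iSup₂ (f := fun (I : Set Torus) (_ : IsArc I) =>
        (ENNReal.ofReal (arcLength I ^ (-η)) * Φ I) ^ (1 / p)) (arc c ℓ) (isArc_arc c h0 h1)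
      rwa [arcLength_arc c h0.le h1] at this
    have h3 := ENNReal.rpow_le_rpow h2 hp.le
    rw [← ENNReal.rpow_mul, one_div_mul_cancel hp.ne', ENNReal.rpow_one] at h3
    calc Φ (arc c ℓ) = ENNReal.ofReal (ℓ ^ η) * (ENNReal.ofReal (ℓ ^ (-η)) * Φ (arc c ℓ)) := by
          rw [← mul_assoc, hcancel ℓ h0, one_mul]
      _ ≤ ENNReal.ofReal (ℓ ^ η) * M ^ p := mul_le_mul_right h3 _
      _ = _ := mul_comm _ _
  · rintro ⟨K, hK, h⟩
    refine lt_of_le_of_lt (iSup₂_le (a := K ^ (1 / p)) fun I hI => ?_)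
      (ENNReal.rpow_ne_top_of_nonneg (by positivity) hK).lt_top
    obtain ⟨c, ℓ, h0, h1, hae⟩ := hI.exists_ae_eq_arc
    refine ENNReal.rpow_le_rpow ?_ (by positivity)
    have hl : arcLength I = ℓ := by
      rw [← arcLength_arc c h0.le h1]
      exact measureReal_congr hae
    rw [hl, hΦ _ _ hae]
    calc _ ≤ ENNReal.ofReal (ℓ ^ (-η)) * (K * ENNReal.ofReal (ℓ ^ η)) :=
          mul_le_mul_right (h c ℓ h0 h1) _
      _ = K * (ENNReal.ofReal (ℓ ^ η) * ENNReal.ofReal (ℓ ^ (-η))) := by ring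
      _ = K := by rw [hcancel ℓ h0, mul_one]

lemma mean_congr_set {I J : Set Torus} (h : I =ᵐ[arcMeasure] J) (f : Torus → ℂ) :
    mean f I = mean f J := by
  unfold mean
  rw [setAverage_congr h]

lemma campanatoSeminorm_lt_top_iff {p η : ℝ} (hp : 0 < p) (f : Torus → ℂ) :
    campanatoSeminorm p η f < ∞ ↔
      ∃ K : ℝ≥0∞, K ≠ ∞ ∧ ∀ (c : Torus) (ℓ : ℝ), 0 < ℓ → ℓ ≤ 1 →
        ∫⁻ t in arc c ℓ, ‖f t - mean f (arc c ℓ)‖ₑ ^ p ∂arcMeasure ≤ K * ENNReal.ofReal (ℓ ^ η) :=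
  iSup_isArc_lt_top_iff hp (fun I => ∫⁻ t in I, ‖f t - mean f I‖ₑ ^ p ∂arcMeasure)
    fun I J h => by rw [mean_congr_set h, setLIntegral_congr h]

/-- The Littlewood–Paley square function truncated to distance at most `x` from the circle. -/
def gsqTrunc (f : Torus → ℂ) (x : ℝ) (t : Torus) : ℝ≥0∞ :=
  ∫⁻ r in Ioo (1 - x) 1,
    ENNReal.ofReal (gradNormSq (poissonExtension f) ((r : ℂ) * point t) * (1 - r ^ 2))

lemma littlewoodPaleySeminorm_lt_top_iff {p η : ℝ} (hp : 0 < p) (f : Torus → ℂ) :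
    littlewoodPaleySeminorm p η f < ∞ ↔
      ∃ K : ℝ≥0∞, K ≠ ∞ ∧ ∀ (c : Torus) (ℓ : ℝ), 0 < ℓ → ℓ ≤ 1 →
        ∫⁻ t in arc c ℓ, gsqTrunc f ℓ t ^ (p / 2) ∂arcMeasure ≤ K * ENNReal.ofReal (ℓ ^ η) := by
  have h := iSup_isArc_lt_top_iff (η := η) hp
    (fun I => ∫⁻ t in I, gsqTrunc f (arcLength I) t ^ (p / 2) ∂arcMeasure)
    fun I J h => by
      have : arcLength I = arcLength J := measureReal_congr h
      simp only [this]
      rw [setLIntegral_congr h]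
  refine Iff.trans h ⟨?_, ?_⟩
  · rintro ⟨K, hK, h⟩
    refine ⟨K, hK, fun c ℓ h0 h1 => ?_⟩
    have := h c ℓ h0 h1
    rwa [arcLength_arc c h0.le h1] at this
  · rintro ⟨K, hK, h⟩
    refine ⟨K, hK, fun c ℓ h0 h1 => ?_⟩
    rw [arcLength_arc c h0.le h1]
    exact h c ℓ h0 h1

/-! ### Means and oscillation over dilated arcs. -/

lemma enorm_mean_sub_le {f : Torus → ℂ} (hf : Integrable f arcMeasure) {B : Set Torus}
    (hB : arcMeasure B ≠ 0) (a : ℂ) :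
    ‖mean f B - a‖ₑ ≤ (arcMeasure B)⁻¹ * ∫⁻ t in B, ‖f t - a‖ₑ ∂arcMeasure := by
  have hBt : arcMeasure B ≠ ∞ := by
    refine ((measure_mono (subset_univ B)).trans_lt ?_).ne
    rw [arcMeasure_univ]; exact ENNReal.one_lt_top
  have hR : arcMeasure.real B ≠ 0 := ENNReal.toReal_ne_zero.2 ⟨hB, hBt⟩
  have e : mean f B - a = (arcMeasure.real B)⁻¹ • ∫ t in B, (f t - a) ∂arcMeasure := by
    have : IsFiniteMeasure (arcMeasure.restrict B) := ⟨by simp⟩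
    rw [integral_sub hf.integrableOn (integrable_const a), setIntegral_const, smul_sub, smul_smul,
      inv_mul_cancel₀ hR, one_smul, mean, setAverage_eq]
  rw [e, enorm_smul]
  refine mul_le_mul' (le_of_eq ?_) (enorm_integral_le_lintegral_enorm _)
  rw [enorm_inv hR, Real.enorm_eq_ofReal measureReal_nonneg, ofReal_measureReal hBt]

lemma setLIntegral_le_holder {p : ℝ} (hp : 1 ≤ p) {F : Torus → ℝ≥0∞} (hF : AEMeasurable F arcMeasure)
    (B : Set Torus) :
    ∫⁻ t in B, F t ∂arcMeasure ≤
      (∫⁻ t in B, F t ^ p ∂arcMeasure) ^ (1 / p) * arcMeasure B ^ (1 - 1 / p) := by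
  have hp0 : 0 < p := by linarith
  have h := ENNReal.lintegral_mul_norm_pow_le (μ := arcMeasure.restrict B)
    (f := fun t => F t ^ p) (g := fun _ => 1) (hF.restrict.pow_const p) aemeasurable_const
    (p := 1 / p) (q := 1 - 1 / p) (by positivity)
    (by rw [sub_nonneg, div_le_one hp0]; exact hp) (by ring)
  simp only [← ENNReal.rpow_mul, mul_one_div_cancel hp0.ne', ENNReal.rpow_one, ENNReal.one_rpow,
    mul_one, lintegral_one, Measure.restrict_apply_univ] at h
  exact h

/-- The exponent `τ` may be negative; the power is then largest on the shortest arc. A single `σ ≥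
0` above `τ` covers both signs. -/
lemma rpow_min_le {ℓ τ σ : ℝ} (h0 : 0 < ℓ) (h1 : ℓ ≤ 1) (hσ0 : 0 ≤ σ) (hτσ : τ ≤ σ) (k : ℕ) :
    min (2 ^ k * ℓ) 1 ^ τ ≤ ℓ ^ τ * ((2 : ℝ) ^ σ) ^ k := by
  have h2k : (1 : ℝ) ≤ 2 ^ k := one_le_pow₀ one_le_two
  have hd0 : 0 < min (2 ^ k * ℓ) 1 := lt_min (by positivity) one_pos
  have h2σ : (1 : ℝ) ≤ 2 ^ σ := Real.one_le_rpow one_le_two hσ0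
  rcases le_total 0 τ with hτ | hτ
  · calc _ ≤ (2 ^ k * ℓ) ^ τ := Real.rpow_le_rpow hd0.le (min_le_left _ _) hτ
      _ = ℓ ^ τ * ((2 : ℝ) ^ τ) ^ k := by
          rw [Real.mul_rpow (by positivity) h0.le, mul_comm, ← Real.rpow_natCast, ← Real.rpow_natCast,
            ← Real.rpow_mul (by norm_num), ← Real.rpow_mul (by norm_num), mul_comm (k : ℝ)]
      _ ≤ _ := by
          gcongr
          exact one_le_two
  · calc _ ≤ ℓ ^ τ := Real.rpow_le_rpow_of_nonpos h0 (le_min (by nlinarith) h1) hτ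
      _ ≤ ℓ ^ τ * ((2 : ℝ) ^ σ) ^ k := le_mul_of_one_le_right (by positivity) (one_le_pow₀ h2σ)

section

variable {p η : ℝ} {f : Torus → ℂ} {K : ℝ≥0∞}

/-- Hölder passes from the `p`-th power to the first; the exponent is `η/p + 1 - 1/p`. The minimum
with 1 occurs because `arc c x` is the whole circle once `x ≥ 1`. -/
lemma setLIntegral_oscillation_le (hp : 1 ≤ p) (hf : MemLp f (ENNReal.ofReal p) arcMeasure)
    (hK : ∀ (c : Torus) (ℓ : ℝ), 0 < ℓ → ℓ ≤ 1 →
      ∫⁻ t in arc c ℓ, ‖f t - mean f (arc c ℓ)‖ₑ ^ p ∂arcMeasure ≤ K * ENNReal.ofReal (ℓ ^ η))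
    (c : Torus) {x : ℝ} (hx : 0 < x) :
    ∫⁻ t in arc c x, ‖f t - mean f (arc c x)‖ₑ ∂arcMeasure ≤
      K ^ (1 / p) * ENNReal.ofReal (min x 1 ^ (1 + (η - 1) / p)) := by
  have hp0 : 0 < p := by linarith
  set d := min x 1 with hd
  have hd0 : 0 < d := lt_min hx one_pos
  have hθ : 0 ≤ 1 - 1 / p := by rw [sub_nonneg, div_le_one hp0]; exact hp
  rw [← arc_min_one, ← hd]
  refine (setLIntegral_le_holder hp
    (hf.aestronglyMeasurable.sub aestronglyMeasurable_const).enorm _).trans ?_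
  refine (mul_le_mul_left (ENNReal.rpow_le_rpow (hK c d hd0 (min_le_right _ _)) (by positivity))
    _).trans_eq ?_
  rw [arcMeasure_arc, min_eq_left (min_le_right _ _), ENNReal.mul_rpow_of_nonneg _ _ (by positivity),
    ENNReal.ofReal_rpow_of_pos (by positivity), ENNReal.ofReal_rpow_of_pos hd0, mul_assoc,
    ← ENNReal.ofReal_mul (by positivity), ← Real.rpow_mul hd0.le, ← Real.rpow_add hd0]
  congr 3
  field_simp
  ring

/-- Average over the smaller arc the deviation of `f` from its mean over the larger one; passing to
the larger arc costs the ratio of lengths, at most 2. -/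
lemma enorm_mean_succ_sub_le (hp : 1 ≤ p) (hf : MemLp f (ENNReal.ofReal p) arcMeasure)
    (hK : ∀ (c : Torus) (ℓ : ℝ), 0 < ℓ → ℓ ≤ 1 →
      ∫⁻ t in arc c ℓ, ‖f t - mean f (arc c ℓ)‖ₑ ^ p ∂arcMeasure ≤ K * ENNReal.ofReal (ℓ ^ η))
    {σ : ℝ} (hσ0 : 0 ≤ σ) (hτσ : (η - 1) / p ≤ σ) (c : Torus) {ℓ : ℝ} (h0 : 0 < ℓ) (h1 : ℓ ≤ 1)
    (k : ℕ) :
    ‖mean f (arc c (2 ^ (k + 1) * ℓ)) - mean f (arc c (2 ^ k * ℓ))‖ₑ ≤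
      K ^ (1 / p) * ENNReal.ofReal (2 * (ℓ ^ ((η - 1) / p) * ((2 : ℝ) ^ σ) ^ (k + 1))) := by
  have hfi := MemLp.integrable_arc hp hf
  set d := min (2 ^ k * ℓ) 1 with hd
  set e := min (2 ^ (k + 1) * ℓ) 1 with he
  set τ := (η - 1) / p with hτ
  have hd0 : 0 < d := lt_min (by positivity) one_pos
  have he0 : 0 < e := lt_min (by positivity) one_pos
  have hed : e ≤ 2 * d := by
    rw [hd, mul_min_of_nonneg _ _ (by norm_num : (0 : ℝ) ≤ 2), he]
    refine min_le_min (le_of_eq ?_) (by norm_num)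
    ring
  rw [enorm_sub_rev]
  have hB : arcMeasure (arc c (2 ^ k * ℓ)) ≠ 0 := by
    rw [arcMeasure_arc, ← hd]; exact (ENNReal.ofReal_pos.2 hd0).ne'
  refine (enorm_mean_sub_le hfi hB _).trans ?_
  have hsub : arc c (2 ^ k * ℓ) ⊆ arc c (2 ^ (k + 1) * ℓ) := arc_mono c (by
    rw [pow_succ]; nlinarith [pow_pos (two_pos : (0 : ℝ) < 2) k])
  refine (mul_le_mul_right ((lintegral_mono_set hsub).trans
    (setLIntegral_oscillation_le hp hf hK c (by positivity))) _).trans ?_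
  rw [arcMeasure_arc, ← hd, ← he, ← hτ, mul_left_comm, ← ENNReal.ofReal_inv_of_pos hd0,
    ← ENNReal.ofReal_mul (by positivity)]
  refine mul_le_mul_right (ENNReal.ofReal_le_ofReal ?_) _
  rw [Real.rpow_add he0, Real.rpow_one]
  have h3 : d⁻¹ * e ≤ 2 := by rw [inv_mul_le_iff₀ hd0]; linarith
  have h4 := rpow_min_le h0 h1 hσ0 hτσ (k + 1)
  rw [← he] at h4
  calc d⁻¹ * (e * e ^ τ) = (d⁻¹ * e) * e ^ τ := by ring
    _ ≤ _ := mul_le_mul h3 h4 (by positivity) (by norm_num)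

/-- Telescoping over successive doublings. Every step is bounded by the last one, whence the factor
`k`; this treats `σ = 0`, where the steps need not grow, together with `σ > 0`. -/
lemma enorm_mean_sub_mean_le (hp : 1 ≤ p) (hf : MemLp f (ENNReal.ofReal p) arcMeasure)
    (hK : ∀ (c : Torus) (ℓ : ℝ), 0 < ℓ → ℓ ≤ 1 →
      ∫⁻ t in arc c ℓ, ‖f t - mean f (arc c ℓ)‖ₑ ^ p ∂arcMeasure ≤ K * ENNReal.ofReal (ℓ ^ η))
    {σ : ℝ} (hσ0 : 0 ≤ σ) (hτσ : (η - 1) / p ≤ σ) (c : Torus) {ℓ : ℝ} (h0 : 0 < ℓ) (h1 : ℓ ≤ 1)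
    (k : ℕ) :
    ‖mean f (arc c (2 ^ (k + 1) * ℓ)) - mean f (arc c (2 * ℓ))‖ₑ ≤
      K ^ (1 / p) * ENNReal.ofReal (2 * k * (ℓ ^ ((η - 1) / p) * ((2 : ℝ) ^ σ) ^ (k + 1))) := by
  have h2σ : (1 : ℝ) ≤ 2 ^ σ := Real.one_le_rpow one_le_two hσ0
  induction k with
  | zero => simp
  | succ k ih =>
    have e : mean f (arc c (2 ^ (k + 1 + 1) * ℓ)) - mean f (arc c (2 * ℓ)) =
        (mean f (arc c (2 ^ (k + 1 + 1) * ℓ)) - mean f (arc c (2 ^ (k + 1) * ℓ))) +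
        (mean f (arc c (2 ^ (k + 1) * ℓ)) - mean f (arc c (2 * ℓ))) := by ring
    rw [e]
    refine (enorm_add_le _ _).trans ((add_le_add
      (enorm_mean_succ_sub_le hp hf hK hσ0 hτσ c h0 h1 (k + 1)) ih).trans ?_)
    rw [← mul_add, ← ENNReal.ofReal_add (by positivity) (by positivity)]
    refine mul_le_mul_right (ENNReal.ofReal_le_ofReal ?_) _
    have h3 : ((2 : ℝ) ^ σ) ^ (k + 1) ≤ ((2 : ℝ) ^ σ) ^ (k + 1 + 1) :=
      pow_le_pow_right₀ h2σ (by omega)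
    have h4 : ℓ ^ ((η - 1) / p) * ((2 : ℝ) ^ σ) ^ (k + 1) ≤
        ℓ ^ ((η - 1) / p) * ((2 : ℝ) ^ σ) ^ (k + 1 + 1) := by gcongr
    push_cast
    nlinarith [mul_le_mul_of_nonneg_left h4 (Nat.cast_nonneg (α := ℝ) k)]

lemma setLIntegral_sub_mean_le (hp : 1 ≤ p) (hf : MemLp f (ENNReal.ofReal p) arcMeasure)
    (hK : ∀ (c : Torus) (ℓ : ℝ), 0 < ℓ → ℓ ≤ 1 →
      ∫⁻ t in arc c ℓ, ‖f t - mean f (arc c ℓ)‖ₑ ^ p ∂arcMeasure ≤ K * ENNReal.ofReal (ℓ ^ η))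
    {σ : ℝ} (hσ0 : 0 ≤ σ) (hτσ : (η - 1) / p ≤ σ) (c : Torus) {ℓ : ℝ} (h0 : 0 < ℓ) (h1 : ℓ ≤ 1)
    (k : ℕ) :
    ∫⁻ t in arc c (2 ^ (k + 1) * ℓ), ‖f t - mean f (arc c (2 * ℓ))‖ₑ ∂arcMeasure ≤
      K ^ (1 / p) * ENNReal.ofReal ((1 + 2 * k) *
        (2 ^ (k + 1) * ℓ * (ℓ ^ ((η - 1) / p) * ((2 : ℝ) ^ σ) ^ (k + 1)))) := by
  set τ := (η - 1) / p with hτ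
  set d := min (2 ^ (k + 1) * ℓ) 1 with hd
  have hd0 : 0 < d := lt_min (by positivity) one_pos
  set m := mean f (arc c (2 ^ (k + 1) * ℓ)) with hm
  calc _ ≤ ∫⁻ t in arc c (2 ^ (k + 1) * ℓ), (‖f t - m‖ₑ + ‖m - mean f (arc c (2 * ℓ))‖ₑ)
        ∂arcMeasure := by
        refine lintegral_mono fun t => ?_
        have : f t - mean f (arc c (2 * ℓ)) = (f t - m) + (m - mean f (arc c (2 * ℓ))) := by ring
        rw [this]
        exact enorm_add_le _ _
    _ = (∫⁻ t in arc c (2 ^ (k + 1) * ℓ), ‖f t - m‖ₑ ∂arcMeasure) +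
        ‖m - mean f (arc c (2 * ℓ))‖ₑ * ENNReal.ofReal d := by
        rw [lintegral_add_right _ measurable_const, setLIntegral_const, arcMeasure_arc]
    _ ≤ K ^ (1 / p) * ENNReal.ofReal (d ^ (1 + τ)) + K ^ (1 / p) *
        ENNReal.ofReal (2 * k * (ℓ ^ τ * ((2 : ℝ) ^ σ) ^ (k + 1))) * ENNReal.ofReal d :=
        add_le_add (setLIntegral_oscillation_le hp hf hK c (by positivity))
          (mul_le_mul_left (enorm_mean_sub_mean_le hp hf hK hσ0 hτσ c h0 h1 k) _)
    _ = K ^ (1 / p) * ENNReal.ofReal (d ^ (1 + τ) + 2 * k * (ℓ ^ τ * ((2 : ℝ) ^ σ) ^ (k + 1)) * d) := by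
        rw [mul_assoc, ← mul_add, ← ENNReal.ofReal_mul (by positivity),
          ← ENNReal.ofReal_add (by positivity) (by positivity)]
    _ ≤ _ := by
        refine mul_le_mul_right (ENNReal.ofReal_le_ofReal ?_) _
        have h4 := rpow_min_le h0 h1 hσ0 hτσ (k + 1)
        rw [← hd] at h4
        have h5 : d ≤ 2 ^ (k + 1) * ℓ := min_le_left _ _
        rw [Real.rpow_add hd0, Real.rpow_one]
        set E := ℓ ^ τ * ((2 : ℝ) ^ σ) ^ (k + 1) with hE
        have hE0 : 0 ≤ E := by positivity
        calc d * d ^ τ + 2 * k * E * d ≤ d * E + 2 * k * E * d := by gcongr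
          _ = (1 + 2 * k) * (d * E) := by ring
          _ ≤ _ := by gcongr

end

/-! ### From the Campanato bound to the Littlewood–Paley bound. -/

lemma gradNormSq_poissonExtension_sub_const {f : Torus → ℂ} (hf : Integrable f arcMeasure) (a : ℂ)
    {z : ℂ} (hz : ‖z‖ < 1) :
    gradNormSq (poissonExtension fun t => f t - a) z = gradNormSq (poissonExtension f) z := by
  have h : poissonExtension (fun t => f t - a) =ᶠ[nhds z] fun w => poissonExtension f w - a := by
    have : Metric.ball (0 : ℂ) 1 ∈ nhds z := Metric.isOpen_ball.mem_nhds (by simpa using hz)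
    filter_upwards [this] with w hw
    have hw1 : ‖w‖ < 1 := by simpa using hw
    rw [poissonExtension_sub hf (integrable_const a) hw1, poissonExtension_const a hw1]
  unfold gradNormSq
  rw [h.fderiv_eq, fderiv_sub_const]

lemma anaDeriv_add {f g : Torus → ℂ} (hf : Integrable f arcMeasure) (hg : Integrable g arcMeasure)
    {z : ℂ} (hz : ‖z‖ < 1) :
    anaDeriv (fun t => f t + g t) z = anaDeriv f z + anaDeriv g z := by
  unfold anaDeriv cauchyDeriv
  rw [← integral_add (integrable_mul_cauchyDeriv_kernel measurable_cpoint norm_cpoint hf hz)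
    (integrable_mul_cauchyDeriv_kernel measurable_cpoint norm_cpoint hg hz)]
  simp_rw [add_mul]

lemma enorm_add_sq_le (a b : ℂ) : ‖a + b‖ₑ ^ 2 ≤ 2 * (‖a‖ₑ ^ 2 + ‖b‖ₑ ^ 2) := by
  have h := (pow_le_pow_left₀ zero_le (enorm_add_le a b) 2).trans
    (le_of_eq (ENNReal.rpow_two _).symm)
  refine h.trans ((ENNReal.rpow_add_le_mul_rpow_add_rpow ‖a‖ₑ ‖b‖ₑ one_le_two).trans_eq ?_)
  norm_num

lemma energy_add_le {f g : Torus → ℂ} (hf : Integrable f arcMeasure) (hg : Integrable g arcMeasure)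
    {z : ℂ} (hz : ‖z‖ < 1) :
    energy (fun t => f t + g t) z ≤ 2 * energy f z + 2 * energy g z := by
  have hfg : Integrable (fun t => f t + g t) arcMeasure := hf.add hg
  rw [energy_eq hfg hz, energy_eq hf hz, energy_eq hg hz, anaDeriv_add hf hg hz]
  simp_rw [map_add]
  rw [anaDeriv_add (integrable_conj hf) (integrable_conj hg) hz]
  calc _ ≤ 2 * (2 * (‖anaDeriv f z‖ₑ ^ 2 + ‖anaDeriv g z‖ₑ ^ 2) +
        2 * (‖anaDeriv (fun t => (starRingEnd ℂ) (f t)) z‖ₑ ^ 2 +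
          ‖anaDeriv (fun t => (starRingEnd ℂ) (g t)) z‖ₑ ^ 2)) :=
        mul_le_mul_right (add_le_add (enorm_add_sq_le _ _) (enorm_add_sq_le _ _)) _
    _ = _ := by ring

/-- At scale `2^k ℓ` the kernel has size `(2^k ℓ)⁻²`, and the integral of the oscillation is at most
a multiple of `(1 + 2k) 2^k ℓ · ℓ^τ 2^(σk)`, with `τ = (η - 1)/p` and `σ = max τ 0`. The terms are
`ℓ^(τ-1) (1 + 2k) (2^σ/2)^k`, and `σ < 1` is where `η < 1 + p` enters. -/
lemma exists_lintegral_far_le {p η : ℝ} (hp : 1 ≤ p) (hηp : η < 1 + p) :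
    ∃ C : ℝ≥0∞, C ≠ ∞ ∧ ∀ (f : Torus → ℂ) (K : ℝ≥0∞), MemLp f (ENNReal.ofReal p) arcMeasure →
      (∀ (c : Torus) (ℓ : ℝ), 0 < ℓ → ℓ ≤ 1 →
        ∫⁻ t in arc c ℓ, ‖f t - mean f (arc c ℓ)‖ₑ ^ p ∂arcMeasure ≤ K * ENNReal.ofReal (ℓ ^ η)) →
      ∀ (c : Torus) (ℓ : ℝ), 0 < ℓ → ℓ ≤ 1 → ∀ t ∈ arc c ℓ, ∀ r ∈ Ico (0 : ℝ) 1,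
        ∫⁻ s, ‖(arc c (2 * ℓ))ᶜ.indicator (fun s => f s - mean f (arc c (2 * ℓ))) s‖ₑ *
          ENNReal.ofReal (1 / ‖point s - r * point t‖ ^ 2) ∂arcMeasure ≤
            C * (K ^ (1 / p) * ENNReal.ofReal (ℓ ^ ((η - 1) / p - 1))) := by
  have hp0 : 0 < p := by linarith
  have hπ := Real.pi_pos
  set τ := (η - 1) / p with hτ
  set σ := max τ 0 with hσ
  have hσ0 : 0 ≤ σ := le_max_right _ _
  have hσ1 : σ < 1 := max_lt (by rw [hτ, div_lt_one hp0]; linarith) one_pos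
  set ρ : ℝ := 2 ^ σ / 2 with hρ
  have hρ0 : 0 < ρ := by positivity
  have hρ1 : ρ < 1 := by
    rw [hρ, div_lt_one two_pos]
    calc (2 : ℝ) ^ σ < 2 ^ (1 : ℝ) := Real.rpow_lt_rpow_of_exponent_lt one_lt_two hσ1
      _ = 2 := Real.rpow_one 2
  have hsum : Summable fun k : ℕ => 32 * 2 ^ σ * ((1 + 2 * (k : ℝ)) * ρ ^ k) := by
    refine Summable.mul_left _ ?_
    have s1 := summable_geometric_of_lt_one hρ0.le hρ1
    have s2 := summable_pow_mul_geometric_of_norm_lt_one 1 (r := ρ)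
      (by rw [Real.norm_of_nonneg hρ0.le]; exact hρ1)
    refine (s1.add (s2.mul_left 2)).congr fun k => ?_
    ring
  -- The constant collects the 16 of the kernel bound, the 2 in the length `2^(k+1) ℓ`, and one
  -- factor of `(2^σ)^(k+1)`.
  refine ⟨∑' k : ℕ, ENNReal.ofReal (32 * 2 ^ σ * ((1 + 2 * (k : ℝ)) * ρ ^ k)),
    hsum.tsum_ofReal_ne_top, ?_⟩
  intro f K hf hK c ℓ h0 h1 t ht r hr
  set m := mean f (arc c (2 * ℓ)) with hm
  have hfm : AEMeasurable (fun s => ‖f s - m‖ₑ) arcMeasure :=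
    (hf.aestronglyMeasurable.sub aestronglyMeasurable_const).enorm
  have hz := norm_mul_point_lt_one hr.1 hr.2 t
  calc _ ≤ ∫⁻ s, ∑' k : ℕ, ENNReal.ofReal (16 / (2 ^ k * ℓ) ^ 2) *
        (arc c (2 ^ (k + 1) * ℓ)).indicator (fun s => ‖f s - m‖ₑ) s ∂arcMeasure := by
        refine lintegral_mono fun s => ?_
        by_cases hs : s ∈ arc c (2 * ℓ)
        · rw [indicator_of_notMem (by simpa using hs)]
          simp
        rw [indicator_of_mem (by simpa using hs)]
        rw [mem_arc, not_le] at hs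
        rw [mem_arc] at ht
        obtain ⟨k, hk1, hk2⟩ := exists_dyadic_scale ‖s - c‖ (mul_pos hπ h0)
        refine le_trans ?_ (ENNReal.le_tsum k)
        have hmem : s ∈ arc c (2 ^ (k + 1) * ℓ) := by
          rw [mem_arc]
          refine hk1.trans ?_
          rw [pow_succ]
          have : 0 < 2 ^ k * (Real.pi * ℓ) := by positivity
          linarith
        rw [indicator_of_mem hmem, mul_comm]
        refine mul_le_mul_left (ENNReal.ofReal_le_ofReal ?_) _
        -- Here `s` is off the doubled arc and `t` in the arc, so `‖s - t‖ ≥ ‖s - c‖/2`, which is at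
        -- least `π 2^k ℓ/4`.
        rw [max_eq_left (by nlinarith)] at hk2
        have h3 := norm_sub_le_pi_mul hr.2 hr.1 s t
        have h4 : ‖s - c‖ ≤ ‖s - t‖ + ‖t - c‖ := norm_sub_le_norm_sub_add_norm_sub s t c
        have h5 : 2 ^ k * ℓ / 4 ≤ ‖point s - r * point t‖ := by
          have : Real.pi * (2 ^ k * ℓ / 4) ≤ Real.pi * ‖point s - r * point t‖ := by nlinarith
          exact le_of_mul_le_mul_left this hπ
        calc 1 / ‖point s - r * point t‖ ^ 2 ≤ 1 / (2 ^ k * ℓ / 4) ^ 2 := by gcongr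
          _ = 16 / (2 ^ k * ℓ) ^ 2 := by field_simp; norm_num
    _ = ∑' k : ℕ, ENNReal.ofReal (16 / (2 ^ k * ℓ) ^ 2) *
        ∫⁻ s in arc c (2 ^ (k + 1) * ℓ), ‖f s - m‖ₑ ∂arcMeasure := by
        rw [lintegral_tsum fun k => (hfm.indicator (measurableSet_arc _ _)).const_mul _]
        congr 1
        ext k
        rw [lintegral_const_mul' _ _ ENNReal.ofReal_ne_top, lintegral_indicator (measurableSet_arc _ _)]
    _ ≤ ∑' k : ℕ, ENNReal.ofReal (32 * 2 ^ σ * ((1 + 2 * (k : ℝ)) * ρ ^ k)) *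
        (K ^ (1 / p) * ENNReal.ofReal (ℓ ^ (τ - 1))) := by
        refine ENNReal.tsum_le_tsum fun k => ?_
        refine (mul_le_mul_right (setLIntegral_sub_mean_le hp hf hK hσ0 (le_max_left _ _) c h0 h1 k)
          _).trans_eq ?_
        rw [mul_left_comm, ← ENNReal.ofReal_mul (by positivity), mul_left_comm (ENNReal.ofReal _),
          ← ENNReal.ofReal_mul (by positivity), ← hτ]
        congr 2
        rw [Real.rpow_sub_one h0.ne', hρ, div_pow]
        field_simp
        ring
    _ = _ := ENNReal.tsum_mul_right

/-- A Campanato bound yields the Littlewood–Paley bound. -/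
theorem exists_setLIntegral_gsqTrunc_le {p η : ℝ} (hp : 1 < p) (hη : 0 < η) (hηp : η < 1 + p)
    {f : Torus → ℂ} (hf : MemLp f (ENNReal.ofReal p) arcMeasure) {K : ℝ≥0∞} (hKt : K ≠ ∞)
    (hK : ∀ (c : Torus) (ℓ : ℝ), 0 < ℓ → ℓ ≤ 1 →
      ∫⁻ t in arc c ℓ, ‖f t - mean f (arc c ℓ)‖ₑ ^ p ∂arcMeasure ≤ K * ENNReal.ofReal (ℓ ^ η)) :
    ∃ K' : ℝ≥0∞, K' ≠ ∞ ∧ ∀ (c : Torus) (ℓ : ℝ), 0 < ℓ → ℓ ≤ 1 →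
      ∫⁻ t in arc c ℓ, gsqTrunc f ℓ t ^ (p / 2) ∂arcMeasure ≤ K' * ENNReal.ofReal (ℓ ^ η) := by
  have hp0 : 0 < p := by linarith
  obtain ⟨C1, hC1t, hC1⟩ := exists_lintegral_gsq_rpow_le hp
  obtain ⟨C2, hC2t, hC2⟩ := exists_lintegral_far_le hp.le hηp
  have hfi := MemLp.integrable_arc hp.le hf
  set α : ℝ≥0∞ := 2 ^ (p / 2) with hα
  have hαt : α ≠ ∞ := ENNReal.rpow_ne_top_of_nonneg (by positivity) (by norm_num)
  set β : ℝ≥0∞ := 2 ^ η with hβ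
  have hβt : β ≠ ∞ := ENNReal.rpow_ne_top_of_nonneg hη.le (by norm_num)
  have hγt : (4 * C2) ^ p * K ≠ ∞ := ENNReal.mul_ne_top (ENNReal.rpow_ne_top_of_nonneg hp0.le
    (ENNReal.mul_ne_top (by norm_num) hC2t)) hKt
  refine ⟨α * (α * (C1 * (K * β)) + (4 * C2) ^ p * K), ?_, ?_⟩
  · exact ENNReal.mul_ne_top hαt (ENNReal.add_ne_top.2 ⟨ENNReal.mul_ne_top hαt
      (ENNReal.mul_ne_top hC1t (ENNReal.mul_ne_top hKt hβt)), hγt⟩)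
  intro c ℓ h0 h1
  -- Subtracting a constant leaves the gradient unchanged. Cutting at the doubled arc separates the
  -- support of `f2` from the arc on which the estimate is made.
  set m := mean f (arc c (2 * ℓ)) with hm
  set f1 := (arc c (2 * ℓ)).indicator fun s => f s - m with hf1
  set f2 := (arc c (2 * ℓ))ᶜ.indicator fun s => f s - m with hf2
  have hFp : MemLp (fun s => f s - m) (ENNReal.ofReal p) arcMeasure := hf.sub (memLp_const m)
  have hf1p : MemLp f1 (ENNReal.ofReal p) arcMeasure := hFp.indicator (measurableSet_arc _ _)
  have hf1i := MemLp.integrable_arc hp.le hf1p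
  have hf2i : Integrable f2 arcMeasure :=
    MemLp.integrable_arc hp.le (hFp.indicator (measurableSet_arc _ _).compl)
  have hsum : (fun s => f1 s + f2 s) = fun s => f s - m :=
    indicator_self_add_compl (arc c (2 * ℓ)) fun s => f s - m
  set V : ℝ≥0∞ := C2 * (K ^ (1 / p) * ENNReal.ofReal (ℓ ^ ((η - 1) / p - 1))) with hV
  have hpt : ∀ t ∈ arc c ℓ, gsqTrunc f ℓ t ≤ 2 * gsq f1 t +
      (4 * (V * ENNReal.ofReal ℓ)) ^ 2 := by
    intro t ht
    calc gsqTrunc f ℓ t ≤ ∫⁻ r in Ioo (1 - ℓ) 1, (2 * ENNReal.ofReal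
          (gradNormSq (poissonExtension f1) ((r : ℂ) * point t) * (1 - r ^ 2)) +
          16 * V ^ 2 * ENNReal.ofReal ℓ) := by
          refine setLIntegral_mono' measurableSet_Ioo fun r hr => ?_
          have hr0 : 0 < r := by linarith [hr.1]
          have hr1 := hr.2
          have hz := norm_mul_point_lt ⟨hr0, hr1⟩ t
          rw [← gradNormSq_poissonExtension_sub_const hfi m hz, ← hsum,
            ENNReal.ofReal_mul (gradNormSq_nonneg _ _), ENNReal.ofReal_mul (gradNormSq_nonneg _ _)]
          have e1 := energy_add_le hf1i hf2i hz
          have e2 : energy f2 (r * point t) ≤ 4 * V ^ 2 :=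
            (energy_le_lintegral hf2i hz).trans (mul_le_mul_right (pow_le_pow_left₀ zero_le
              (hC2 f K hf hK c ℓ h0 h1 t ht r ⟨hr0.le, hr1⟩) 2) _)
          change energy (fun s => f1 s + f2 s) _ * _ ≤ 2 * (energy f1 _ * _) + _
          have e3 : ENNReal.ofReal (1 - r ^ 2) ≤ 2 * ENNReal.ofReal ℓ := by
            rw [show (2 : ℝ≥0∞) = ENNReal.ofReal 2 by norm_num, ← ENNReal.ofReal_mul (by norm_num)]
            refine ENNReal.ofReal_le_ofReal ?_
            nlinarith [hr.1]
          calc _ ≤ (2 * energy f1 (r * point t) + 2 * (4 * V ^ 2)) * ENNReal.ofReal (1 - r ^ 2) := by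
                refine mul_le_mul_left (e1.trans (add_le_add le_rfl (mul_le_mul_right e2 _))) _
            _ = 2 * (energy f1 (r * point t) * ENNReal.ofReal (1 - r ^ 2)) +
                2 * (4 * V ^ 2) * ENNReal.ofReal (1 - r ^ 2) := by ring
            _ ≤ 2 * (energy f1 (r * point t) * ENNReal.ofReal (1 - r ^ 2)) +
                2 * (4 * V ^ 2) * (2 * ENNReal.ofReal ℓ) := add_le_add le_rfl (mul_le_mul_right e3 _)
            _ = _ := by ring
      _ = 2 * gsqTrunc f1 ℓ t + 16 * V ^ 2 * ENNReal.ofReal ℓ * ENNReal.ofReal ℓ := by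
          rw [lintegral_add_right _ measurable_const, lintegral_const_mul' _ _ (by norm_num),
            setLIntegral_const, Real.volume_Ioo, sub_sub_cancel, gsqTrunc]
      _ ≤ 2 * gsq f1 t + 16 * V ^ 2 * ENNReal.ofReal ℓ * ENNReal.ofReal ℓ := by
          refine add_le_add (mul_le_mul_right (lintegral_mono_set ?_) _) le_rfl
          exact Ioo_subset_Ioo_left (by linarith)
      _ = _ := by ring
  have hf1int : ∫⁻ t, ‖f1 t‖ₑ ^ p ∂arcMeasure ≤ K * β * ENNReal.ofReal (ℓ ^ η) := by
    have e : ∀ t, ‖f1 t‖ₑ ^ p = (arc c (2 * ℓ)).indicator (fun t => ‖f t - m‖ₑ ^ p) t := by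
      intro t
      by_cases ht : t ∈ arc c (2 * ℓ)
      · rw [hf1, indicator_of_mem ht, indicator_of_mem ht]
      · rw [hf1, indicator_of_notMem ht, indicator_of_notMem ht, enorm_zero,
          ENNReal.zero_rpow_of_pos hp0]
    simp_rw [e]
    rw [lintegral_indicator (measurableSet_arc _ _)]
    have hd0 : 0 < min (2 * ℓ) 1 := lt_min (by linarith) one_pos
    have h2 := hK c (min (2 * ℓ) 1) hd0 (min_le_right _ _)
    rw [arc_min_one] at h2
    refine h2.trans ?_
    rw [mul_assoc]
    refine mul_le_mul_right ?_ _
    rw [hβ, show (2 : ℝ≥0∞) = ENNReal.ofReal 2 by norm_num, ENNReal.ofReal_rpow_of_pos two_pos,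
      ← ENNReal.ofReal_mul (by positivity), ← Real.mul_rpow (by norm_num) h0.le]
    exact ENNReal.ofReal_le_ofReal (Real.rpow_le_rpow hd0.le (min_le_left _ _) hη.le)
  -- The far part is constant on the arc; its `p`-th power scales as `ℓ^(η-1)`, and the length of
  -- the arc supplies the missing factor `ℓ`.
  have hVℓ : (4 * (V * ENNReal.ofReal ℓ)) ^ p * ENNReal.ofReal ℓ =
      (4 * C2) ^ p * K * ENNReal.ofReal (ℓ ^ η) := by
    have e : 4 * (V * ENNReal.ofReal ℓ) =
        4 * C2 * (K ^ (1 / p) * ENNReal.ofReal (ℓ ^ ((η - 1) / p))) := by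
      have : ENNReal.ofReal (ℓ ^ ((η - 1) / p)) =
          ENNReal.ofReal (ℓ ^ ((η - 1) / p - 1)) * ENNReal.ofReal ℓ := by
        rw [← ENNReal.ofReal_mul (by positivity), Real.rpow_sub_one h0.ne', div_mul_cancel₀ _ h0.ne']
      rw [hV, this]; ring
    rw [e, ENNReal.mul_rpow_of_nonneg _ _ hp0.le, ENNReal.mul_rpow_of_nonneg (K ^ (1 / p)) _ hp0.le,
      ← ENNReal.rpow_mul, one_div_mul_cancel hp0.ne', ENNReal.rpow_one,
      ENNReal.ofReal_rpow_of_pos (by positivity), ← Real.rpow_mul h0.le, div_mul_cancel₀ _ hp0.ne',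
      mul_assoc, mul_assoc, mul_assoc, ← ENNReal.ofReal_mul (by positivity),
      Real.rpow_sub_one h0.ne', div_mul_cancel₀ _ h0.ne']
  -- The power is subadditive if `p/2 ≤ 1` and convex otherwise; the constant `2^(p/2)` serves in
  -- both cases.
  have hadd : ∀ x y : ℝ≥0∞, (x + y) ^ (p / 2) ≤ α * (x ^ (p / 2) + y ^ (p / 2)) := by
    intro x y
    rcases le_total (p / 2) 1 with h | h
    · refine (ENNReal.rpow_add_le_add_rpow _ _ (by positivity) h).trans ?_
      refine le_mul_of_one_le_left zero_le (ENNReal.one_le_rpow one_le_two (by positivity))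
    · refine (ENNReal.rpow_add_le_mul_rpow_add_rpow _ _ h).trans (mul_le_mul_left ?_ _)
      exact ENNReal.rpow_le_rpow_of_exponent_le one_le_two (by linarith)
  calc ∫⁻ t in arc c ℓ, gsqTrunc f ℓ t ^ (p / 2) ∂arcMeasure
      ≤ ∫⁻ t in arc c ℓ, α * (α * gsq f1 t ^ (p / 2) + (4 * (V * ENNReal.ofReal ℓ)) ^ p)
          ∂arcMeasure := by
        refine setLIntegral_mono' (measurableSet_arc _ _) fun t ht => ?_
        refine (ENNReal.rpow_le_rpow (hpt t ht) (by positivity)).trans ((hadd _ _).trans_eq ?_)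
        rw [ENNReal.mul_rpow_of_nonneg _ _ (by positivity), ← ENNReal.rpow_two, ← ENNReal.rpow_mul,
          mul_div_cancel₀ _ two_ne_zero]
    _ = α * (α * (∫⁻ t in arc c ℓ, gsq f1 t ^ (p / 2) ∂arcMeasure) +
          (4 * C2) ^ p * K * ENNReal.ofReal (ℓ ^ η)) := by
        rw [lintegral_const_mul' _ _ hαt, lintegral_add_right _ measurable_const,
          lintegral_const_mul' _ _ hαt, setLIntegral_const, arcMeasure_arc, min_eq_left h1, hVℓ]
    _ ≤ α * (α * (C1 * (K * β * ENNReal.ofReal (ℓ ^ η))) +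
          (4 * C2) ^ p * K * ENNReal.ofReal (ℓ ^ η)) := by
        refine mul_le_mul_right (add_le_add (mul_le_mul_right ?_ _) le_rfl) _
        exact (setLIntegral_le_lintegral _ _).trans ((hC1 f1 hf1p).trans (mul_le_mul_right hf1int _))
    _ = _ := by ring

/-! ### From the Littlewood–Paley bound to the Campanato bound. -/

lemma anaDeriv_kernel_eq {z : ℂ} (hz : ‖z‖ < 1) (s : Torus) :
    cpoint s / (1 - z * cpoint s) ^ 2 = point s / (point s - z) ^ 2 := by
  have h0 := point_ne_zero s
  have h1 : point s - z ≠ 0 := norm_pos_iff.1 (norm_point_sub_pos hz s)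
  have h2 : cpoint s = (point s)⁻¹ := eq_inv_of_mul_eq_one_right (point_mul_conj s)
  have h3 : 1 - z * (point s)⁻¹ = (point s - z) / point s := by field_simp
  rw [h2, h3]
  field_simp

/-- The kernel is of order `x⁻²`, so its variation is of order `x⁻³` per unit of angle. An explicit
factorization of the difference yields this with the constant 6. -/
lemma norm_anaDeriv_kernel_sub_le {z : ℂ} (hz : ‖z‖ < 1) (s c : Torus) {x : ℝ} (hx : 0 < x)
    (h1 : x ≤ ‖point c - z‖) (h2 : x / 2 ≤ ‖point s - z‖) :
    ‖cpoint s / (1 - z * cpoint s) ^ 2 - cpoint c / (1 - z * cpoint c) ^ 2‖ ≤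
      6 * ‖s - c‖ / x ^ 3 := by
  rw [anaDeriv_kernel_eq hz, anaDeriv_kernel_eq hz]
  have n1 : point s - z ≠ 0 := norm_pos_iff.1 (norm_point_sub_pos hz s)
  have n2 : point c - z ≠ 0 := norm_pos_iff.1 (norm_point_sub_pos hz c)
  have e : point s / (point s - z) ^ 2 - point c / (point c - z) ^ 2 =
      -((point s - point c) * (z * (point c - z) + point c * (point s - z))) /
        ((point s - z) ^ 2 * (point c - z) ^ 2) := by
    field_simp
    ring
  rw [e, norm_div, norm_neg, norm_mul, norm_mul, norm_pow, norm_pow]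
  set A := ‖point s - z‖ with hA
  set B := ‖point c - z‖ with hB
  have hA0 : 0 < A := norm_point_sub_pos hz s
  have hB0 : 0 < B := norm_point_sub_pos hz c
  have hnum : ‖z * (point c - z) + point c * (point s - z)‖ ≤ B + A := by
    refine (norm_add_le _ _).trans ?_
    rw [norm_mul, norm_mul, norm_point, one_mul]
    nlinarith
  have hch := chord_le_norm_sub s c
  calc _ ≤ ‖s - c‖ * (B + A) / (A ^ 2 * B ^ 2) := by gcongr
    _ = ‖s - c‖ * (1 / (A ^ 2 * B) + 1 / (A * B ^ 2)) := by field_simp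
    _ ≤ ‖s - c‖ * (1 / ((x / 2) ^ 2 * x) + 1 / (x / 2 * x ^ 2)) := by gcongr
    _ = _ := by field_simp; ring

/-- Mean zero permits subtracting the value of the kernel at the centre `c`. On the support of `h`
the difference is at most `6πℓ/x³`, where `x` measures how far `r * point t` is from the arc. -/
lemma enorm_anaDeriv_le_of_integral_eq_zero {h : Torus → ℂ} (hh : Integrable h arcMeasure)
    (h0 : ∫ t, h t ∂arcMeasure = 0) {c : Torus} {ℓ : ℝ} (hℓ : 0 < ℓ)
    (hsupp : ∀ s, s ∉ arc c ℓ → h s = 0) {r : ℝ} (hr : r ∈ Ioo (0 : ℝ) 1) (t : Torus)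
    (hx : 2 * ℓ ≤ max (‖t - c‖ / Real.pi) (1 - r)) :
    ‖anaDeriv h (r * point t)‖ₑ ≤
      ENNReal.ofReal (6 * (Real.pi * ℓ) / max (‖t - c‖ / Real.pi) (1 - r) ^ 3) *
        ∫⁻ s, ‖h s‖ₑ ∂arcMeasure := by
  set x := max (‖t - c‖ / Real.pi) (1 - r) with hxdef
  have hπ := Real.pi_pos
  have hx0 : 0 < x := by linarith
  have hz := norm_mul_point_lt hr t
  have hlow : ∀ s, max (‖s - t‖ / Real.pi) (1 - r) ≤ ‖point s - r * point t‖ := by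
    intro s
    refine max_le ?_ ?_
    · rw [div_le_iff₀ hπ]
      exact (norm_sub_le_pi_mul hr.2 hr.1.le s t).trans_eq (mul_comm _ _)
    · have := one_sub_norm_le (r * point t) s
      rwa [norm_mul_point, abs_of_pos hr.1] at this
  have e : anaDeriv h (r * point t) = ∫ s, h s * (cpoint s / (1 - r * point t * cpoint s) ^ 2 -
      cpoint c / (1 - r * point t * cpoint c) ^ 2) ∂arcMeasure := by
    simp_rw [mul_sub]
    rw [integral_sub (integrable_mul_cauchyDeriv_kernel measurable_cpoint norm_cpoint hh hz)
      (hh.mul_const _), integral_mul_const, h0, zero_mul, sub_zero]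
    rfl
  rw [e, ← lintegral_const_mul' _ _ ENNReal.ofReal_ne_top]
  refine (enorm_integral_le_lintegral_enorm _).trans (lintegral_mono fun s => ?_)
  by_cases hs : s ∈ arc c ℓ
  · rw [enorm_mul, mul_comm]
    refine mul_le_mul_left ?_ _
    rw [← ofReal_norm]
    refine ENNReal.ofReal_le_ofReal ?_
    rw [mem_arc] at hs
    refine (norm_anaDeriv_kernel_sub_le hz s c hx0 ?_ ?_).trans ?_
    · rw [hxdef, norm_sub_rev]; exact hlow c
    · refine le_trans ?_ (hlow s)
      -- If the angular distance realizes `x`, the radius `πℓ ≤ πx/2` of the arc leaves at least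
      -- half of it for `s`; otherwise the radial distance `1 - r` suffices.
      rcases max_choice (‖t - c‖ / Real.pi) (1 - r) with h | h
      · refine le_trans ?_ (le_max_left _ _)
        rw [← hxdef] at h
        have h3 : ‖t - c‖ = Real.pi * x := by rw [h]; field_simp
        have h4 : ‖t - c‖ ≤ ‖s - t‖ + ‖s - c‖ := by
          rw [norm_sub_rev s t]; exact norm_sub_le_norm_sub_add_norm_sub t s c
        rw [le_div_iff₀ hπ]
        nlinarith
      · refine le_trans ?_ (le_max_right _ _)
        rw [← hxdef] at h
        linarith
    · gcongr
  · rw [hsupp s hs]; simp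

/-- The duality map of `L^p`, up to normalization. -/
def dualFun (p : ℝ) (w : ℂ) : ℂ := ((‖w‖ ^ (p - 2) : ℝ) : ℂ) * (starRingEnd ℂ) w

lemma measurable_dualFun (p : ℝ) : Measurable (dualFun p) :=
  (Complex.measurable_ofReal.comp (measurable_norm.pow_const _)).mul Complex.continuous_conj.measurable

lemma mul_dualFun {p : ℝ} (hp : 1 < p) (w : ℂ) : w * dualFun p w = ((‖w‖ ^ p : ℝ) : ℂ) := by
  unfold dualFun
  rcases eq_or_ne w 0 with rfl | hw
  · simp [Real.zero_rpow (by linarith : p ≠ 0)]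
  · rw [mul_left_comm, Complex.mul_conj, Complex.normSq_eq_norm_sq, ← Complex.ofReal_mul]
    congr 1
    rw [← Real.rpow_natCast, ← Real.rpow_add (norm_pos_iff.2 hw)]
    congr 1; push_cast; ring

lemma enorm_dualFun_rpow {p q : ℝ} (hpq : p.HolderConjugate q) (w : ℂ) :
    ‖dualFun p w‖ₑ ^ q = ‖w‖ₑ ^ p := by
  unfold dualFun
  rcases eq_or_ne w 0 with rfl | hw
  · simp [ENNReal.zero_rpow_of_pos hpq.pos, ENNReal.zero_rpow_of_pos hpq.symm.pos]
  · have hw0 : 0 < ‖w‖ := norm_pos_iff.2 hw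
    have e : ‖((‖w‖ ^ (p - 2) : ℝ) : ℂ) * (starRingEnd ℂ) w‖ = ‖w‖ ^ (p - 1) := by
      rw [norm_mul, RCLike.norm_conj, Complex.norm_real, Real.norm_of_nonneg (by positivity)]
      rw [← Real.rpow_add_one hw0.ne']
      congr 1; ring
    rw [← ofReal_norm, e, ← ofReal_norm, ENNReal.ofReal_rpow_of_pos (by positivity),
      ENNReal.ofReal_rpow_of_pos hw0, ← Real.rpow_mul hw0.le, hpq.sub_one_mul_conj]

/-- A mean-zero function on an arc that norms the oscillation of `f`. -/
lemma exists_dual_of_oscillation {p q : ℝ} (hpq : p.HolderConjugate q) {f : Torus → ℂ}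
    (hf : MemLp f (ENNReal.ofReal p) arcMeasure) (c : Torus) {ℓ : ℝ} (h0 : 0 < ℓ) (h1 : ℓ ≤ 1) :
    ∃ h : Torus → ℂ, MemLp h (ENNReal.ofReal q) arcMeasure ∧ ∫ t, h t ∂arcMeasure = 0 ∧
      (∀ s, s ∉ arc c ℓ → h s = 0) ∧
      ∫⁻ t, ‖h t‖ₑ ^ q ∂arcMeasure ≤
        2 ^ q * ∫⁻ t in arc c ℓ, ‖f t - mean f (arc c ℓ)‖ₑ ^ p ∂arcMeasure ∧
      ‖∫ t, f t * h t ∂arcMeasure‖ₑ =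
        ∫⁻ t in arc c ℓ, ‖f t - mean f (arc c ℓ)‖ₑ ^ p ∂arcMeasure := by
  have hp1 := hpq.lt
  have hq1 := hpq.symm.lt
  have hp0 := hpq.pos
  have hq0 := hpq.symm.pos
  set B := arc c ℓ with hB
  have hBm : MeasurableSet B := measurableSet_arc c ℓ
  have hBμ : arcMeasure B = ENNReal.ofReal ℓ := by rw [hB, arcMeasure_arc, min_eq_left h1]
  have hBR : arcMeasure.real B = ℓ := arcLength_arc c h0.le h1
  set m := mean f B with hm
  have hfi := MemLp.integrable_arc hp1.le hf
  set F : Torus → ℂ := fun t => f t - m with hF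
  have hFp : MemLp F (ENNReal.ofReal p) arcMeasure := hf.sub (memLp_const m)
  have hFi := MemLp.integrable_arc hp1.le hFp
  set S := ∫⁻ t in B, ‖F t‖ₑ ^ p ∂arcMeasure with hS
  have hSt : S ≠ ∞ := ne_top_of_le_ne_top (lintegral_enorm_rpow_ne_top hp0 hFp)
    (setLIntegral_le_lintegral _ _)
  -- `u` is extremal for `F` on `B`. Subtracting its mean over `B` makes it mean-zero without
  -- changing its pairing with `F`, since `F` has mean zero on `B`.
  set u : Torus → ℂ := B.indicator fun t => dualFun p (F t) with hu
  have hum : AEStronglyMeasurable u arcMeasure :=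
    (((measurable_dualFun p).comp_aemeasurable hFp.aestronglyMeasurable.aemeasurable).indicator
      hBm).aestronglyMeasurable
  have hunorm : ∀ t, ‖u t‖ₑ ^ q = B.indicator (fun t => ‖F t‖ₑ ^ p) t := by
    intro t
    by_cases ht : t ∈ B
    · rw [hu, indicator_of_mem ht, indicator_of_mem ht, enorm_dualFun_rpow hpq]
    · rw [hu, indicator_of_notMem ht, indicator_of_notMem ht, enorm_zero, ENNReal.zero_rpow_of_pos hq0]
  have huS : ∫⁻ t, ‖u t‖ₑ ^ q ∂arcMeasure = S := by
    simp_rw [hunorm]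
    rw [lintegral_indicator hBm]
  have huq : MemLp u (ENNReal.ofReal q) arcMeasure := by
    refine ⟨hum, ?_⟩
    rw [eLpNorm_ofReal hq0, huS]
    exact (ENNReal.rpow_ne_top_of_nonneg (by positivity) hSt).lt_top
  have hui := MemLp.integrable_arc hq1.le huq
  set a := mean u B with ha
  set v : Torus → ℂ := B.indicator fun _ => a with hv
  have hvq : MemLp v (ENNReal.ofReal q) arcMeasure := (memLp_const a).indicator hBm
  have hvi := MemLp.integrable_arc hq1.le hvq
  -- By Hölder, replacing `u` on `B` by its mean does not increase the `L^q` norm; two pieces of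
  -- equal bound give the factor `2^q`.
  have haS : ‖a‖ₑ ^ q * ENNReal.ofReal ℓ ≤ S := by
    have b1 : ‖a‖ₑ ≤ (ENNReal.ofReal ℓ)⁻¹ * ∫⁻ t in B, ‖u t‖ₑ ∂arcMeasure := by
      have := enorm_mean_sub_le hui (B := B)
        (by rw [hBμ]; exact (ENNReal.ofReal_pos.2 h0).ne') 0
      simp only [sub_zero, hBμ] at this
      exact this
    have b2 := setLIntegral_le_holder hq1.le hui.aestronglyMeasurable.enorm B
    have b3 : ∫⁻ t in B, ‖u t‖ₑ ^ q ∂arcMeasure ≤ S := huS ▸ setLIntegral_le_lintegral _ _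
    have hL0 : ENNReal.ofReal ℓ ≠ 0 := (ENNReal.ofReal_pos.2 h0).ne'
    have hLt : ENNReal.ofReal ℓ ≠ ∞ := ENNReal.ofReal_ne_top
    have b4 : ‖a‖ₑ ≤ S ^ (1 / q) * ENNReal.ofReal ℓ ^ (-(1 / q)) := by
      calc ‖a‖ₑ ≤ (ENNReal.ofReal ℓ) ^ (-1 : ℝ) * (S ^ (1 / q) * ENNReal.ofReal ℓ ^ (1 - 1 / q)) := by
            rw [ENNReal.rpow_neg_one]
            refine b1.trans (mul_le_mul_right (b2.trans ?_) _)
            rw [hBμ]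
            exact mul_le_mul_left (ENNReal.rpow_le_rpow b3 (by positivity)) _
        _ = _ := by
            rw [mul_left_comm, ← ENNReal.rpow_add _ _ hL0 hLt]
            congr 2; ring
    calc _ ≤ (S ^ (1 / q) * ENNReal.ofReal ℓ ^ (-(1 / q))) ^ q * ENNReal.ofReal ℓ :=
          mul_le_mul_left (ENNReal.rpow_le_rpow b4 hq0.le) _
      _ = S * ((ENNReal.ofReal ℓ) ^ (-1 : ℝ) * ENNReal.ofReal ℓ) := by
          rw [ENNReal.mul_rpow_of_nonneg _ _ hq0.le, ← ENNReal.rpow_mul, ← ENNReal.rpow_mul,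
            one_div_mul_cancel hq0.ne', ENNReal.rpow_one, neg_mul, one_div_mul_cancel hq0.ne', mul_assoc]
      _ = S := by rw [ENNReal.rpow_neg_one, ENNReal.inv_mul_cancel hL0 hLt, mul_one]
  have hvS : ∫⁻ t, ‖v t‖ₑ ^ q ∂arcMeasure ≤ S := by
    have e : ∀ t, ‖v t‖ₑ ^ q = B.indicator (fun _ => ‖a‖ₑ ^ q) t := by
      intro t
      by_cases ht : t ∈ B
      · rw [hv, indicator_of_mem ht, indicator_of_mem ht]
      · rw [hv, indicator_of_notMem ht, indicator_of_notMem ht, enorm_zero,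
          ENNReal.zero_rpow_of_pos hq0]
    simp_rw [e]
    rw [lintegral_indicator hBm, setLIntegral_const, hBμ]
    exact haS
  have hmz : ∀ g : Torus → ℂ, ∫ t in B, g t ∂arcMeasure = (ℓ : ℂ) * mean g B := by
    intro g
    rw [mean, setAverage_eq, hBR, Complex.real_smul, ← mul_assoc, ← Complex.ofReal_mul,
      mul_inv_cancel₀ h0.ne', Complex.ofReal_one, one_mul]
  have hvint : ∫ t, v t ∂arcMeasure = (ℓ : ℂ) * a := by
    rw [hv, integral_indicator hBm, setIntegral_const, hBR, Complex.real_smul]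
  have huint : ∫ t, u t ∂arcMeasure = (ℓ : ℂ) * a := by
    rw [← hmz u, ← integral_indicator hBm, hu, indicator_indicator, inter_self]
  have hh0 : ∫ t, (u t - v t) ∂arcMeasure = 0 := by
    rw [integral_sub hui hvi, hvint, huint, sub_self]
  have hFint : ∫ t in B, F t ∂arcMeasure = 0 := by
    rw [hF, integral_sub hfi.integrableOn (integrable_const m), hmz f, setIntegral_const, hBR,
      Complex.real_smul, sub_self]
  have hhq : MemLp (fun t => u t - v t) (ENNReal.ofReal q) arcMeasure := huq.sub hvq
  refine ⟨fun t => u t - v t, hhq, hh0, ?_, ?_, ?_⟩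
  · intro s hs
    simp [hu, hv, indicator_of_notMem hs]
  · calc _ ≤ ∫⁻ t, 2 ^ (q - 1) * (‖u t‖ₑ ^ q + ‖v t‖ₑ ^ q) ∂arcMeasure := by
          refine lintegral_mono fun t => ?_
          refine (ENNReal.rpow_le_rpow (enorm_sub_le) hq0.le).trans ?_
          exact ENNReal.rpow_add_le_mul_rpow_add_rpow _ _ hq1.le
      _ = 2 ^ (q - 1) * ((∫⁻ t, ‖u t‖ₑ ^ q ∂arcMeasure) + ∫⁻ t, ‖v t‖ₑ ^ q ∂arcMeasure) := by
          rw [lintegral_const_mul' _ _ (ENNReal.rpow_ne_top_of_nonneg (by linarith) (by norm_num)),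
            lintegral_add_left' (hum.enorm.pow_const _)]
      _ ≤ 2 ^ (q - 1) * (S + S) := mul_le_mul_right (add_le_add huS.le hvS) _
      _ = 2 ^ (q - 1) * 2 ^ (1 : ℝ) * S := by rw [ENNReal.rpow_one]; ring
      _ = 2 ^ q * S := by
          rw [← ENNReal.rpow_add _ _ (by norm_num) (by norm_num)]
          norm_num
  · have hFpi : Integrable (fun t => ‖F t‖ ^ p) arcMeasure := by
      have := hFp.integrable_norm_rpow (by simpa using hp0) ENNReal.ofReal_ne_top
      rwa [ENNReal.toReal_ofReal hp0.le] at this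
    -- Writing `f = F + m`, the last two terms integrate to zero, the one because `F` has mean zero
    -- on `B`, the other because `u - v` has.
    have hpt : ∀ t, f t * (u t - v t) =
        B.indicator (fun t => ((‖F t‖ ^ p : ℝ) : ℂ)) t - a * B.indicator F t + m * (u t - v t) := by
      intro t
      have hft : f t = F t + m := by simp [hF]
      by_cases ht : t ∈ B
      · simp only [hu, hv, indicator_of_mem ht]
        rw [← mul_dualFun hp1, hft]; ring
      · simp only [hu, hv, indicator_of_notMem ht]; ring
    have i1 : Integrable (B.indicator fun t => ((‖F t‖ ^ p : ℝ) : ℂ)) arcMeasure :=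
      hFpi.ofReal.indicator hBm
    have i2 : Integrable (fun t => a * B.indicator F t) arcMeasure := (hFi.indicator hBm).const_mul a
    have i3 : Integrable (fun t => m * (u t - v t)) arcMeasure := (hui.sub hvi).const_mul m
    have i12 : Integrable (fun t => B.indicator (fun t => ((‖F t‖ ^ p : ℝ) : ℂ)) t -
      a * B.indicator F t) arcMeasure := i1.sub i2
    simp_rw [hpt]
    rw [integral_add i12 i3, integral_sub i1 i2, integral_const_mul, integral_const_mul, hh0,
      integral_indicator hBm, integral_indicator hBm, hFint, mul_zero, mul_zero, sub_zero, add_zero,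
      integral_complex_ofReal, ← ofReal_norm, Complex.norm_real,
      Real.norm_of_nonneg (integral_nonneg fun t => by positivity),
      ofReal_integral_eq_lintegral_ofReal hFpi.integrableOn (.of_forall fun t => by positivity)]
    refine lintegral_congr fun t => ?_
    rw [← ENNReal.ofReal_rpow_of_nonneg (norm_nonneg _) hp0.le, ofReal_norm]

lemma gsqTrunc_eq (f : Torus → ℂ) (x : ℝ) (t : Torus) :
    gsqTrunc f x t = ∫⁻ r in Ioo (1 - x) 1, ENNReal.ofReal (1 - r ^ 2) * energy f (r * point t) := by
  refine lintegral_congr fun r => ?_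
  rw [ENNReal.ofReal_mul (gradNormSq_nonneg _ _), mul_comm]
  rfl

lemma gsqTrunc_le_gsq (f : Torus → ℂ) {x : ℝ} (hx : x ≤ 1) (t : Torus) : gsqTrunc f x t ≤ gsq f t :=
  lintegral_mono_set (Ioo_subset_Ioo_left (by linarith))

lemma measurable_one_sub_sq : Measurable fun r : ℝ => ENNReal.ofReal (1 - r ^ 2) := by fun_prop

lemma measurable_energy_ray (f : Torus → ℂ) (t : Torus) :
    Measurable fun r : ℝ => energy f (r * point t) :=
  (measurable_energy f).comp (Complex.measurable_ofReal.mul_const _)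

lemma measurable_gsqTrunc (f : Torus → ℂ) (x : ℝ) : Measurable (gsqTrunc f x) := by
  have := measurable_radial_lintegral (measurable_energy f) measurable_one_sub_sq (Ioo (1 - x) 1)
  simp_rw [← gsqTrunc_eq] at this
  exact this

lemma radial_cauchy_schwarz (f : Torus → ℂ) (x : ℝ) (t : Torus) {G : ℝ → ℝ≥0∞} (hG : Measurable G) :
    ∫⁻ r in Ioo (1 - x) 1, ENNReal.ofReal (1 - r ^ 2) *
        (energy f (r * point t) ^ (1 / 2 : ℝ) * G r ^ (1 / 2 : ℝ)) ≤
      gsqTrunc f x t ^ (1 / 2 : ℝ) *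
        (∫⁻ r in Ioo (1 - x) 1, ENNReal.ofReal (1 - r ^ 2) * G r) ^ (1 / 2 : ℝ) := by
  rw [gsqTrunc_eq]
  refine le_trans (le_of_eq ?_) (ENNReal.lintegral_mul_norm_pow_le
    (measurable_one_sub_sq.mul (measurable_energy_ray f t)).aemeasurable
    (measurable_one_sub_sq.mul hG).aemeasurable (by norm_num) (by norm_num) (by norm_num))
  refine lintegral_congr fun r => ?_
  simp only [Pi.mul_apply]
  rw [ENNReal.mul_rpow_of_nonneg _ _ (by norm_num), ENNReal.mul_rpow_of_nonneg _ _ (by norm_num),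
    mul_mul_mul_comm, ← ENNReal.rpow_add_of_nonneg _ _ (by norm_num) (by norm_num)]
  norm_num

/-- Cauchy–Schwarz along the radius with a constant second factor; the integral of `1 - r²` over `(1
- d, 1)` is at most `2d · d ≤ (2d)²`. -/
lemma radial_lintegral_const_le (f : Torus → ℂ) {d : ℝ} (hd0 : 0 ≤ d) (hd1 : d ≤ 1) (t : Torus)
    (H : ℝ≥0∞) :
    ∫⁻ r in Ioo (1 - d) 1, ENNReal.ofReal (1 - r ^ 2) * (energy f (r * point t) ^ (1 / 2 : ℝ) * H) ≤
      H * (ENNReal.ofReal (2 * d) * gsqTrunc f d t ^ (1 / 2 : ℝ)) := by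
  have h := radial_cauchy_schwarz f d t (G := fun _ => H ^ (2 : ℝ)) measurable_const
  simp only [← ENNReal.rpow_mul] at h
  norm_num at h
  refine h.trans ?_
  have h1 : ∫⁻ r in Ioo (1 - d) 1, ENNReal.ofReal (1 - r ^ 2) * H ^ 2 ≤
      (ENNReal.ofReal (2 * d) * H) ^ (2 : ℝ) := by
    calc _ ≤ ∫⁻ _ in Ioo (1 - d) 1, ENNReal.ofReal (2 * d) * H ^ 2 := by
          refine setLIntegral_mono' measurableSet_Ioo fun r hr => mul_le_mul_left
            (ENNReal.ofReal_le_ofReal ?_) _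
          nlinarith [hr.1, hr.2]
      _ = ENNReal.ofReal (2 * d) * H ^ 2 * ENNReal.ofReal d := by
          rw [setLIntegral_const, Real.volume_Ioo, sub_sub_cancel]
      _ ≤ ENNReal.ofReal (2 * d) * H ^ 2 * ENNReal.ofReal (2 * d) :=
          mul_le_mul_right (ENNReal.ofReal_le_ofReal (by linarith)) _
      _ = _ := by rw [ENNReal.rpow_two]; ring
  have h2 := ENNReal.rpow_le_rpow h1 (by norm_num : (0 : ℝ) ≤ 1 / 2)
  rw [← ENNReal.rpow_mul] at h2
  norm_num at h2
  refine (mul_le_mul_right h2 _).trans_eq ?_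
  norm_num
  ring

lemma ofReal_mul_neg_log_le {r : ℝ} (hr : r ∈ Ioo (0 : ℝ) 1) :
    ENNReal.ofReal (r * -Real.log r) ≤ ENNReal.ofReal (1 - r ^ 2) := by
  refine ENNReal.ofReal_le_ofReal ?_
  have h0 := hr.1
  have h1 := hr.2
  have h2 := Real.one_sub_inv_le_log_of_pos h0
  have h3 : r * -Real.log r ≤ r * (r⁻¹ - 1) := by
    refine mul_le_mul_of_nonneg_left (by linarith) h0.le
  have h4 : r * (r⁻¹ - 1) = 1 - r := by field_simp
  nlinarith

lemma ofReal_sqrt_gradNormSq (f : Torus → ℂ) (z : ℂ) :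
    ENNReal.ofReal √(gradNormSq (poissonExtension f) z) = energy f z ^ (1 / 2 : ℝ) := by
  rw [Real.sqrt_eq_rpow, ← ENNReal.ofReal_rpow_of_nonneg (gradNormSq_nonneg _ _) (by norm_num)]
  rfl

/-- Splitting of a radial integral into Carleson boxes, given decay of `∇Ph` away from an arc. -/
lemma radial_lintegral_le_boxes {f h : Torus → ℂ} (c : Torus) {ℓ : ℝ} (hℓ : 0 < ℓ) (t : Torus)
    {H : ℕ → ℝ≥0∞}
    (hH : ∀ (k : ℕ), ∀ r ∈ Ioo (0 : ℝ) 1, 2 * ℓ ≤ max (‖t - c‖ / Real.pi) (1 - r) →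
      2 ^ k * ℓ ≤ 2 * max (‖t - c‖ / Real.pi) (1 - r) →
        energy h (r * point t) ^ (1 / 2 : ℝ) ≤ H k) :
    ∫⁻ r in Ioo 0 1, ENNReal.ofReal (r * -Real.log r) *
        ENNReal.ofReal (√(gradNormSq (poissonExtension f) (r * point t)) *
          √(gradNormSq (poissonExtension h) (r * point t))) ≤
      (arc c (4 * ℓ)).indicator (fun t => gsqTrunc f (min (4 * ℓ) 1) t ^ (1 / 2 : ℝ) *
        gsq h t ^ (1 / 2 : ℝ)) t +
      ∑' k : ℕ, (arc c (2 ^ (k + 1) * ℓ)).indicator (fun t => H k * (ENNReal.ofReal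
        (2 * min (2 ^ (k + 1) * ℓ) 1) * gsqTrunc f (min (2 ^ (k + 1) * ℓ) 1) t ^ (1 / 2 : ℝ))) t := by
  have hπ := Real.pi_pos
  set d : ℕ → ℝ := fun k => min (2 ^ k * ℓ) 1 with hd
  have hd0 : ∀ k, 0 < d k := fun k => lt_min (by positivity) one_pos
  have hd1 : ∀ k, d k ≤ 1 := fun k => min_le_right _ _
  set A : ℝ → ℝ≥0∞ := fun r => ENNReal.ofReal (1 - r ^ 2) *
    (energy f (r * point t) ^ (1 / 2 : ℝ) * energy h (r * point t) ^ (1 / 2 : ℝ)) with hA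
  set Ak : ℕ → ℝ → ℝ≥0∞ := fun k r => ENNReal.ofReal (1 - r ^ 2) *
    (energy f (r * point t) ^ (1 / 2 : ℝ) * H k) with hAk
  have mf := (measurable_energy_ray f t).pow_const (1 / 2 : ℝ)
  have mh := (measurable_energy_ray h t).pow_const (1 / 2 : ℝ)
  have mA : Measurable A := measurable_one_sub_sq.mul (mf.mul mh)
  have mAk : ∀ k, Measurable (Ak k) := fun k => measurable_one_sub_sq.mul (mf.mul_const _)
  have hpt : ∀ r ∈ Ioo (0 : ℝ) 1, ENNReal.ofReal (r * -Real.log r) *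
        ENNReal.ofReal (√(gradNormSq (poissonExtension f) (r * point t)) *
          √(gradNormSq (poissonExtension h) (r * point t))) ≤
      (arc c (4 * ℓ)).indicator (fun _ => (Ioo (1 - d 2) 1).indicator A r) t +
        ∑' k : ℕ, (arc c (2 ^ (k + 1) * ℓ)).indicator
          (fun _ => (Ioo (1 - d (k + 1)) 1).indicator (Ak k) r) t := by
    intro r hr
    have hle : ENNReal.ofReal (r * -Real.log r) *
        ENNReal.ofReal (√(gradNormSq (poissonExtension f) (r * point t)) *
          √(gradNormSq (poissonExtension h) (r * point t))) ≤ A r := by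
      rw [ENNReal.ofReal_mul (Real.sqrt_nonneg _), ofReal_sqrt_gradNormSq, ofReal_sqrt_gradNormSq]
      exact mul_le_mul_left (ofReal_mul_neg_log_le hr) _
    refine hle.trans ?_
    -- The scale of a point is the larger of its angular and radial distances. As the radial
    -- interval of a box is open, the point is placed in the boxes of index strictly larger than
    -- `k`.
    obtain ⟨k, hk1, hk2⟩ := exists_dyadic_scale (max (‖t - c‖ / Real.pi) (1 - r)) hℓ
    have hbox : ∀ n, k < n → t ∈ arc c (2 ^ n * ℓ) ∧ r ∈ Ioo (1 - d n) 1 := by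
      intro n hn
      have hlt : 2 ^ k * ℓ < 2 ^ n * ℓ :=
        mul_lt_mul_of_pos_right (pow_lt_pow_right₀ one_lt_two hn) hℓ
      refine ⟨?_, ?_, hr.2⟩
      · rw [mem_arc]
        have h1 := (le_max_left _ _).trans hk1
        rw [div_le_iff₀ hπ] at h1
        nlinarith
      · have h1 := (le_max_right _ _).trans hk1
        have : 1 - r < d n := lt_min (by linarith) (by linarith [hr.1])
        linarith
    rcases le_or_gt (2 * ℓ) (max (‖t - c‖ / Real.pi) (1 - r)) with hx | hx
    · refine le_add_left (le_trans ?_ (ENNReal.le_tsum k))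
      obtain ⟨b1, b2⟩ := hbox (k + 1) (by omega)
      rw [indicator_of_mem b1, indicator_of_mem b2]
      rw [max_eq_left (by linarith)] at hk2
      exact mul_le_mul_right (mul_le_mul_right (hH k r hr hx hk2) _) _
    · refine le_add_right ?_
      -- Points of scale below `2ℓ` thus lie in the box of index 2, which is the near region of size
      -- `4ℓ`.
      have hk : k < 2 := by
        by_contra hk
        have : (2 : ℝ) ^ 2 ≤ 2 ^ k := pow_le_pow_right₀ one_le_two (by omega)
        have h3 : max (max (‖t - c‖ / Real.pi) (1 - r)) ℓ < 2 * ℓ := max_lt hx (by linarith)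
        nlinarith
      obtain ⟨b1, b2⟩ := hbox 2 hk
      rw [indicator_of_mem (by norm_num at b1; exact b1), indicator_of_mem b2]
  have hbd : ∀ (x : ℝ) (n : ℕ) (g : ℝ → ℝ≥0∞) (B : Torus → ℝ≥0∞),
      ∫⁻ r in Ioo (1 - d n) 1, g r ≤ B t →
      ∫⁻ r in Ioo 0 1, (arc c x).indicator (fun _ => (Ioo (1 - d n) 1).indicator g r) t ≤
        (arc c x).indicator B t := by
    intro x n g B hgB
    by_cases ht : t ∈ arc c x
    · simp only [indicator_of_mem ht]
      rw [lintegral_indicator measurableSet_Ioo, Measure.restrict_restrict measurableSet_Ioo,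
        inter_eq_left.2 (Ioo_subset_Ioo_left (by linarith [hd1 n]))]
      exact hgB
    · simp only [indicator_of_notMem ht]
      simp
  have mind : ∀ (x : ℝ) (n : ℕ) (g : ℝ → ℝ≥0∞), Measurable g →
      Measurable fun r => (arc c x).indicator (fun _ => (Ioo (1 - d n) 1).indicator g r) t := by
    intro x n g hg
    by_cases ht : t ∈ arc c x
    · simp only [indicator_of_mem ht]
      exact hg.indicator measurableSet_Ioo
    · simp only [indicator_of_notMem ht]
      exact measurable_const
  have hd2 : d 2 = min (4 * ℓ) 1 := by rw [hd]; norm_num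
  refine (setLIntegral_mono' measurableSet_Ioo hpt).trans ?_
  rw [lintegral_add_left (mind _ _ _ mA), lintegral_tsum fun k => (mind _ _ _ (mAk k)).aemeasurable]
  refine add_le_add (hbd _ 2 _ _ ?_) (ENNReal.tsum_le_tsum fun k => hbd _ (k + 1) _ _ ?_)
  · refine (radial_cauchy_schwarz f (d 2) t (measurable_energy_ray h t)).trans ?_
    rw [← gsqTrunc_eq, hd2]
    exact mul_le_mul_right (ENNReal.rpow_le_rpow (gsqTrunc_le_gsq h (min_le_right _ _) t)
      (by norm_num)) _
  · exact radial_lintegral_const_le f (hd0 _).le (hd1 _) t (H k)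

lemma setLIntegral_gsqTrunc_min_le {p η : ℝ} (hη : 0 < η) {f : Torus → ℂ} {K : ℝ≥0∞}
    (hK : ∀ (c : Torus) (ℓ : ℝ), 0 < ℓ → ℓ ≤ 1 →
      ∫⁻ t in arc c ℓ, gsqTrunc f ℓ t ^ (p / 2) ∂arcMeasure ≤ K * ENNReal.ofReal (ℓ ^ η))
    (c : Torus) {x : ℝ} (hx : 0 < x) :
    ∫⁻ t in arc c x, gsqTrunc f (min x 1) t ^ (p / 2) ∂arcMeasure ≤ K * ENNReal.ofReal (x ^ η) := by
  have hd0 : 0 < min x 1 := lt_min hx one_pos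
  have h := hK c (min x 1) hd0 (min_le_right _ _)
  rw [arc_min_one] at h
  refine h.trans (mul_le_mul_right (ENNReal.ofReal_le_ofReal ?_) _)
  exact Real.rpow_le_rpow hd0.le (min_le_left _ _) hη.le

/-- Hölder on the arc; the exponent is `η/p + 1 - 1/p`, the same as for the oscillation. -/
lemma setLIntegral_sqrt_gsqTrunc_le {p η : ℝ} (hp : 1 ≤ p) (hη : 0 < η) {f : Torus → ℂ} {K : ℝ≥0∞}
    (hK : ∀ (c : Torus) (ℓ : ℝ), 0 < ℓ → ℓ ≤ 1 →
      ∫⁻ t in arc c ℓ, gsqTrunc f ℓ t ^ (p / 2) ∂arcMeasure ≤ K * ENNReal.ofReal (ℓ ^ η))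
    (c : Torus) {x : ℝ} (hx : 0 < x) :
    ∫⁻ t in arc c x, gsqTrunc f (min x 1) t ^ (1 / 2 : ℝ) ∂arcMeasure ≤
      K ^ (1 / p) * ENNReal.ofReal (x ^ (1 + (η - 1) / p)) := by
  have hp0 : 0 < p := by linarith
  have hθ : 0 ≤ 1 - 1 / p := by rw [sub_nonneg, div_le_one hp0]; exact hp
  refine (setLIntegral_le_holder hp ((measurable_gsqTrunc f _).pow_const _).aemeasurable _).trans ?_
  simp only [← ENNReal.rpow_mul]
  rw [one_div_mul_eq_div, arcMeasure_arc]
  calc _ ≤ (K * ENNReal.ofReal (x ^ η)) ^ (1 / p) * ENNReal.ofReal x ^ (1 - 1 / p) := by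
        refine mul_le_mul' (ENNReal.rpow_le_rpow (setLIntegral_gsqTrunc_min_le hη hK c hx)
          (by positivity)) (ENNReal.rpow_le_rpow (ENNReal.ofReal_le_ofReal (min_le_left _ _)) hθ)
    _ = _ := by
        rw [ENNReal.mul_rpow_of_nonneg _ _ (by positivity),
          ENNReal.ofReal_rpow_of_pos (by positivity), ENNReal.ofReal_rpow_of_pos hx, mul_assoc,
          ← ENNReal.ofReal_mul (by positivity), ← Real.rpow_mul hx.le, ← Real.rpow_add hx]
        congr 3
        field_simp
        ring

/-- Decay of the gradient of the Poisson extension of a mean-zero function supported on an arc. -/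
lemma sqrt_energy_le_of_integral_eq_zero {h : Torus → ℂ} (hh : Integrable h arcMeasure)
    (h0 : ∫ t, h t ∂arcMeasure = 0) {c : Torus} {ℓ : ℝ} (hℓ : 0 < ℓ)
    (hsupp : ∀ s, s ∉ arc c ℓ → h s = 0) (t : Torus) (k : ℕ) {r : ℝ} (hr : r ∈ Ioo (0 : ℝ) 1)
    (hx : 2 * ℓ ≤ max (‖t - c‖ / Real.pi) (1 - r))
    (hk : 2 ^ k * ℓ ≤ 2 * max (‖t - c‖ / Real.pi) (1 - r)) :
    energy h (r * point t) ^ (1 / 2 : ℝ) ≤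
      2 * (ENNReal.ofReal (48 * (Real.pi * ℓ) / (2 ^ k * ℓ) ^ 3) * ∫⁻ s, ‖h s‖ₑ ∂arcMeasure) := by
  have hπ := Real.pi_pos
  set x := max (‖t - c‖ / Real.pi) (1 - r) with hxdef
  have hx0 : 0 < x := by linarith
  have hcoef : 6 * (Real.pi * ℓ) / x ^ 3 ≤ 48 * (Real.pi * ℓ) / (2 ^ k * ℓ) ^ 3 := by
    have h1 : 2 ^ k * ℓ / 2 ≤ x := by linarith
    calc 6 * (Real.pi * ℓ) / x ^ 3 ≤ 6 * (Real.pi * ℓ) / (2 ^ k * ℓ / 2) ^ 3 := by gcongr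
      _ = _ := by field_simp; norm_num
  have hconj0 : ∫ t, (starRingEnd ℂ) (h t) ∂arcMeasure = 0 := by
    rw [integral_conj, h0, map_zero]
  have b1 := enorm_anaDeriv_le_of_integral_eq_zero hh h0 hℓ hsupp hr t hx
  have b2 := enorm_anaDeriv_le_of_integral_eq_zero (integrable_conj hh) hconj0 hℓ
    (fun s hs => by rw [hsupp s hs, map_zero]) hr t hx
  have e : ∀ s, ‖(starRingEnd ℂ) (h s)‖ₑ = ‖h s‖ₑ := fun s => by
    rw [← ofReal_norm, ← ofReal_norm, RCLike.norm_conj]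
  simp_rw [e] at b2
  have b3 := energy_le hh (norm_mul_point_lt hr t) b1 b2
  refine (ENNReal.rpow_le_rpow b3 (by norm_num)).trans ?_
  rw [show (4 : ℝ≥0∞) = 2 ^ 2 by norm_num, ← mul_pow, ← ENNReal.rpow_two, ← ENNReal.rpow_mul]
  norm_num
  exact mul_le_mul_right (mul_le_mul_left (ENNReal.ofReal_le_ofReal hcoef) _) _

/-- A Littlewood–Paley bound yields the Campanato bound. -/
theorem exists_setLIntegral_oscillation_le {p η : ℝ} (hp : 1 < p) (hη : 0 < η) (hηp : η < 1 + p)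
    {f : Torus → ℂ} (hf : MemLp f (ENNReal.ofReal p) arcMeasure) {K : ℝ≥0∞} (hKt : K ≠ ∞)
    (hK : ∀ (c : Torus) (ℓ : ℝ), 0 < ℓ → ℓ ≤ 1 →
      ∫⁻ t in arc c ℓ, gsqTrunc f ℓ t ^ (p / 2) ∂arcMeasure ≤ K * ENNReal.ofReal (ℓ ^ η)) :
    ∃ K' : ℝ≥0∞, K' ≠ ∞ ∧ ∀ (c : Torus) (ℓ : ℝ), 0 < ℓ → ℓ ≤ 1 →
      ∫⁻ t in arc c ℓ, ‖f t - mean f (arc c ℓ)‖ₑ ^ p ∂arcMeasure ≤ K' * ENNReal.ofReal (ℓ ^ η) := by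
  have hπ := Real.pi_pos
  set q := p.conjExponent with hq
  have hpq : p.HolderConjugate q := Real.HolderConjugate.conjExponent hp
  have hp0 := hpq.pos
  have hq0 := hpq.symm.pos
  have hq1 := hpq.symm.lt
  have hpq1 : 1 / p + 1 / q = 1 := by simpa using hpq.inv_add_inv_eq_one
  obtain ⟨C1, hC1t, hC1⟩ := exists_lintegral_gsq_rpow_le hq1
  set τ := (η - 1) / p with hτ
  have hτ1 : τ < 1 := by rw [hτ, div_lt_one hp0]; linarith
  -- The ratio of the far terms: `(2^k ℓ)⁻³` from the decay of `∇Ph` against `(2^k ℓ)^(2+τ)` from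
  -- the box. It is below one because `η < 1 + p`.
  set ρ : ℝ := 2 ^ (τ - 1) with hρ
  have hρ1 : ρ < 1 := Real.rpow_lt_one_of_one_lt_of_neg one_lt_two (by linarith)
  set α : ℝ≥0∞ := ENNReal.ofReal (4 ^ (η / p)) * (C1 * 2 ^ q) ^ (1 / q) with hα
  have hαt : α ≠ ∞ := ENNReal.mul_ne_top ENNReal.ofReal_ne_top
    (ENNReal.rpow_ne_top_of_nonneg (by positivity)
      (ENNReal.mul_ne_top hC1t (ENNReal.rpow_ne_top_of_nonneg hq0.le (by norm_num))))
  -- The constant is `384 = 2 * 48 * 2 * 2`: the decay bound gives `2 * 48`, the `L¹` norm of `h` a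
  -- 2, and the radial integral over a box of size `x` the 2 in `2x`.
  set β : ℝ≥0∞ := ∑' k : ℕ, ENNReal.ofReal (384 * Real.pi * 2 ^ (2 + τ) * ρ ^ k) with hβ
  have hβt : β ≠ ∞ :=
    ((summable_geometric_of_lt_one (by positivity) hρ1).mul_left _).tsum_ofReal_ne_top
  set D : ℝ≥0∞ := 2 * (α + β) with hD
  have hDt : D ≠ ∞ := ENNReal.mul_ne_top (by norm_num) (ENNReal.add_ne_top.2 ⟨hαt, hβt⟩)
  refine ⟨D ^ p * K, ENNReal.mul_ne_top (ENNReal.rpow_ne_top_of_nonneg hp0.le hDt) hKt, ?_⟩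
  intro c ℓ h0 h1
  obtain ⟨h, hhq, hh0, hsupp, hhS, hfh⟩ := exists_dual_of_oscillation hpq hf c h0 h1
  set S := ∫⁻ t in arc c ℓ, ‖f t - mean f (arc c ℓ)‖ₑ ^ p ∂arcMeasure with hS
  -- The duality argument bounds `S` by a multiple of `S^(1/q)`; this power can be cancelled only
  -- when `S` is finite and nonzero.
  have hSt : S ≠ ∞ := ne_top_of_le_ne_top
    (lintegral_enorm_rpow_ne_top hp0 (hf.sub (memLp_const (mean f (arc c ℓ)))))
    (setLIntegral_le_lintegral _ _)
  rcases eq_or_ne S 0 with hS0 | hS0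
  · rw [hS0]; exact zero_le
  have hhi := MemLp.integrable_arc hq1.le hhq
  have hh1 : ∫⁻ s, ‖h s‖ₑ ∂arcMeasure ≤ 2 * S ^ (1 / q) * ENNReal.ofReal (ℓ ^ (1 / p)) := by
    have e : ∫⁻ s, ‖h s‖ₑ ∂arcMeasure = ∫⁻ s in arc c ℓ, ‖h s‖ₑ ∂arcMeasure := by
      rw [← lintegral_indicator (measurableSet_arc c ℓ)]
      refine lintegral_congr fun s => ?_
      by_cases hs : s ∈ arc c ℓ
      · rw [indicator_of_mem hs]
      · rw [indicator_of_notMem hs, hsupp s hs, enorm_zero]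
    rw [e]
    refine (setLIntegral_le_holder hq1.le hhi.aestronglyMeasurable.enorm _).trans ?_
    rw [arcMeasure_arc, min_eq_left h1, ENNReal.ofReal_rpow_of_pos h0,
      show 1 - 1 / q = 1 / p by linarith]
    refine mul_le_mul_left ?_ _
    refine (ENNReal.rpow_le_rpow ((setLIntegral_le_lintegral _ _).trans hhS)
      (by positivity)).trans_eq ?_
    rw [ENNReal.mul_rpow_of_nonneg _ _ (by positivity), ← ENNReal.rpow_mul,
      mul_one_div_cancel hq0.ne', ENNReal.rpow_one]
  set N := ∫⁻ s, ‖h s‖ₑ ∂arcMeasure with hN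
  set H : ℕ → ℝ≥0∞ := fun k => 2 * (ENNReal.ofReal (48 * (Real.pi * ℓ) / (2 ^ k * ℓ) ^ 3) * N) with hH
  have hNt : N ≠ ∞ := hhi.2.ne
  have hHt : ∀ k, H k ≠ ∞ := fun k => ENNReal.mul_ne_top (by norm_num)
    (ENNReal.mul_ne_top ENNReal.ofReal_ne_top hNt)
  set R : ℝ≥0∞ := K ^ (1 / p) * ENNReal.ofReal (ℓ ^ (η / p)) * S ^ (1 / q) with hR
  have hnear : ∫⁻ t in arc c (4 * ℓ), gsqTrunc f (min (4 * ℓ) 1) t ^ (1 / 2 : ℝ) *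
      gsq h t ^ (1 / 2 : ℝ) ∂arcMeasure ≤ α * R := by
    calc _ = ∫⁻ t in arc c (4 * ℓ), (gsqTrunc f (min (4 * ℓ) 1) t ^ (p / 2)) ^ (1 / p) *
          (gsq h t ^ (q / 2)) ^ (1 / q) ∂arcMeasure := by
          refine lintegral_congr fun t => ?_
          rw [← ENNReal.rpow_mul, ← ENNReal.rpow_mul]
          congr 2 <;> field_simp
      _ ≤ (∫⁻ t in arc c (4 * ℓ), gsqTrunc f (min (4 * ℓ) 1) t ^ (p / 2) ∂arcMeasure) ^ (1 / p) *
          (∫⁻ t in arc c (4 * ℓ), gsq h t ^ (q / 2) ∂arcMeasure) ^ (1 / q) :=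
          ENNReal.lintegral_mul_norm_pow_le ((measurable_gsqTrunc f _).pow_const _).aemeasurable
            ((measurable_gsq h).pow_const _).aemeasurable (by positivity) (by positivity) hpq1
      _ ≤ (K * ENNReal.ofReal ((4 * ℓ) ^ η)) ^ (1 / p) * (C1 * (2 ^ q * S)) ^ (1 / q) := by
          refine mul_le_mul' (ENNReal.rpow_le_rpow
            (setLIntegral_gsqTrunc_min_le hη hK c (by positivity)) (by positivity))
            (ENNReal.rpow_le_rpow ?_ (by positivity))
          exact (setLIntegral_le_lintegral _ _).trans ((hC1 h hhq).trans (mul_le_mul_right hhS _))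
      _ = _ := by
          rw [ENNReal.mul_rpow_of_nonneg _ _ (by positivity), ← mul_assoc C1,
            ENNReal.mul_rpow_of_nonneg _ S (by positivity),
            ENNReal.ofReal_rpow_of_pos (by positivity), ← Real.rpow_mul (by positivity),
            mul_one_div, Real.mul_rpow (by norm_num) h0.le, ENNReal.ofReal_mul (by positivity), hα, hR]
          ring
  have hfar : ∀ k : ℕ, ∫⁻ t in arc c (2 ^ (k + 1) * ℓ), H k * (ENNReal.ofReal
        (2 * min (2 ^ (k + 1) * ℓ) 1) * gsqTrunc f (min (2 ^ (k + 1) * ℓ) 1) t ^ (1 / 2 : ℝ))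
          ∂arcMeasure ≤ ENNReal.ofReal (384 * Real.pi * 2 ^ (2 + τ) * ρ ^ k) * R := by
    intro k
    rw [lintegral_const_mul' _ _ (hHt k), lintegral_const_mul' _ _ ENNReal.ofReal_ne_top]
    set x : ℝ := 2 ^ (k + 1) * ℓ with hx
    have hx0 : 0 < x := by positivity
    calc _ ≤ 2 * (ENNReal.ofReal (48 * (Real.pi * ℓ) / (2 ^ k * ℓ) ^ 3) *
          (2 * S ^ (1 / q) * ENNReal.ofReal (ℓ ^ (1 / p)))) *
          (ENNReal.ofReal (2 * x) * (K ^ (1 / p) * ENNReal.ofReal (x ^ (1 + τ)))) := by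
          refine mul_le_mul' (mul_le_mul_right (mul_le_mul_right hh1 _) _)
            (mul_le_mul' (ENNReal.ofReal_le_ofReal ?_)
              (setLIntegral_sqrt_gsqTrunc_le hp.le hη hK c hx0))
          exact mul_le_mul_of_nonneg_left (min_le_left _ _) (by norm_num)
      _ = ENNReal.ofReal (2 * (48 * (Real.pi * ℓ) / (2 ^ k * ℓ) ^ 3) * 2 * ℓ ^ (1 / p) * (2 * x) *
          x ^ (1 + τ)) * (K ^ (1 / p) * S ^ (1 / q)) := by
          have split : ∀ a b y e : ℝ, 0 ≤ a → 0 ≤ b → 0 ≤ y →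
              ENNReal.ofReal (2 * a * 2 * b * y * e) = 2 * ENNReal.ofReal a * 2 * ENNReal.ofReal b *
                ENNReal.ofReal y * ENNReal.ofReal e := by
            intro a b y e ha hb hy
            rw [ENNReal.ofReal_mul (by positivity), ENNReal.ofReal_mul (by positivity),
              ENNReal.ofReal_mul (by positivity), ENNReal.ofReal_mul (by positivity),
              ENNReal.ofReal_mul (by positivity), ENNReal.ofReal_ofNat]
          rw [split _ _ _ _ (by positivity) (by positivity) (by positivity)]
          ring
      _ = ENNReal.ofReal (384 * Real.pi * 2 ^ (2 + τ) * ρ ^ k * ℓ ^ (η / p)) *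
          (K ^ (1 / p) * S ^ (1 / q)) := by
          congr 2
          have e1 : x * x ^ (1 + τ) = (2 : ℝ) ^ (2 + τ) * ((2 : ℝ) ^ τ * 4) ^ k * (ℓ ^ 2 * ℓ ^ τ) := by
            have a1 : x * x ^ (1 + τ) = x ^ (2 + τ) := by
              rw [← Real.rpow_one_add' hx0.le (by
                have : -1 < τ := by
                  rw [hτ, lt_div_iff₀ hp0]; linarith
                linarith)]
              congr 1; ring
            rw [a1, hx, Real.mul_rpow (by positivity) h0.le, pow_succ, Real.mul_rpow (by positivity)
              (by norm_num), Real.rpow_add h0, Real.rpow_two]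
            have a2 : ((2 : ℝ) ^ k) ^ (2 + τ) = ((2 : ℝ) ^ τ * 4) ^ k := by
              rw [← Real.rpow_natCast, ← Real.rpow_mul (by norm_num), mul_comm, Real.rpow_mul (by norm_num),
                Real.rpow_natCast, Real.rpow_add (by norm_num)]
              norm_num
              ring
            rw [a2]; ring
          have e2 : ℓ ^ (η / p) = ℓ ^ (1 / p) * ℓ ^ τ := by
            rw [← Real.rpow_add h0, hτ]; congr 1; field_simp; ring
          have e3 : ρ = (2 : ℝ) ^ τ / 2 := by rw [hρ, Real.rpow_sub_one two_ne_zero]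
          calc _ = 2 * (48 * (Real.pi * ℓ) / (2 ^ k * ℓ) ^ 3) * 2 * ℓ ^ (1 / p) * 2 *
                (x * x ^ (1 + τ)) := by ring
            _ = _ := by
                rw [e1, e2, e3, div_pow, mul_pow ((2 : ℝ) ^ τ) 4 k,
                  show (4 : ℝ) ^ k = 2 ^ k * 2 ^ k by rw [← mul_pow]; norm_num]
                field_simp
                ring
      _ = _ := by
          rw [ENNReal.ofReal_mul (by positivity), hR]
          ring
  have hmain : S ≤ D * R := by
    calc S = ‖∫ t, f t * h t ∂arcMeasure‖ₑ := hfh.symm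
      _ ≤ 2 * ∫⁻ t, (∫⁻ r in Ioo 0 1, ENNReal.ofReal (r * -Real.log r) *
          ENNReal.ofReal (√(gradNormSq (poissonExtension f) (r * point t)) *
            √(gradNormSq (poissonExtension h) (r * point t)))) ∂arcMeasure :=
          enorm_integral_mul_le_gradient hpq hf hhq hh0
      _ ≤ 2 * ∫⁻ t, ((arc c (4 * ℓ)).indicator (fun t => gsqTrunc f (min (4 * ℓ) 1) t ^ (1 / 2 : ℝ) *
          gsq h t ^ (1 / 2 : ℝ)) t +
          ∑' k : ℕ, (arc c (2 ^ (k + 1) * ℓ)).indicator (fun t => H k * (ENNReal.ofReal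
            (2 * min (2 ^ (k + 1) * ℓ) 1) * gsqTrunc f (min (2 ^ (k + 1) * ℓ) 1) t ^ (1 / 2 : ℝ))) t)
              ∂arcMeasure := by
          refine mul_le_mul_right (lintegral_mono fun t => ?_) _
          exact radial_lintegral_le_boxes c h0 t fun k r hr hx hk =>
            sqrt_energy_le_of_integral_eq_zero hhi hh0 h0 hsupp t k hr hx hk
      _ = 2 * ((∫⁻ t in arc c (4 * ℓ), gsqTrunc f (min (4 * ℓ) 1) t ^ (1 / 2 : ℝ) *
          gsq h t ^ (1 / 2 : ℝ) ∂arcMeasure) +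
          ∑' k : ℕ, ∫⁻ t in arc c (2 ^ (k + 1) * ℓ), H k * (ENNReal.ofReal
            (2 * min (2 ^ (k + 1) * ℓ) 1) * gsqTrunc f (min (2 ^ (k + 1) * ℓ) 1) t ^ (1 / 2 : ℝ))
              ∂arcMeasure) := by
          have m1 : Measurable fun t => gsqTrunc f (min (4 * ℓ) 1) t ^ (1 / 2 : ℝ) *
              gsq h t ^ (1 / 2 : ℝ) :=
            ((measurable_gsqTrunc f _).pow_const _).mul ((measurable_gsq h).pow_const _)
          have m2 : ∀ k : ℕ, Measurable fun t => H k * (ENNReal.ofReal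
              (2 * min (2 ^ (k + 1) * ℓ) 1) *
                gsqTrunc f (min (2 ^ (k + 1) * ℓ) 1) t ^ (1 / 2 : ℝ)) := fun k =>
            (((measurable_gsqTrunc f _).pow_const _).const_mul _).const_mul _
          rw [lintegral_add_left (m1.indicator (measurableSet_arc _ _)), lintegral_tsum fun k =>
            ((m2 k).indicator (measurableSet_arc _ _)).aemeasurable,
            lintegral_indicator (measurableSet_arc _ _)]
          simp_rw [lintegral_indicator (measurableSet_arc _ _)]
      _ ≤ 2 * (α * R + ∑' k : ℕ, ENNReal.ofReal (384 * Real.pi * 2 ^ (2 + τ) * ρ ^ k) * R) :=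
          mul_le_mul_right (add_le_add hnear (ENNReal.tsum_le_tsum hfar)) _
      _ = D * R := by rw [ENNReal.tsum_mul_right, hD, hβ]; ring
  have hSq0 : S ^ (1 / q) ≠ 0 := by
    rw [Ne, ENNReal.rpow_eq_zero_iff_of_pos (by positivity)]; exact hS0
  have hSqt : S ^ (1 / q) ≠ ∞ := ENNReal.rpow_ne_top_of_nonneg (by positivity) hSt
  have hSp : S ^ (1 / p) ≤ D * (K ^ (1 / p) * ENNReal.ofReal (ℓ ^ (η / p))) := by
    rw [← ENNReal.mul_le_mul_iff_left hSq0 hSqt]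
    calc S ^ (1 / p) * S ^ (1 / q) = S := by
          rw [← ENNReal.rpow_add_of_nonneg _ _ (by positivity) (by positivity), hpq1,
            ENNReal.rpow_one]
      _ ≤ D * R := hmain
      _ = _ := by rw [hR]; ring
  have hfin := ENNReal.rpow_le_rpow hSp hp0.le
  rw [← ENNReal.rpow_mul, one_div_mul_cancel hp0.ne', ENNReal.rpow_one,
    ENNReal.mul_rpow_of_nonneg D _ hp0.le, ENNReal.mul_rpow_of_nonneg (K ^ (1 / p)) _ hp0.le,
    ← ENNReal.rpow_mul, one_div_mul_cancel hp0.ne', ENNReal.rpow_one, ENNReal.ofReal_rpow_of_pos (by positivity),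
    ← Real.rpow_mul h0.le, div_mul_cancel₀ _ hp0.ne', ← mul_assoc] at hfin
  exact hfin

end Campanato

end

theorem theorem2p2 (p η : ℝ) (hp : 1 < p) (hη : 0 < η) (hηp : η < 1 + p)
    (f : Campanato.Torus → ℂ) (hf : MemLp f (ENNReal.ofReal p) Campanato.arcMeasure) :
    f ∈ Campanato.campanatoSpace p η ↔ Campanato.littlewoodPaleySeminorm p η f < ∞ := by
  have hp0 : 0 < p := by linarith
  rw [Campanato.littlewoodPaleySeminorm_lt_top_iff hp0]
  constructor
  · rintro ⟨-, h⟩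
    obtain ⟨K, hKt, hK⟩ := (Campanato.campanatoSeminorm_lt_top_iff hp0 f).1 h
    exact Campanato.exists_setLIntegral_gsqTrunc_le hp hη hηp hf hKt hK
  · rintro ⟨K, hKt, hK⟩
    exact ⟨hf, (Campanato.campanatoSeminorm_lt_top_iff hp0 f).2
      (Campanato.exists_setLIntegral_oscillation_le hp hη hηp hf hKt hK)⟩
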